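/- Let $m,N\ge 1$ be integers with $N+1\ge m$, let $h=1/N$, and let $p$ be an integrable weight on $[0,1]$. Let $W_2^{(m,m-1)}(0,1)$ be the space of functions $\varphi$ on $[0,1]$ with $\varphi^{(m-1)}$ absolutely continuous and $\varphi^{(m)}\in L_2(0,1)$, with the (semi)norm $\|\varphi\|=\big(\int_0^1(\varphi^{(m)}+\varphi^{(m-1)})^2dx\big)^{1/2}$. The coefficients $C_0,\dots,C_N$ of the quadrature formula $\int_0^1p(x)\varphi(x)\,dx\cong\sum_{\beta=0}^NC_\beta\varphi(h\beta)$ are called optimal if the norm of the error functional, $\sup_{\|\varphi\|=1}\big|\int_0^1p\varphi\,dx-\sum_\beta C_\beta\varphi(h\beta)\big|$, is finite and minimal among all choices of coefficients. Notation. Put $$\psi_m(x)=\tfrac{\operatorname{sign}x}{2}\Big(\tfrac{e^x-e^{-x}}2-\sum_{k=1}^{m-1}\tfrac{x^{2k-1}}{(2k-1)!}\Big),\quad f_m(t)=\int_0^1p(x)\psi_m(x-t)\,dx\ (t\in\mathbb R),$$ $$q_\alpha=\int_0^1p(x)x^\alpha dx\ (0\le\alpha\le m-2),\qquad q=\int_0^1p(x)e^{-x}dx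 .$$ Let $E_0=1$, $E_k(\lambda)=(1+k\lambda)E_{k-1}(\lambda)+\lambda(1-\lambda)E_{k-1}'(\lambda)$ be the Euler(–Frobenius) polynomials, and $$P_{2m-2}(\lambda)=\sum_{s=0}^{2m-2}p_s\lambda^s=(1-e^{2h})(1-\lambda)^{2m-2}-2\big(\lambda(e^{2h}+1)-e^h(\lambda^2+1)\big)\sum_{j=0}^{m-2}\tfrac{h^{2j+1}}{(2j+1)!}(1-\lambda)^{2m-4-2j}E_{2j}(\lambda).$$ Write $p_*=p_{2m-2}$ for its leading coefficient (and $p_{-1}=0$ if $m=1$), let $\lambda_k$ run over the distinct complex roots of $P_{2m-2}$ with $|\lambda_k|<1$, and put $$A_k=\frac{2(1-\lambda_k)^{2m-2}[\lambda_k(e^{2h}+1)-e^h(\lambda_k^2+1)]\,p_*}{\lambda_kP_{2m-2}'(\lambda_k)},\qquad C=1+(2m-2)e^h+e^{2h}+\frac{e^hp_{2m-3}}{p_*}.$$ Define $D_m$ on $h\mathbb Z$ by $p_*D_m(h\beta)=\sum_kA_k\lambda_k^{|\beta|-1}$ for $|\beta|\ge2$, $p_*D_m(h\beta)=-2e^h+\sum_kA_k$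 for $|\beta|=1$, $p_*D_m(0)=2C+\sum_kA_k/\lambda_k$, and let $D_m(h\beta)*g(h\beta)=\sum_{\gamma\in\mathbb Z}D_m(h\beta-h\gamma)g(h\gamma)$. Let $$Q^{(2m-3)}(x)=\frac12\Big[\sum_{k=1}^{[\frac{m+1}2]-1}\sum_{\alpha=0}^{2k-1}+\sum_{k=[\frac{m+1}2]}^{m-1}\sum_{\alpha=0}^{m-2}\Big]\frac{(-1)^\alpha q_\alpha\,x^{2k-1-\alpha}}{(2k-1-\alpha)!\,\alpha!},$$ and, for coefficients $C_0,\dots,C_N$, $$Q_{m-2}(x)=\frac12\sum_{k=[\frac{m+1}2]}^{m-1}\sum_{\alpha=m-1}^{2k-1}\frac{(-1)^\alpha x^{2k-1-\alpha}}{(2k-1-\alpha)!\,\alpha!}\sum_{\gamma=0}^NC_\gamma(h\gamma)^\alpha,\qquad D=\frac14\sum_{\gamma=0}^NC_\gamma e^{h\gamma}.$$ For polynomials $Q^{(\pm)}$ of degree at most $m-2$ (zero if $m=1$) and constants $a^\pm$ put $$L_\gamma=-\tfrac{e^{-h\gamma}}4q+Q^{(2m-3)}(-h\gamma)+Q^{(-)}(-h\gamma)+a^-e^{h\gamma}-f_m(-h\gamma),$$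 $$R_\gamma=\tfrac{e^{1+h\gamma}}4q-Q^{(2m-3)}(1+h\gamma)+Q^{(+)}(1+h\gamma)+a^+e^{-1-h\gamma}-f_m(1+h\gamma),$$ $$a_k=\frac{A_k}{\lambda_kp_*}\sum_{\gamma\ge1}\lambda_k^\gamma L_\gamma,\quad b_k=\frac{A_k}{\lambda_kp_*}\sum_{\gamma\ge1}\lambda_k^\gamma R_\gamma,\quad a=-\frac{2e^h}{p_*}L_1,\quad b=-\frac{2e^h}{p_*}R_1,$$ and let $u(h\beta)=f_m(h\beta)$ for $0\le\beta\le N$, $u(-h\gamma)=f_m(-h\gamma)+L_\gamma$ and $u(1+h\gamma)=f_m(1+h\gamma)+R_\gamma$ for $\gamma\ge1$. Theorem. $P_{2m-2}$ has exactly $m-1$ distinct roots $\lambda_1,\dots,\lambda_{m-1}$ in the open unit disc; the series $D_m(h\beta)*f_m(h\beta)$ and the series in $a_k$, $b_k$ converge; and: (i) If $C_0,\dots,C_N$ are optimal, then there are a polynomial $P$ of degree at most $m-2$ and a constant $d$ such that $$\sum_{\gamma=0}^NC_\gamma\psi_m(h\beta-h\gamma)+P(h\beta)+de^{-h\beta}=f_m(h\beta)\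 (0\le\beta\le N),\quad \sum_{\gamma=0}^NC_\gamma(h\gamma)^\alpha=q_\alpha\ (0\le\alpha\le m-2),\quad\sum_{\gamma=0}^NC_\gamma e^{-h\gamma}=q,$$ and, with $Q^{(\pm)}=P\mp Q_{m-2}$ and $a^\pm=d\mp D$, one has $D_m(h\beta)*u(h\beta)=0$ for all integers $\beta<0$ and $\beta>N$, and $$C_\beta=\begin{cases}D_m(h\beta)*f_m(h\beta)|_{\beta=0}+a+\sum_{k=1}^{m-1}(a_k+b_k\lambda_k^N),&\beta=0,\\ D_m(h\beta)*f_m(h\beta)+\sum_{k=1}^{m-1}(a_k\lambda_k^\beta+b_k\lambda_k^{N-\beta}),&1\le\beta\le N-1,\\ D_m(h\beta)*f_m(h\beta)|_{\beta=N}+b+\sum_{k=1}^{m-1}(a_k\lambda_k^N+b_k),&\beta=N.\end{cases}\qquad(*)$$ (ii) Conversely, if polynomials $Q^{(\pm)}$ of degree at most $m-2$ and constants $a^\pm$ satisfy $D_m(h\beta)*u(h\beta)=0$ for all integers $\beta<0$ and $\beta>N$, then $(*)$ gives optimal coefficients. -/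

import Mathlib

open MeasureTheory
open scoped Polynomial

noncomputable section

namespace OptimalQuadrature

/-! ### The space `W_2^{(m,m-1)}(0,1)` and optimal quadrature formulas -/

/-- `φ` belongs to `W_2^{(m,m-1)}(0,1)`: `φ^{(m-1)}` exists and is absolutely continuous on `[0,1]`,
and `φ^{(m)}` is square integrable (used for `m ≥ 1`). -/
def MemW (m : ℕ) (φ : ℝ → ℝ) : Prop :=
  ContDiffOn ℝ (m - 1 : ℕ) φ (Set.Icc 0 1) ∧
  AbsolutelyContinuousOnInterval (iteratedDerivWithin (m - 1) φ (Set.Icc 0 1)) 0 1 ∧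
  MemLp (iteratedDerivWithin m φ (Set.Icc 0 1)) 2 (volume.restrict (Set.Icc 0 1))

/-- The (semi)norm `(∫₀¹ (φ^{(m)} + φ^{(m-1)})² dx)^{1/2}`. -/
def wNorm (m : ℕ) (φ : ℝ → ℝ) : ℝ :=
  Real.sqrt (∫ x in (0 : ℝ)..1, (iteratedDerivWithin m φ (Set.Icc 0 1) x +
    iteratedDerivWithin (m - 1) φ (Set.Icc 0 1) x) ^ 2)

/-- The grid point `hβ`, `h = 1/N`. -/
def grid (N : ℕ) (β : ℤ) : ℝ := (1 / (N : ℝ)) * β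

/-- The error `(ℓ_N, φ)` of the quadrature formula with weight `p`, nodes `hβ` and coefficients
`c 0, …, c N`. -/
def quadError (N : ℕ) (p : ℝ → ℝ) (c : Fin (N + 1) → ℝ) (φ : ℝ → ℝ) : ℝ :=
  (∫ x in (0 : ℝ)..1, p x * φ x) - ∑ β : Fin (N + 1), c β * φ (grid N (β : ℕ))

/-- The norm of the error functional: the supremum of `|(ℓ_N, φ)|` over `‖φ‖ = 1`, possibly `∞`. -/
def errNorm (m N : ℕ) (p : ℝ → ℝ) (c : Fin (N + 1) → ℝ) : ENNReal :=
  ⨆ (φ : ℝ → ℝ) (_ : MemW m φ) (_ : wNorm m φ = 1), ENNReal.ofReal |quadError N p c φ|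

/-- `c` are optimal coefficients: the error functional is bounded and its norm is the least
possible. -/
def IsOptimal (m N : ℕ) (p : ℝ → ℝ) (c : Fin (N + 1) → ℝ) : Prop :=
  errNorm m N p c ≠ ⊤ ∧ ∀ c' : Fin (N + 1) → ℝ, errNorm m N p c ≤ errNorm m N p c'

/-! ### The functions `ψ_m`, `f_m` and the moments of the weight -/

/-- `ψ_m(x) = (sign x / 2) ((e^x - e^{-x})/2 - ∑_{k=1}^{m-1} x^{2k-1}/(2k-1)!)`. -/
def psi (m : ℕ) (x : ℝ) : ℝ :=
  Real.sign x / 2 * ((Real.exp x - Real.exp (-x)) / 2 -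
    ∑ k ∈ Finset.Icc 1 (m - 1), x ^ (2 * k - 1) / ((2 * k - 1).factorial : ℝ))

/-- `f_m(t) = ∫₀¹ p(x) ψ_m(x - t) dx`, for every real `t`. -/
def fm (m : ℕ) (p : ℝ → ℝ) (t : ℝ) : ℝ := ∫ x in (0 : ℝ)..1, p x * psi m (x - t)

/-- The moment `∫₀¹ p(x) x^α dx`. -/
def moment (p : ℝ → ℝ) (α : ℕ) : ℝ := ∫ x in (0 : ℝ)..1, p x * x ^ α

/-- The exponential moment `∫₀¹ p(x) e^{-x} dx`. -/
def expMoment (p : ℝ → ℝ) : ℝ := ∫ x in (0 : ℝ)..1, p x * Real.exp (-x)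

/-! ### The discrete operator `D_m` -/

/-- The Euler (Euler–Frobenius) polynomials `E_0 = 1`, `E_1 = 1 + λ`, `E_2 = 1 + 4λ + λ²`, …, that
is `E_k(λ) = (1-λ)^{k+2} λ^{-1} (λ d/dλ)^k (λ/(1-λ)²)`. -/
def eulerPoly : ℕ → ℝ[X]
  | 0 => 1
  | k + 1 => (1 + Polynomial.C ((k : ℝ) + 1) * Polynomial.X) * eulerPoly k +
      Polynomial.X * (1 - Polynomial.X) * Polynomial.derivative (eulerPoly k)

/-- The polynomial `P_{2m-2}`; its bracket is
`∑_{j=0}^{m-2} h^{2j+1}/(2j+1)! (1-λ)^{2m-4-2j} E_{2j}(λ)`. -/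
def charP (m : ℕ) (h : ℝ) : ℝ[X] :=
  Polynomial.C (1 - Real.exp (2 * h)) * (1 - Polynomial.X) ^ (2 * m - 2) -
    2 * (Polynomial.C (Real.exp (2 * h) + 1) * Polynomial.X -
      Polynomial.C (Real.exp h) * (Polynomial.X ^ 2 + 1)) *
    ∑ j ∈ Finset.range (m - 1), Polynomial.C (h ^ (2 * j + 1) / ((2 * j + 1).factorial : ℝ)) *
      (1 - Polynomial.X) ^ (2 * m - 4 - 2 * j) * eulerPoly (2 * j)

/-- The coefficient `p = p_{2m-2}^{(2m-2)}` of `λ^{2m-2}` in `P_{2m-2}`. -/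
def leadP (m : ℕ) (h : ℝ) : ℝ := (charP m h).coeff (2 * m - 2)

/-- The coefficient `p_{2m-3}^{(2m-2)}` of `λ^{2m-3}` in `P_{2m-2}` (there is none for `m = 1`). -/
def subleadP (m : ℕ) (h : ℝ) : ℝ := if m = 1 then 0 else (charP m h).coeff (2 * m - 3)

/-- The (distinct, complex) roots `λ_k` of `P_{2m-2}` with `|λ_k| < 1`. -/
def innerRoots (m : ℕ) (h : ℝ) : Finset ℂ :=
  ((charP m h).map (algebraMap ℝ ℂ)).roots.toFinset.filter fun z => ‖z‖ < 1

/-- The constant `C = 1 + (2m-2) e^h + e^{2h} + e^h p_{2m-3}/p_{2m-2}`. -/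
def constC (m : ℕ) (h : ℝ) : ℝ :=
  1 + (2 * (m : ℝ) - 2) * Real.exp h + Real.exp (2 * h) +
    Real.exp h * subleadP m h / leadP m h

/-- `A_k`, as a function of the root `z = λ_k`. -/
def coefA (m : ℕ) (h : ℝ) (z : ℂ) : ℂ :=
  2 * (1 - z) ^ (2 * m - 2) *
      (z * ((Real.exp (2 * h) + 1 : ℝ) : ℂ) - ((Real.exp h : ℝ) : ℂ) * (z ^ 2 + 1)) *
      ((leadP m h : ℝ) : ℂ) /
    (z * Polynomial.aeval z (Polynomial.derivative (charP m h)))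

/-- The discrete analogue `D_m(hβ)` of the operator `d^{2m}/dx^{2m} - d^{2m-2}/dx^{2m-2}`. -/
def discD (m : ℕ) (h : ℝ) (β : ℤ) : ℂ :=
  1 / ((leadP m h : ℝ) : ℂ) *
    (if β = 0 then 2 * ((constC m h : ℝ) : ℂ) + ∑ z ∈ innerRoots m h, coefA m h z / z
    else if β.natAbs = 1 then
      -2 * ((Real.exp h : ℝ) : ℂ) + ∑ z ∈ innerRoots m h, coefA m h z
    else ∑ z ∈ innerRoots m h, coefA m h z * z ^ (β.natAbs - 1))

/-- The discrete convolution `D_m(hβ) * u(hβ) = ∑_γ D_m(hβ - hγ) u(hγ)` over all integers. -/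
def convD (m N : ℕ) (u : ℤ → ℝ) (β : ℤ) : ℂ :=
  ∑' γ : ℤ, discD m (1 / (N : ℝ)) (β - γ) * ((u γ : ℝ) : ℂ)

/-! ### The linear system for the optimal coefficients -/

/-- The system with unknowns `c`, a polynomial `P` of degree at most `m - 2` and a constant `d`. -/
def SolvesSystem (m N : ℕ) (p : ℝ → ℝ) (c : Fin (N + 1) → ℝ) (P : ℝ[X]) (d : ℝ) : Prop :=
  P ∈ Polynomial.degreeLT ℝ (m - 1) ∧
  (∀ β : Fin (N + 1),
    ∑ γ : Fin (N + 1), c γ * psi m (grid N (β : ℕ) - grid N (γ : ℕ)) +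
      P.eval (grid N (β : ℕ)) + d * Real.exp (-grid N (β : ℕ)) = fm m p (grid N (β : ℕ))) ∧
  (∀ α ∈ Finset.range (m - 1),
    ∑ γ : Fin (N + 1), c γ * grid N (γ : ℕ) ^ α = moment p α) ∧
  ∑ γ : Fin (N + 1), c γ * Real.exp (-grid N (γ : ℕ)) = expMoment p

/-- The polynomial `Q^{(2m-3)}`. -/
def polyQ (m : ℕ) (p : ℝ → ℝ) : ℝ[X] :=
  Polynomial.C (1 / 2) *
    (∑ k ∈ Finset.Icc 1 ((m + 1) / 2 - 1), ∑ α ∈ Finset.range (2 * k),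
        Polynomial.C ((-1) ^ α * moment p α /
          (((2 * k - 1 - α).factorial : ℝ) * (α.factorial : ℝ))) * Polynomial.X ^ (2 * k - 1 - α) +
      ∑ k ∈ Finset.Icc ((m + 1) / 2) (m - 1), ∑ α ∈ Finset.range (m - 1),
        Polynomial.C ((-1) ^ α * moment p α /
          (((2 * k - 1 - α).factorial : ℝ) * (α.factorial : ℝ))) * Polynomial.X ^ (2 * k - 1 - α))

/-- The polynomial `Q_{m-2}` belonging to the coefficients `c`. -/
def polyQlow (m N : ℕ) (c : Fin (N + 1) → ℝ) : ℝ[X] :=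
  Polynomial.C (1 / 2) *
    ∑ k ∈ Finset.Icc ((m + 1) / 2) (m - 1), ∑ α ∈ Finset.Icc (m - 1) (2 * k - 1),
      Polynomial.C ((-1) ^ α * (∑ γ : Fin (N + 1), c γ * grid N (γ : ℕ) ^ α) /
        (((2 * k - 1 - α).factorial : ℝ) * (α.factorial : ℝ))) * Polynomial.X ^ (2 * k - 1 - α)

/-- The constant `D = (1/4) ∑ c_γ e^{hγ}`. -/
def constD (N : ℕ) (c : Fin (N + 1) → ℝ) : ℝ :=
  1 / 4 * ∑ γ : Fin (N + 1), c γ * Real.exp (grid N (γ : ℕ))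

/-- The function `u(hβ)` on all integers `β`, given the polynomials `Qm = Q^{(-)}_{m-2}`,
`Qp = Q^{(+)}_{m-2}` and the constants `am = a⁻`, `ap = a⁺`. -/
def uFun (m N : ℕ) (p : ℝ → ℝ) (Qm Qp : ℝ[X]) (am ap : ℝ) (β : ℤ) : ℝ :=
  if β < 0 then
    -(Real.exp (grid N β) / 4) * expMoment p + (polyQ m p).eval (grid N β) +
      Qm.eval (grid N β) + am * Real.exp (-grid N β)
  else if β ≤ N then fm m p (grid N β)
  else
    Real.exp (grid N β) / 4 * expMoment p - (polyQ m p).eval (grid N β) +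
      Qp.eval (grid N β) + ap * Real.exp (-grid N β)

/-- `Qm`, `Qp` (polynomials of degree at most `m - 2`), `am`, `ap` satisfy the equation
`D_m(hβ) * u(hβ) = 0` for all `hβ ∉ [0,1]`. -/
def SolvesOuter (m N : ℕ) (p : ℝ → ℝ) (Qm Qp : ℝ[X]) (am ap : ℝ) : Prop :=
  Qm ∈ Polynomial.degreeLT ℝ (m - 1) ∧ Qp ∈ Polynomial.degreeLT ℝ (m - 1) ∧
  ∀ β : ℤ, (β < 0 ∨ (N : ℤ) < β) →
    HasSum (fun γ : ℤ => discD m (1 / (N : ℝ)) (β - γ) *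
      ((uFun m N p Qm Qp am ap γ : ℝ) : ℂ)) 0

/-! ### The explicit coefficients -/

/-- The bracket `-e^{-hγ}/4 q_{m-1} + Q^{(2m-3)}(-hγ) + Q^{(-)}(-hγ) + a⁻ e^{hγ} - f_m(-hγ)`. -/
def leftTerm (m N : ℕ) (p : ℝ → ℝ) (Qm : ℝ[X]) (am : ℝ) (γ : ℕ) : ℝ :=
  -(Real.exp (-grid N γ) / 4) * expMoment p + (polyQ m p).eval (-grid N γ) +
    Qm.eval (-grid N γ) + am * Real.exp (grid N γ) - fm m p (-grid N γ)

/-- The bracket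
`e^{1+hγ}/4 q_{m-1} - Q^{(2m-3)}(1+hγ) + Q^{(+)}(1+hγ) + a⁺ e^{-1-hγ} - f_m(1+hγ)`. -/
def rightTerm (m N : ℕ) (p : ℝ → ℝ) (Qp : ℝ[X]) (ap : ℝ) (γ : ℕ) : ℝ :=
  Real.exp (1 + grid N γ) / 4 * expMoment p - (polyQ m p).eval (1 + grid N γ) +
    Qp.eval (1 + grid N γ) + ap * Real.exp (-1 - grid N γ) - fm m p (1 + grid N γ)

/-- `a_k`, as a function of the root `z = λ_k`; the summation index is `γ + 1 ≥ 1`. -/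
def coefLeft (m N : ℕ) (p : ℝ → ℝ) (Qm : ℝ[X]) (am : ℝ) (z : ℂ) : ℂ :=
  coefA m (1 / (N : ℝ)) z / (z * ((leadP m (1 / (N : ℝ)) : ℝ) : ℂ)) *
    ∑' γ : ℕ, z ^ (γ + 1) * ((leftTerm m N p Qm am (γ + 1) : ℝ) : ℂ)

/-- `b_k`, as a function of the root `z = λ_k`; the summation index is `γ + 1 ≥ 1`. -/
def coefRight (m N : ℕ) (p : ℝ → ℝ) (Qp : ℝ[X]) (ap : ℝ) (z : ℂ) : ℂ :=
  coefA m (1 / (N : ℝ)) z / (z * ((leadP m (1 / (N : ℝ)) : ℝ) : ℂ)) *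
    ∑' γ : ℕ, z ^ (γ + 1) * ((rightTerm m N p Qp ap (γ + 1) : ℝ) : ℂ)

/-- The boundary term `a`. -/
def boundLeft (m N : ℕ) (p : ℝ → ℝ) (Qm : ℝ[X]) (am : ℝ) : ℝ :=
  -(2 * Real.exp (1 / (N : ℝ)) / leadP m (1 / (N : ℝ))) * leftTerm m N p Qm am 1

/-- The boundary term `b`. -/
def boundRight (m N : ℕ) (p : ℝ → ℝ) (Qp : ℝ[X]) (ap : ℝ) : ℝ :=
  -(2 * Real.exp (1 / (N : ℝ)) / leadP m (1 / (N : ℝ))) * rightTerm m N p Qp ap 1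

/-- The values given by the explicit formula, for `β = 0`, `β = N`, and `1 ≤ β ≤ N - 1`. -/
def explicitCoef (m N : ℕ) (p : ℝ → ℝ) (Qm Qp : ℝ[X]) (am ap : ℝ) (β : ℕ) : ℂ :=
  if β = 0 then
    convD m N (fun γ => fm m p (grid N γ)) 0 + ((boundLeft m N p Qm am : ℝ) : ℂ) +
      ∑ z ∈ innerRoots m (1 / (N : ℝ)),
        (coefLeft m N p Qm am z + coefRight m N p Qp ap z * z ^ N)
  else if β = N then
    convD m N (fun γ => fm m p (grid N γ)) N + ((boundRight m N p Qp ap : ℝ) : ℂ) +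
      ∑ z ∈ innerRoots m (1 / (N : ℝ)),
        (coefLeft m N p Qm am z * z ^ N + coefRight m N p Qp ap z)
  else
    convD m N (fun γ => fm m p (grid N γ)) β +
      ∑ z ∈ innerRoots m (1 / (N : ℝ)),
        (coefLeft m N p Qm am z * z ^ β + coefRight m N p Qp ap z * z ^ (N - β))

end OptimalQuadrature

end

open MeasureTheory
open scoped Polynomial

namespace OptimalQuadrature

/-! ### Iterated primitives of the exponential and of the hyperbolic sine -/

/-! Write m = k + 1 and h = 1/N. The function ψ_m is a fundamental solution of D^{2k}(D² - 1), and
D_m is a discrete inverse of convolution with its samples. The theorem joins a variational argument,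
which turns optimality into a linear system, with a calculus of two-sided sequences, which solves
that system.

Optimality. The seminorm vanishes exactly on polynomials of degree below k plus multiples of e^{-x}.
A formula with finite error norm must be exact there (`isExact_of_errNorm_ne_top`). For exact
formulas the error is the integral of φ^{(m)} + φ^{(m-1)} against a Peano kernel, and the norm is
the L² norm of this kernel (`errNorm_eq`). Optimal coefficients thus minimize a quadratic functional
on an affine space. Since the L² products of such kernels are expressed by ψ_m
(`integral_errKernel_mul_nodeKernel`), the linear system is the system of normal equations
(`exists_solvesSystem_of_isOptimal`, `isOptimal_of_solvesSystem`).

Inverting ψ_m. Let S be the shift and M = -2e^h (1-S)^{2k} (1 - 2 cosh(h) S + S²). M kills samples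
of e^x, e^{-x} and polynomials of degree below 2k, and sends the samples of ψ_m to the coefficients
of λP(λ), P = P_{2m-2} (`act_opPoly_psi`). The explicit form of D_m is a partial fraction expansion
of M/(λP), so S P(S) D_m = M δ (`act_discD`). If P(S) is injective on the sequences in question, D_m
* ψ_m = δ and D_m kills everything M kills. The sequences grow like e^{h|β|}, so both the
convergence of the convolution and the injectivity require |λ_k| < e^{-h}, not merely |λ_k| < 1.

The roots. Up to the factor -2e^h, P(λ) is the value R_{2k}(h, λ) of an exponential Euler spline
(`charP_eq`). For λ < 0 these splines are successive primitives with R_n(0) = λ R_n(h); each has one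
sign change per period, which makes n ↦ R_n(h, ·) a Sturm sequence. All roots are then real,
negative and simple, and the palindromic coefficients put half of them in the unit disc
(`exists_charP_roots`). The bound |λ_k| < e^{-h} comes from writing P(λ) for λ = -e^{-s} as a sum
over the logarithms of λ; if mh ≤ 2, all its terms have, after a common sign, positive real part
(`eval_charP_ne_zero`).

Conclusion. Outside [0,1] the sum ∑ c_γ ψ_m(x - hγ) is an exponential polynomial whose coefficients
are moments of c. If c solves the system, then u = ψ_m * c + P + d e^{-x} on the whole grid and D_m
* u = c, which vanishes outside 0, …, N. Conversely, if D_m * u vanishes there, it defines c, and u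
- ψ_m * c lies in the kernel of M; comparing its expressions on the left and on the right of the
interval yields the exactness conditions (`solvesSystem_of_solvesOuter`). Splitting u into f_m and
its two one-sided corrections gives (*) (`conv_uFun_eq_explicitCoef`). -/

/-- The remainder `e^x - ∑_{j<n} x^j/j!` of the exponential series. -/
noncomputable def expRem (n : ℕ) (x : ℝ) : ℝ :=
  Real.exp x - ∑ j ∈ Finset.range n, x ^ j / (j.factorial : ℝ)

/-- The `n`-th iterated primitive of `sinh` that vanishes at `0` to the highest order. -/
noncomputable def primSinh (n : ℕ) (x : ℝ) : ℝ :=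
  (expRem n x - (-1) ^ n * expRem n (-x)) / 2

/-- The Green function of `D^{k+1} + D^k`. -/
noncomputable def green (k : ℕ) (x : ℝ) : ℝ := (-1) ^ k * expRem k (-x)

@[simp] lemma expRem_zero_left (x : ℝ) : expRem 0 x = Real.exp x := by simp [expRem]

lemma expRem_succ (n : ℕ) (x : ℝ) :
    expRem (n + 1) x = expRem n x - x ^ n / (n.factorial : ℝ) := by
  simp [expRem, Finset.sum_range_succ]; ring

@[simp] lemma expRem_succ_zero (n : ℕ) : expRem (n + 1) 0 = 0 := by
  simp [expRem, Finset.sum_range_succ']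

lemma hasDerivAt_expRem (n : ℕ) (x : ℝ) : HasDerivAt (expRem (n + 1)) (expRem n x) x := by
  induction n with
  | zero =>
    have : expRem 1 = fun x => Real.exp x - 1 := by ext x; simp [expRem]
    simpa [this] using (Real.hasDerivAt_exp x).sub_const 1
  | succ n ih =>
    have h : expRem (n + 2) = fun x => expRem (n + 1) x - x ^ (n + 1) / ((n + 1).factorial : ℝ) := by
      ext x; exact expRem_succ (n + 1) x
    rw [show n + 1 + 1 = n + 2 from rfl, h, expRem_succ n x]
    refine (ih.fun_sub ((hasDerivAt_pow (n + 1) x).div_const ((n + 1).factorial : ℝ))).congr_deriv ?_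
    rw [Nat.factorial_succ]
    push_cast
    have : (n.factorial : ℝ) ≠ 0 := by positivity
    field_simp

lemma continuous_expRem (n : ℕ) : Continuous (expRem n) := by
  unfold expRem; fun_prop

lemma continuous_primSinh (n : ℕ) : Continuous (primSinh n) := by
  have := continuous_expRem n
  unfold primSinh; fun_prop

lemma continuous_green (n : ℕ) : Continuous (green n) := by
  have := continuous_expRem n
  unfold green; fun_prop

lemma abs_expRem_le (n : ℕ) (x : ℝ) : |expRem n x| ≤ 2 * Real.exp |x| := by
  have h1 : |∑ j ∈ Finset.range n, x ^ j / (j.factorial : ℝ)| ≤ Real.exp |x| := by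
    refine (Finset.abs_sum_le_sum_abs _ _).trans ?_
    refine le_trans (le_of_eq ?_) (Real.sum_le_exp_of_nonneg (abs_nonneg x) n)
    refine Finset.sum_congr rfl fun j _ => ?_
    rw [abs_div, abs_pow, Nat.abs_cast]
  have h2 : |Real.exp x| ≤ Real.exp |x| := by
    rw [abs_of_pos (Real.exp_pos x)]; exact Real.exp_le_exp.2 (le_abs_self x)
  unfold expRem
  linarith [abs_sub (Real.exp x) (∑ j ∈ Finset.range n, x ^ j / (j.factorial : ℝ))]

lemma hasDerivAt_primSinh (n : ℕ) (x : ℝ) : HasDerivAt (primSinh (n + 1)) (primSinh n x) x := by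
  have h1 := hasDerivAt_expRem n x
  have h2 := (hasDerivAt_expRem n (-x)).comp x (hasDerivAt_neg x)
  refine ((h1.fun_sub (h2.const_mul ((-1) ^ (n + 1)))).div_const 2).congr_deriv ?_
  unfold primSinh; ring

@[simp] lemma primSinh_apply_zero (n : ℕ) : primSinh n 0 = 0 := by
  cases n <;> simp [primSinh]

lemma abs_primSinh_le (n : ℕ) (x : ℝ) : |primSinh n x| ≤ 2 * Real.exp |x| := by
  have h1 := abs_expRem_le n x
  have h2 := abs_expRem_le n (-x)
  rw [abs_neg] at h2
  unfold primSinh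
  rw [abs_div, abs_two]
  have h3 := abs_sub (expRem n x) ((-1) ^ n * expRem n (-x))
  rw [abs_mul, abs_pow, abs_neg, abs_one, one_pow, one_mul] at h3
  linarith

lemma primSinh_even (k : ℕ) (x : ℝ) :
    primSinh (2 * k) x = (Real.exp x - Real.exp (-x)) / 2 -
      ∑ j ∈ Finset.range k, x ^ (2 * j + 1) / ((2 * j + 1).factorial : ℝ) := by
  induction k with
  | zero => simp [primSinh]
  | succ k ih =>
    rw [Finset.sum_range_succ, ← sub_sub, ← ih]
    rw [show 2 * (k + 1) = 2 * k + 1 + 1 by ring]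
    simp only [primSinh, expRem_succ]
    have e1 : (-1 : ℝ) ^ (2 * k) = 1 := by rw [pow_mul]; norm_num
    have e2 : (-x) ^ (2 * k) = x ^ (2 * k) := Even.neg_pow (by simp) x
    have e3 : (-x) ^ (2 * k + 1) = - x ^ (2 * k + 1) := Odd.neg_pow ⟨k, rfl⟩ x
    rw [pow_succ (-1 : ℝ), pow_succ (-1 : ℝ), e1, e2, e3]
    ring

lemma primSinh_even_neg (k : ℕ) (x : ℝ) : primSinh (2 * k) (-x) = -primSinh (2 * k) x := by
  have e1 : (-1 : ℝ) ^ (2 * k) = 1 := by rw [pow_mul]; norm_num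
  simp only [primSinh, e1, neg_neg]; ring

/-- Since `primSinh (2 * k)` is odd, this exhibits ψ_m as an even function that agrees with plus or
minus half of one analytic function on each half line. All later uses of ψ_m rest on this. -/
lemma psi_succ (k : ℕ) (x : ℝ) : psi (k + 1) x = Real.sign x / 2 * primSinh (2 * k) x := by
  rw [primSinh_even, psi, Finset.sum_bij (s := Finset.range k) (t := Finset.Icc 1 (k + 1 - 1))
    (g := fun k => x ^ (2 * k - 1) / ((2 * k - 1).factorial : ℝ)) (fun j _ => j + 1)]
  · intro j hj; simp at hj ⊢; omega
  · intro a _ b _ h; omega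
  · intro b hb
    simp at hb
    exact ⟨b - 1, by simp; omega, by omega⟩
  · intro j _
    rw [show 2 * (j + 1) - 1 = 2 * j + 1 by omega]

lemma psi_neg (k : ℕ) (x : ℝ) : psi (k + 1) (-x) = psi (k + 1) x := by
  rw [psi_succ, psi_succ, primSinh_even_neg, Real.sign_neg]; ring

lemma abs_sign_le (x : ℝ) : |Real.sign x| ≤ 1 := by
  rcases Real.sign_apply_eq x with h | h | h <;> simp [h]

lemma abs_psi_le (k : ℕ) (x : ℝ) : |psi (k + 1) x| ≤ Real.exp |x| := by
  rw [psi_succ, abs_mul, abs_div, abs_two]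
  have := abs_primSinh_le (2 * k) x
  have h2 := abs_sign_le x
  calc |Real.sign x| / 2 * |primSinh (2 * k) x| ≤ 1 / 2 * (2 * Real.exp |x|) := by gcongr
    _ = _ := by ring

lemma psi_of_nonneg (k : ℕ) {x : ℝ} (hx : 0 ≤ x) : psi (k + 1) x = primSinh (2 * k) x / 2 := by
  rcases hx.eq_or_lt with rfl | hx
  · simp [psi_succ]
  · rw [psi_succ, Real.sign_of_pos hx]; ring

lemma psi_of_nonpos (k : ℕ) {x : ℝ} (hx : x ≤ 0) : psi (k + 1) x = -primSinh (2 * k) x / 2 := by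
  rw [← psi_neg, psi_of_nonneg k (by linarith), primSinh_even_neg]

lemma continuous_psi (k : ℕ) : Continuous (psi (k + 1)) := by
  have : psi (k + 1) = fun x => primSinh (2 * k) |x| / 2 := by
    ext x
    rcases le_total 0 x with h | h
    · rw [abs_of_nonneg h, psi_of_nonneg k h]
    · rw [abs_of_nonpos h, psi_of_nonpos k h, primSinh_even_neg]
  rw [this]
  exact ((continuous_primSinh _).comp continuous_abs).div_const 2

/-! ### The Green function of `D^{k+1} + D^k` -/

@[simp] lemma green_zero_left (x : ℝ) : green 0 x = Real.exp (-x) := by simp [green]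

@[simp] lemma green_succ_zero (k : ℕ) : green (k + 1) 0 = 0 := by simp [green]

lemma hasDerivAt_green (k : ℕ) (x : ℝ) : HasDerivAt (green (k + 1)) (green k x) x := by
  have h2 := (hasDerivAt_expRem k (-x)).comp x (hasDerivAt_neg x)
  refine (h2.const_mul ((-1) ^ (k + 1))).congr_deriv ?_
  unfold green; ring

/-- `green k` is the fundamental solution of D^k(D + 1), so D + 1 turns it into that of D^k, the
Taylor kernel of order k. For k = 0 nothing remains. -/
lemma hasDerivAt_green_self (k : ℕ) (x : ℝ) :
    HasDerivAt (green k) (-green k x + if k = 0 then 0 else x ^ (k - 1) / ((k - 1).factorial : ℝ))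
      x := by
  cases k with
  | zero =>
    have : green 0 = fun x => Real.exp (-x) := by ext; simp
    rw [this]
    simpa using (hasDerivAt_neg x).exp
  | succ k =>
    refine (hasDerivAt_green k x).congr_deriv ?_
    simp only [green, expRem_succ, Nat.succ_ne_zero, if_false, Nat.add_sub_cancel]
    rw [neg_pow x k, pow_succ]
    have : ((-1 : ℝ) ^ k) * (-1) ^ k = 1 := by rw [← mul_pow]; simp
    linear_combination (x ^ k / (k.factorial : ℝ)) * this

/-- Factor D^k(D² - 1) as (D - 1) times D^k(D + 1): applying D - 1 to the fundamental solution of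
the product leaves `green k`. -/
lemma hasDerivAt_primSinh_self (k : ℕ) (x : ℝ) :
    HasDerivAt (primSinh k) (primSinh k x + green k x) x := by
  cases k with
  | zero =>
    have : primSinh 0 = fun x => (Real.exp x - Real.exp (-x)) / 2 := by ext; simp [primSinh]
    rw [this]
    refine (((Real.hasDerivAt_exp x).fun_sub (hasDerivAt_neg x).exp).div_const 2).congr_deriv ?_
    simp; ring
  | succ k =>
    refine (hasDerivAt_primSinh k x).congr_deriv ?_
    simp only [green, primSinh, expRem_succ]
    rw [neg_pow x k, pow_succ]
    have : ((-1 : ℝ) ^ k) * (-1) ^ k = 1 := by rw [← mul_pow]; simp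
    linear_combination -(x ^ k / (k.factorial : ℝ)) / 2 * this

/-- The convolution of the Green functions of `D^{k+1} + D^k` and `D^{l+1} - D^l`. -/
lemma integral_green_mul_expRem (k l : ℕ) (s : ℝ) :
    ∫ t in (0 : ℝ)..s, green k t * expRem l (s - t) = primSinh (k + l) s := by
  induction l generalizing k with
  | zero =>
    have h : ∀ t ∈ Set.uIcc 0 s, HasDerivAt (fun t => primSinh k t * Real.exp (s - t))
        (green k t * expRem 0 (s - t)) t := by
      intro t _
      have h1 := (hasDerivAt_primSinh_self k t).mul
        (((hasDerivAt_id t).const_sub s).exp)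
      refine h1.congr_deriv ?_
      simp; ring
    rw [intervalIntegral.integral_eq_sub_of_hasDerivAt h]
    · simp
    · apply Continuous.intervalIntegrable
      have := continuous_green k
      have := continuous_expRem 0
      fun_prop
  -- Integration by parts moves one primitive from `expRem` to `green`. The boundary terms vanish
  -- because both functions of positive index are zero at 0.
  | succ l ih =>
    have := intervalIntegral.integral_mul_deriv_eq_deriv_mul (a := 0) (b := s)
      (u := fun t => expRem (l + 1) (s - t)) (v := green (k + 1))
      (u' := fun t => -expRem l (s - t)) (v' := green k)
      (fun t _ => by
        have := (hasDerivAt_expRem l (s - t)).comp t ((hasDerivAt_id t).const_sub s)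
        exact this.congr_deriv (by simp))
      (fun t _ => hasDerivAt_green k t)
      (by
        apply Continuous.intervalIntegrable
        have := continuous_expRem l
        fun_prop)
      ((continuous_green k).intervalIntegrable _ _)
    simp only [sub_self, expRem_succ_zero, green_succ_zero, zero_mul, mul_zero, zero_sub,
      neg_mul, intervalIntegral.integral_neg, neg_neg] at this
    rw [show k + (l + 1) = k + 1 + l by ring, ← ih (k + 1)]
    simp_rw [mul_comm (green _ _)]
    exact this

end OptimalQuadrature

namespace OptimalQuadrature

/-! ### One sign change per period -/

/-- `f` has, up to the factor `s`, exactly one sign change on `[0, h)`, located at `y`. -/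
def OneChange (h : ℝ) (f : ℝ → ℝ) (s y : ℝ) : Prop :=
  s ≠ 0 ∧ y ∈ Set.Ico 0 h ∧ (∀ x ∈ Set.Ico 0 y, s * f x < 0) ∧ ∀ x ∈ Set.Ioo y h, 0 < s * f x

lemma strictMonoOn_of_hasDerivAt {f F : ℝ → ℝ} {a b : ℝ} (hF : ∀ x, HasDerivAt F (f x) x)
    (hpos : ∀ x ∈ Set.Ioo a b, 0 < f x) : StrictMonoOn F (Set.Icc a b) := by
  refine strictMonoOn_of_deriv_pos (convex_Icc a b)
    (fun x _ => (hF x).continuousAt.continuousWithinAt) fun x hx => ?_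
  rw [interior_Icc] at hx
  rw [(hF x).deriv]
  exact hpos x hx

lemma strictAntiOn_of_hasDerivAt {f F : ℝ → ℝ} {a b : ℝ} (hF : ∀ x, HasDerivAt F (f x) x)
    (hneg : ∀ x ∈ Set.Ioo a b, f x < 0) : StrictAntiOn F (Set.Icc a b) := by
  refine strictAntiOn_of_deriv_neg (convex_Icc a b)
    (fun x _ => (hF x).continuousAt.continuousWithinAt) fun x hx => ?_
  rw [interior_Icc] at hx
  rw [(hF x).deriv]
  exact hneg x hx

/-- F falls on [0, y] and rises on [y, h], while F(0) and F(h) have opposite signs or both vanish.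
If F(h) < 0 the only zero lies on the falling branch, if F(h) > 0 on the rising branch, and if F(h)
= 0 it is the point 0. -/
lemma exists_oneChange_of_pos {h l : ℝ} (hl : l < 0) {f F : ℝ → ℝ}
    (hF : ∀ x, HasDerivAt F (f x) x) (hb : F 0 = l * F h) {y : ℝ} (hy : y ∈ Set.Ico 0 h)
    (hneg : ∀ x ∈ Set.Ioo 0 y, f x < 0) (hpos : ∀ x ∈ Set.Ioo y h, 0 < f x) :
    ∃ s y', OneChange h F s y' := by
  have hcont : Continuous F := continuous_iff_continuousAt.2 fun x => (hF x).continuousAt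
  have hA := strictAntiOn_of_hasDerivAt hF hneg
  have hM := strictMonoOn_of_hasDerivAt hF hpos
  obtain ⟨hy0, hyh⟩ := hy
  rcases lt_trichotomy (F h) 0 with hh | hh | hh
  · have h0 : 0 < F 0 := by rw [hb]; exact mul_pos_of_neg_of_neg hl hh
    have hFy : F y < 0 := (hM ⟨le_rfl, hyh.le⟩ ⟨hyh.le, le_rfl⟩ hyh).trans hh
    obtain ⟨z, hz, hz0⟩ := intermediate_value_Icc' hy0 hcont.continuousOn
      (show (0 : ℝ) ∈ Set.Icc (F y) (F 0) from ⟨hFy.le, h0.le⟩)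
    have hzy : z < y := lt_of_le_of_ne hz.2 (by rintro rfl; linarith)
    refine ⟨-1, z, by norm_num, ⟨hz.1, hzy.trans hyh⟩, fun x hx => ?_, fun x hx => ?_⟩
    · have := hA ⟨hx.1, (hx.2.trans hzy).le⟩ hz hx.2
      linarith
    · rcases le_total x y with hxy | hxy
      · have := hA hz ⟨hz.1.trans hx.1.le, hxy⟩ hx.1
        linarith
      · have := hM ⟨hxy, hx.2.le⟩ ⟨hyh.le, le_rfl⟩ hx.2
        linarith
  · have h0 : F 0 = 0 := by rw [hb, hh, mul_zero]
    refine ⟨-1, 0, by norm_num, ⟨le_rfl, hy0.trans_lt hyh⟩, fun x hx => ?_, fun x hx => ?_⟩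
    · exact absurd (hx.1.trans_lt hx.2) (lt_irrefl _)
    · rcases le_total x y with hxy | hxy
      · have := hA ⟨le_rfl, hy0⟩ ⟨hx.1.le, hxy⟩ hx.1
        linarith
      · have := hM ⟨hxy, hx.2.le⟩ ⟨hyh.le, le_rfl⟩ hx.2
        linarith
  · have h0 : F 0 < 0 := by rw [hb]; exact mul_neg_of_neg_of_pos hl hh
    have hFy : F y < 0 := by
      rcases hy0.eq_or_lt with rfl | hy0'
      · exact h0
      · exact (hA ⟨le_rfl, hy0⟩ ⟨hy0, le_rfl⟩ hy0').trans h0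
    obtain ⟨z, hz, hz0⟩ := intermediate_value_Icc hyh.le hcont.continuousOn
      (show (0 : ℝ) ∈ Set.Icc (F y) (F h) from ⟨hFy.le, hh.le⟩)
    have hzh : z < h := lt_of_le_of_ne hz.2 (by rintro rfl; linarith)
    refine ⟨1, z, by norm_num, ⟨hy0.trans hz.1, hzh⟩, fun x hx => ?_, fun x hx => ?_⟩
    · rcases le_total x y with hxy | hxy
      · have := hA.antitoneOn ⟨le_rfl, hy0⟩ ⟨hx.1, hxy⟩ hx.1
        linarith
      · have := hM ⟨hxy, (hx.2.trans hzh).le⟩ hz hx.2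
        linarith
    · have := hM hz ⟨hz.1.trans hx.1.le, hx.2.le⟩ hx.1
      linarith

lemma OneChange.primitive {h l : ℝ} (hl : l < 0) {f F : ℝ → ℝ} {c : ℝ} (hc : 0 < c)
    (hF : ∀ x, HasDerivAt F (c * f x) x) (hb : F 0 = l * F h) {s y : ℝ}
    (hf : OneChange h f s y) : ∃ s' y', OneChange h F s' y' := by
  obtain ⟨hs, hy, hneg, hpos⟩ := hf
  obtain ⟨s', y', hs', hy', h1, h2⟩ := exists_oneChange_of_pos (h := h) hl
    (f := fun x => s * (c * f x)) (F := fun x => s * F x) (fun x => (hF x).const_mul s)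
    (by rw [hb]; ring) hy
    (fun x hx => by
      have := hneg x ⟨hx.1.le, hx.2⟩
      nlinarith)
    (fun x hx => by
      have := hpos x hx
      have := mul_pos hc this
      linarith)
  refine ⟨s' * s, y', mul_ne_zero hs' hs, hy', fun x hx => ?_, fun x hx => ?_⟩
  · rw [mul_assoc]; exact h1 x hx
  · rw [mul_assoc]; exact h2 x hx

/-- The Sturm property for three consecutive members of a chain of quasi-periodic primitives. -/
lemma OneChange.sturm {h l : ℝ} (hh : 0 < h) (hl : l < 0) {c : ℝ} (hc : 0 < c) {f F G : ℝ → ℝ}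
    (hF : ∀ x, HasDerivAt F (c * f x) x) (hG : ∀ x, HasDerivAt G (c * F x) x)
    (hfb : f 0 = l * f h) (hFb : F 0 = l * F h) (hGb : G 0 = l * G h) {s y : ℝ}
    (hf : OneChange h f s y) (hFh : F h = 0) : G h * f h < 0 := by
  obtain ⟨s', y', hF'⟩ := hf.primitive hl hc hF hFb
  have hF0 : F 0 = 0 := by rw [hFb, hFh, mul_zero]
  obtain ⟨hs', hy', hneg', hpos'⟩ := hF'
  have hy'0 : y' = 0 := by
    by_contra hne
    have := hneg' 0 ⟨le_rfl, lt_of_le_of_ne hy'.1 (Ne.symm hne)⟩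
    simp [hF0] at this
  subst hy'0
  -- F vanishes at both ends and `s' * F` is positive in between, so `s' * G` increases; as G(0) = l
  -- G(h) with l < 0, the sign of G(h) follows.
  have hGh : 0 < s' * G h := by
    have hm := strictMonoOn_of_hasDerivAt (a := 0) (b := h) (F := fun x => s' * G x)
      (fun x => (hG x).const_mul s') (fun x hx => by
        have := mul_pos hc (hpos' x hx); linarith)
    have := hm ⟨le_rfl, hh.le⟩ ⟨hh.le, le_rfl⟩ hh
    simp only [hGb] at this
    nlinarith
  obtain ⟨hs, hy, hneg, hpos⟩ := hf
  -- Were y = 0, f would keep one sign on (0, h) and F would be strictly monotone, although it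
  -- vanishes at both ends.
  have hy0 : 0 < y := by
    rcases hy.1.eq_or_lt with h0 | h0
    · subst h0
      have hm := strictMonoOn_of_hasDerivAt (a := 0) (b := h) (F := fun x => s * F x)
        (fun x => (hF x).const_mul s) (fun x hx => by
          have := mul_pos hc (hpos x hx); linarith)
      have := hm ⟨le_rfl, hh.le⟩ ⟨hh.le, le_rfl⟩ hh
      simp [hF0, hFh] at this
    · exact h0
  have hfh : 0 < s * f h := by
    have := hneg 0 ⟨le_rfl, hy0⟩
    rw [hfb] at this
    nlinarith
  have hFy : s * F y < 0 := by
    have hm := strictAntiOn_of_hasDerivAt (a := 0) (b := y) (F := fun x => s * F x)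
      (fun x => (hF x).const_mul s) (fun x hx => by
        have := hneg x ⟨hx.1.le, hx.2⟩
        nlinarith)
    have := hm ⟨le_rfl, hy0.le⟩ ⟨hy0.le, le_rfl⟩ hy0
    simpa [hF0] using this
  have hFy' := hpos' y ⟨hy0, hy.2⟩
  -- The signs of s and s' are opposite: at y the product `s * F` is negative and `s' * F` is
  -- positive. So the two positive numbers `s' * G h` and `s * f h` force G(h) f(h) < 0.
  have e : s * s' * (G h * f h) = (s' * G h) * (s * f h) := by ring
  have e2 : (s * s') * (F y) ^ 2 < 0 := by nlinarith [mul_neg_of_neg_of_pos hFy hFy']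
  have hss : s * s' < 0 := by
    by_contra hcon
    nlinarith [sq_nonneg (F y)]
  have := mul_pos hGh hfh
  by_contra hcon
  nlinarith

/-! ### Coefficients of the exponential Euler splines -/

/-- Coefficients (with respect to `λ`) of the exponential Euler splines of `D^n (D² - 1)` with
step `h`: the polynomials `R_n(x, λ) = ∑ᵢ splineCoef h n i x λ^i` satisfy
`∂R_{n+1}/∂x = (1 - λ) R_n` and `R_n(0, λ) = λ R_n(h, λ)`. -/
noncomputable def splineCoef (h : ℝ) : ℕ → ℕ → ℝ → ℝ
  | 0, i, x => if i = 0 then Real.sinh x else if i = 1 then Real.sinh (h - x) else 0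
  | n + 1, i, x => (∫ y in (0 : ℝ)..x, splineCoef h n i y) +
      if i = 0 then 0 else ∫ y in x..h, splineCoef h n (i - 1) y

lemma continuous_splineCoef (h : ℝ) (n i : ℕ) : Continuous (splineCoef h n i) := by
  induction n generalizing i with
  | zero =>
    have e : splineCoef h 0 i =
        fun x => if i = 0 then Real.sinh x else if i = 1 then Real.sinh (h - x) else 0 := by
      ext x; rw [splineCoef]
    rw [e]
    split_ifs
    · exact Real.continuous_sinh
    · exact Real.continuous_sinh.comp (by fun_prop)
    · exact continuous_const
  | succ n ih =>
    have e : splineCoef h (n + 1) i = fun x => (∫ y in (0 : ℝ)..x, splineCoef h n i y) +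
        if i = 0 then 0 else ∫ y in x..h, splineCoef h n (i - 1) y := by
      ext x; rw [splineCoef]
    rw [e]
    refine Continuous.add (intervalIntegral.continuous_primitive
      (fun a b => (ih i).intervalIntegrable a b) 0) ?_
    split_ifs
    · exact continuous_const
    · have := intervalIntegral.continuous_primitive
        (fun a b => (ih (i - 1)).intervalIntegrable (μ := volume) a b) h
      simp_rw [fun x => intervalIntegral.integral_symm (μ := volume)
        (f := splineCoef h n (i - 1)) h x]
      exact this.neg

lemma hasDerivAt_splineCoef (h : ℝ) (n i : ℕ) (x : ℝ) :
    HasDerivAt (splineCoef h (n + 1) i)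
      (splineCoef h n i x - if i = 0 then 0 else splineCoef h n (i - 1) x) x := by
  have h1 := intervalIntegral.integral_hasDerivAt_right
    ((continuous_splineCoef h n i).intervalIntegrable 0 x)
    ((continuous_splineCoef h n i).stronglyMeasurableAtFilter _ _)
    (continuous_splineCoef h n i).continuousAt
  have h2 := intervalIntegral.integral_hasDerivAt_left
    ((continuous_splineCoef h n (i - 1)).intervalIntegrable x h)
    ((continuous_splineCoef h n (i - 1)).stronglyMeasurableAtFilter _ _)
    (continuous_splineCoef h n (i - 1)).continuousAt
  have e : splineCoef h (n + 1) i = fun x => (∫ y in (0 : ℝ)..x, splineCoef h n i y) +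
      if i = 0 then 0 else ∫ y in x..h, splineCoef h n (i - 1) y := by
    ext x; rw [splineCoef]
  rw [e]
  split_ifs with hi
  · simpa using h1
  · exact (h1.fun_add h2).congr_deriv (sub_eq_add_neg _ _).symm

lemma splineCoef_eq_zero (h : ℝ) {n i : ℕ} (hi : n + 1 < i) (x : ℝ) : splineCoef h n i x = 0 := by
  induction n generalizing i x with
  | zero => simp [splineCoef, show i ≠ 0 by omega, show i ≠ 1 by omega]
  | succ n ih =>
    have h1 := fun y => ih (i := i) (by omega) y
    have h2 := fun y => ih (i := i - 1) (by omega) y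
    simp [splineCoef, h1, h2]

lemma splineCoef_last (h : ℝ) (n : ℕ) : splineCoef h n (n + 1) h = 0 := by
  cases n with
  | zero => simp [splineCoef]
  | succ n =>
    have h1 := fun y => splineCoef_eq_zero h (n := n) (i := n + 1 + 1) (by omega) y
    simp [splineCoef, h1]

lemma splineCoef_first (h : ℝ) (n : ℕ) : splineCoef h n 0 0 = 0 := by
  cases n <;> simp [splineCoef]

/-- This is the coefficient form of R_n(0, λ) = λ R_n(h, λ). -/
lemma splineCoef_boundary (h : ℝ) (n i : ℕ) :
    splineCoef h n (i + 1) 0 = splineCoef h n i h := by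
  cases n with
  | zero => rcases i with _ | _ | i <;> simp [splineCoef]
  | succ n => by_cases hi : i = 0 <;> simp [splineCoef]

lemma splineCoef_nonneg {h : ℝ} (n i : ℕ) {x : ℝ} (hx : x ∈ Set.Icc 0 h) :
    0 ≤ splineCoef h n i x := by
  induction n generalizing i x with
  | zero =>
    unfold splineCoef
    split_ifs
    · exact Real.sinh_nonneg_iff.2 hx.1
    · exact Real.sinh_nonneg_iff.2 (by linarith [hx.2])
    · exact le_rfl
  | succ n ih =>
    unfold splineCoef
    refine add_nonneg (intervalIntegral.integral_nonneg hx.1 fun y hy =>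
      ih i ⟨hy.1, hy.2.trans hx.2⟩) ?_
    split_ifs
    · exact le_rfl
    · exact intervalIntegral.integral_nonneg hx.2 fun y hy => ih _ ⟨hx.1.trans hy.1, hy.2⟩

lemma splineCoef_pos {h : ℝ} (n : ℕ) {i : ℕ} (hi : i ≤ n + 1) {x : ℝ} (hx : x ∈ Set.Ioo 0 h) :
    0 < splineCoef h n i x := by
  induction n generalizing i x with
  | zero =>
    unfold splineCoef
    split_ifs
    · exact Real.sinh_pos_iff.2 hx.1
    · exact Real.sinh_pos_iff.2 (by linarith [hx.2])
    · omega
  | succ n ih =>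
    unfold splineCoef
    rcases Nat.lt_or_ge i (n + 2) with h1 | h1
    · refine add_pos_of_pos_of_nonneg (intervalIntegral.intervalIntegral_pos_of_pos_on
        ((continuous_splineCoef h n i).intervalIntegrable _ _)
        (fun y hy => ih (by omega) ⟨hy.1, hy.2.trans hx.2⟩) hx.1) ?_
      split_ifs
      · exact le_rfl
      · exact intervalIntegral.integral_nonneg hx.2.le fun y hy =>
          splineCoef_nonneg n _ ⟨hx.1.le.trans hy.1, hy.2⟩
    · rw [if_neg (by omega)]
      refine add_pos_of_nonneg_of_pos (intervalIntegral.integral_nonneg hx.1.le fun y hy =>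
          splineCoef_nonneg n _ ⟨hy.1, hy.2.trans hx.2.le⟩)
        (intervalIntegral.intervalIntegral_pos_of_pos_on
        ((continuous_splineCoef h n (i - 1)).intervalIntegrable _ _)
        (fun y hy => ih (by omega) ⟨hx.1.trans hy.1, hy.2⟩) hx.2)

lemma splineCoef_right_pos {h : ℝ} (hh : 0 < h) (n : ℕ) {i : ℕ} (hi : i ≤ n) :
    0 < splineCoef h n i h := by
  cases n with
  | zero =>
    obtain rfl : i = 0 := by omega
    simpa [splineCoef] using hh
  | succ n =>
    have := intervalIntegral.intervalIntegral_pos_of_pos_on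
      ((continuous_splineCoef h n i).intervalIntegrable (μ := volume) 0 h)
      (fun y hy => splineCoef_pos n hi hy) hh
    simpa [splineCoef] using this

/-- The substitution y ↦ h - y exchanges the two integrals of the recursion. At x = 0 this makes the
polynomial R_n(h, ·) palindromic, which pairs each root with its inverse. -/
lemma splineCoef_reflect (h : ℝ) (n : ℕ) {i : ℕ} (hi : i ≤ n + 1) (x : ℝ) :
    splineCoef h n i (h - x) = splineCoef h n (n + 1 - i) x := by
  induction n generalizing i x with
  | zero =>
    rcases i with _ | _ | i
    · simp [splineCoef]
    · simp [splineCoef]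
    · omega
  | succ n ih =>
    have e1 : ∫ y in (0 : ℝ)..(h - x), splineCoef h n i y =
        if n + 1 + 1 - i = 0 then 0 else
          ∫ y in x..h, splineCoef h n (n + 1 + 1 - i - 1) y := by
      split_ifs with h0
      · simp [splineCoef_eq_zero h (show n + 1 < i by omega)]
      · have := intervalIntegral.integral_comp_sub_left (a := x) (b := h)
          (fun y => splineCoef h n i y) h
        rw [sub_self] at this
        rw [← this]
        refine intervalIntegral.integral_congr fun y _ => ?_
        rw [ih (by omega)]
        congr 1; omega
    have e2 : (if i = 0 then 0 else ∫ y in (h - x)..h, splineCoef h n (i - 1) y) =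
        ∫ y in (0 : ℝ)..x, splineCoef h n (n + 1 + 1 - i) y := by
      split_ifs with h0
      · simp [splineCoef_eq_zero h (show n + 1 < n + 1 + 1 - i by omega)]
      · have := intervalIntegral.integral_comp_sub_left (a := 0) (b := x)
          (fun y => splineCoef h n (i - 1) y) h
        rw [sub_zero] at this
        rw [← this]
        refine intervalIntegral.integral_congr fun y _ => ?_
        rw [ih (by omega)]
        congr 1; omega
    rw [splineCoef, splineCoef, e1, e2, add_comm]

lemma splineCoef_palindrome (h : ℝ) (n : ℕ) {i : ℕ} (hi : i ≤ n) :
    splineCoef h n i h = splineCoef h n (n - i) h := by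
  have := splineCoef_reflect h n (i := i) (by omega) 0
  rw [sub_zero, show n + 1 - i = n - i + 1 by omega, splineCoef_boundary] at this
  exact this

/-- The exponential Euler spline `R_n(x, l)`. -/
noncomputable def eulerSpline (h : ℝ) (n : ℕ) (l x : ℝ) : ℝ :=
  ∑ i ∈ Finset.range (n + 2), splineCoef h n i x * l ^ i

/-- The values `R_n(h, λ)` as a polynomial in `λ`. -/
noncomputable def eulerSplinePoly (h : ℝ) (n : ℕ) : ℝ[X] :=
  ∑ i ∈ Finset.range (n + 1), Polynomial.C (splineCoef h n i h) * Polynomial.X ^ i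

lemma coeff_eulerSplinePoly (h : ℝ) (n i : ℕ) :
    (eulerSplinePoly h n).coeff i = splineCoef h n i h := by
  simp only [eulerSplinePoly, Polynomial.finsetSum_coeff, Polynomial.coeff_C_mul,
    Polynomial.coeff_X_pow, mul_ite, mul_one, mul_zero, Finset.sum_ite_eq, Finset.mem_range]
  split_ifs with hi
  · rfl
  · rcases Nat.lt_or_ge (n + 1) i with h1 | h1
    · rw [splineCoef_eq_zero h h1]
    · rw [show i = n + 1 by omega, splineCoef_last]

lemma eval_eulerSplinePoly (h : ℝ) (n : ℕ) (l : ℝ) :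
    (eulerSplinePoly h n).eval l = eulerSpline h n l h := by
  rw [eulerSpline, Finset.sum_range_succ, splineCoef_last, zero_mul, add_zero, eulerSplinePoly,
    Polynomial.eval_finsetSum]
  simp

lemma eulerSpline_zero (h : ℝ) (n : ℕ) (l : ℝ) :
    eulerSpline h n l 0 = l * eulerSpline h n l h := by
  rw [eulerSpline, Finset.sum_range_succ', splineCoef_first, eulerSpline,
    Finset.sum_range_succ (fun i => splineCoef h n i h * l ^ i), splineCoef_last, zero_mul, zero_mul, add_zero, add_zero, Finset.mul_sum]
  refine Finset.sum_congr rfl fun i _ => ?_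
  rw [splineCoef_boundary]; ring

lemma hasDerivAt_eulerSpline (h : ℝ) (n : ℕ) (l x : ℝ) :
    HasDerivAt (eulerSpline h (n + 1) l) ((1 - l) * eulerSpline h n l x) x := by
  have h1 : HasDerivAt (eulerSpline h (n + 1) l) (∑ i ∈ Finset.range (n + 1 + 2),
      (splineCoef h n i x - if i = 0 then 0 else splineCoef h n (i - 1) x) * l ^ i) x :=
    HasDerivAt.fun_sum fun i _ => (hasDerivAt_splineCoef h n i x).mul_const (l ^ i)
  refine h1.congr_deriv ?_
  simp only [sub_mul, Finset.sum_sub_distrib, one_mul]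
  congr 1
  · rw [eulerSpline, Finset.sum_range_succ _ (n + 2), splineCoef_eq_zero h (by omega)]
    simp
  · rw [eulerSpline, Finset.sum_range_succ' _ (n + 2), Finset.mul_sum]
    simp only [Nat.succ_ne_zero, if_false, if_true, Nat.add_sub_cancel, zero_mul, add_zero]
    exact Finset.sum_congr rfl fun i _ => by ring

/-- For l < 0 the derivative of R_0 is cosh x - l cosh(h - x) > 0, and every further spline is a
positive multiple of a quasi-periodic primitive of its predecessor. -/
lemma exists_oneChange_eulerSpline {h : ℝ} (hh : 0 < h) (n : ℕ) {l : ℝ} (hl : l < 0) :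
    ∃ s y, OneChange h (eulerSpline h n l) s y := by
  induction n with
  | zero =>
    have hd : ∀ x, HasDerivAt (eulerSpline h 0 l) (Real.cosh x - l * Real.cosh (h - x)) x := by
      intro x
      have e : eulerSpline h 0 l = fun x => Real.sinh x + Real.sinh (h - x) * l := by
        ext x; simp [eulerSpline, splineCoef, Finset.sum_range_succ]
      rw [e]
      refine ((Real.hasDerivAt_sinh x).add
        ((((hasDerivAt_id x).const_sub h).sinh).mul_const l)).congr_deriv ?_
      simp; ring
    refine exists_oneChange_of_pos hl hd (eulerSpline_zero h 0 l) (y := 0) ⟨le_rfl, hh⟩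
      (fun x hx => absurd (hx.1.trans hx.2) (lt_irrefl _)) (fun x _ => ?_)
    nlinarith [Real.cosh_pos x, Real.cosh_pos (h - x)]
  | succ n ih =>
    obtain ⟨s, y, hs⟩ := ih
    exact hs.primitive hl (by linarith) (hasDerivAt_eulerSpline h n l) (eulerSpline_zero h _ l)

/-- The polynomials `R_n(h, ·)` form a Sturm sequence on the negative half line. -/
lemma eulerSplinePoly_sturm {h : ℝ} (hh : 0 < h) (n : ℕ) {l : ℝ} (hl : l < 0)
    (h0 : (eulerSplinePoly h (n + 1)).eval l = 0) :
    (eulerSplinePoly h (n + 2)).eval l * (eulerSplinePoly h n).eval l < 0 := by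
  rw [eval_eulerSplinePoly] at h0 ⊢
  rw [eval_eulerSplinePoly]
  obtain ⟨s, y, hs⟩ := exists_oneChange_eulerSpline hh n hl
  exact hs.sturm hh hl (c := 1 - l) (by linarith) (hasDerivAt_eulerSpline h n l)
    (hasDerivAt_eulerSpline h (n + 1) l) (eulerSpline_zero h _ l) (eulerSpline_zero h _ l)
    (eulerSpline_zero h _ l) h0

end OptimalQuadrature

namespace OptimalQuadrature

/-! ### Real-rootedness of Sturm sequences -/

lemma eq_C_mul_prod_of_roots {ι : Type*} {p : ℝ[X]} {s : Finset ι} (hdeg : p.natDegree ≤ s.card)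
    {μ : ι → ℝ} (hinj : Set.InjOn μ s) (hroot : ∀ i ∈ s, p.eval (μ i) = 0) :
    p = Polynomial.C (p.coeff s.card) * ∏ i ∈ s, (Polynomial.X - Polynomial.C (μ i)) := by
  set q := ∏ i ∈ s, (Polynomial.X - Polynomial.C (μ i)) with hq
  have hmonic : q.Monic := Polynomial.monic_prod_X_sub_C _ _
  have hqdeg : q.natDegree = s.card := by simp [hq]
  rw [← sub_eq_zero]
  refine Polynomial.eq_zero_of_degree_lt_of_eval_finset_eq_zero
    (s.image μ) ?_ ?_
  · rw [Finset.card_image_of_injOn hinj, Polynomial.degree_lt_iff_coeff_zero]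
    intro k hk
    rw [Polynomial.coeff_sub, Polynomial.coeff_C_mul]
    rcases hk.eq_or_lt with rfl | hk
    · have : q.coeff s.card = 1 := by rw [← hqdeg]; exact hmonic.coeff_natDegree
      rw [this]; ring
    · rw [Polynomial.coeff_eq_zero_of_natDegree_lt (hdeg.trans_lt hk),
        Polynomial.coeff_eq_zero_of_natDegree_lt (p := q) (by omega)]
      ring
  · intro x hx
    obtain ⟨i, hi, rfl⟩ := Finset.mem_image.1 hx
    rw [Polynomial.eval_sub, hroot i hi, Polynomial.eval_mul, hq, Polynomial.eval_prod,
      Finset.prod_eq_zero hi (by simp)]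
    simp

lemma neg_one_pow_mul_prod_sub_pos {n k : ℕ} (hk : k ≤ n) {μ : ℕ → ℝ} {x : ℝ}
    (h1 : ∀ i < k, x < μ i) (h2 : ∀ i < n, k ≤ i → μ i < x) :
    0 < (-1) ^ k * ∏ i ∈ Finset.range n, (x - μ i) := by
  obtain ⟨l, rfl⟩ := Nat.exists_eq_add_of_le hk
  rw [Finset.prod_range_add, ← mul_assoc]
  refine mul_pos ?_ (Finset.prod_pos fun i hi => ?_)
  · rw [← Finset.card_range k, ← Finset.prod_const, Finset.card_range, ← Finset.prod_mul_distrib]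
    refine Finset.prod_pos fun i hi => ?_
    linarith [h1 i (Finset.mem_range.1 hi)]
  · have := h2 (k + i) (by simpa using hi) (by omega)
    linarith

lemma exists_neg_one_pow_mul_eval_pos {p : ℝ[X]} {n : ℕ} (hn : 0 < n) (hdeg : p.natDegree ≤ n)
    (hc : 0 < p.coeff n) (c : ℝ) : ∃ x < c, 0 < (-1) ^ n * p.eval x := by
  have hdeg' : p.natDegree = n := le_antisymm hdeg (Polynomial.le_natDegree_of_ne_zero hc.ne')
  set q : ℝ[X] := Polynomial.C ((-1) ^ n) * p.comp (-Polynomial.X) with hq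
  have hl : q.leadingCoeff = p.coeff n := by
    rw [hq, Polynomial.leadingCoeff_mul, Polynomial.leadingCoeff_C,
      Polynomial.comp_neg_X_leadingCoeff_eq, hdeg', ← mul_assoc, ← mul_pow,
      Polynomial.leadingCoeff, hdeg']
    simp
  have hqd : q.natDegree = n := by
    rw [hq, Polynomial.natDegree_C_mul (by simp), Polynomial.natDegree_comp]
    simp [hdeg']
  have ht := Polynomial.tendsto_atTop_of_leadingCoeff_nonneg q
    (Polynomial.natDegree_pos_iff_degree_pos.1 (by omega)) (by rw [hl]; exact hc.le)
  obtain ⟨y, hy1, hy2⟩ := ((ht.eventually_gt_atTop 0).and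
    (Filter.eventually_gt_atTop (-c))).exists
  refine ⟨-y, by linarith, ?_⟩
  simpa [hq, Polynomial.eval_comp] using hy1

/-- A polynomial that changes sign between the consecutive points `t 0 > t 1 > ⋯ > t n` has a root
in each gap. -/
lemma exists_roots_of_sign_changes {p : ℝ[X]} {n : ℕ} {t : ℕ → ℝ}
    (ht : ∀ i < n, t (i + 1) < t i) (hs : ∀ i ≤ n, 0 < (-1) ^ i * p.eval (t i)) :
    ∃ ν : ℕ → ℝ, ∀ i < n, t (i + 1) < ν i ∧ ν i < t i ∧ p.eval (ν i) = 0 := by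
  have key : ∀ i, ∃ x, i < n → t (i + 1) < x ∧ x < t i ∧ p.eval x = 0 := by
    intro i
    by_cases hi : i < n
    · have h1 := hs i hi.le
      have h2 := hs (i + 1) hi
      set f : ℝ → ℝ := fun x => (-1) ^ i * p.eval x with hf
      have hfc : Continuous f := continuous_const.mul p.continuous
      have h2' : f (t (i + 1)) < 0 := by
        simp only [hf]; rw [pow_succ] at h2; linarith
      obtain ⟨x, hx, hx0⟩ := intermediate_value_Ioo (ht i hi).le hfc.continuousOn
        (show (0 : ℝ) ∈ Set.Ioo (f (t (i + 1))) (f (t i)) from ⟨h2', h1⟩)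
      refine ⟨x, fun _ => ⟨hx.1, hx.2, ?_⟩⟩
      simpa [hf] using hx0
    · exact ⟨0, fun h => absurd h hi⟩
  choose ν hν using key
  exact ⟨ν, hν⟩

lemma strictAnti_of_lt_pred {n : ℕ} {ν : ℕ → ℝ} (h : ∀ i, i + 1 < n → ν (i + 1) < ν i) {i j : ℕ}
    (hij : i < j) (hj : j < n) : ν j < ν i := by
  induction j, hij using Nat.le_induction with
  | base => exact h i hj
  | succ j hij ih => exact (h j hj).trans (ih (by omega))

/-- The polynomials of a Sturm sequence have simple negative roots which interlace. -/
lemma exists_roots_of_sturm {K : ℕ → ℝ[X]} (hdeg : ∀ n, (K n).natDegree ≤ n)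
    (hlead : ∀ n, 0 < (K n).coeff n) (hzero : ∀ n, 0 < (K n).eval 0)
    (hsturm : ∀ n l, l < 0 → (K (n + 1)).eval l = 0 → (K (n + 2)).eval l * (K n).eval l < 0)
    (n : ℕ) : ∃ μ : ℕ → ℝ, (∀ i < n + 1, μ i < 0 ∧ (K (n + 1)).eval (μ i) = 0) ∧
      (∀ i j, i < j → j < n + 1 → μ j < μ i) ∧
      ∀ i < n + 1, 0 < (-1) ^ i * (K n).eval (μ i) := by
  induction n with
  | zero =>
    obtain ⟨x, hx, hx0⟩ := exists_neg_one_pow_mul_eval_pos (n := 1) one_pos (hdeg 1) (hlead 1) 0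
    obtain ⟨ν, hν⟩ := exists_roots_of_sign_changes (p := K 1) (n := 1)
      (t := fun i => if i = 0 then 0 else x)
      (fun i hi => by obtain rfl : i = 0 := by omega
                      simpa using hx)
      (fun i hi => by
        rcases Nat.le_one_iff_eq_zero_or_eq_one.1 hi with rfl | rfl
        · simpa using hzero 1
        · simpa using hx0)
    refine ⟨ν, fun i hi => ?_, fun i j hij hj => by omega, fun i hi => ?_⟩
    · obtain rfl : i = 0 := by omega
      have := hν 0 one_pos
      exact ⟨by simpa using this.2.1, this.2.2⟩
    · obtain rfl : i = 0 := by omega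
      have hK : K 0 = Polynomial.C ((K 0).coeff 0) :=
        Polynomial.eq_C_of_natDegree_le_zero (hdeg 0)
      rw [hK]
      simpa using hlead 0
  | succ n ih =>
    obtain ⟨μ, hμ, hanti, hsign⟩ := ih
    obtain ⟨x, hx, hx0⟩ := exists_neg_one_pow_mul_eval_pos (n := n + 2) (by omega)
      (hdeg (n + 2)) (hlead (n + 2)) (μ n)
    -- Test points for `K (n + 2)`: 0, then the roots of `K (n + 1)` in decreasing order, then a
    -- point far to the left where the leading term decides the sign.
    set t : ℕ → ℝ := fun i => if i = 0 then 0 else if i = n + 2 then x else μ (i - 1) with ht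
    have t0 : t 0 = 0 := by simp [ht]
    have tn : t (n + 2) = x := by simp [ht]
    have tm : ∀ i < n + 1, t (i + 1) = μ i := fun i hi => by
      simp [ht, show i ≠ n + 1 by omega]
    have hK1 := eq_C_mul_prod_of_roots (s := Finset.range (n + 1))
      (by simpa using hdeg (n + 1)) (μ := μ)
      (fun i hi j hj hij => by
        simp only [Finset.coe_range, Set.mem_Iio] at hi hj
        by_contra hne
        rcases lt_or_gt_of_ne hne with h | h
        · exact absurd hij (hanti i j h hj).ne'
        · exact absurd hij (hanti j i h hi).ne)
      (fun i hi => (hμ i (Finset.mem_range.1 hi)).2)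
    rw [Finset.card_range] at hK1
    have htanti : ∀ i < n + 2, t (i + 1) < t i := by
      intro i hi
      rcases Nat.eq_zero_or_pos i with rfl | hi0
      · rw [t0, tm 0 (by omega)]; exact (hμ 0 (by omega)).1
      · obtain ⟨j, rfl⟩ := Nat.exists_eq_succ_of_ne_zero hi0.ne'
        rw [Nat.succ_eq_add_one, tm j (by omega)]
        rcases Nat.lt_or_ge (j + 1) (n + 1) with h1 | h1
        · rw [tm (j + 1) h1]; exact hanti j (j + 1) (by omega) h1
        · obtain rfl : j = n := by omega
          rw [tn]; exact hx
    obtain ⟨ν, hν⟩ := exists_roots_of_sign_changes (p := K (n + 2)) (n := n + 2) htanti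
      (fun i hi => by
        rcases Nat.eq_zero_or_pos i with rfl | hi0
        · rw [t0]; simpa using hzero (n + 2)
        · obtain ⟨j, rfl⟩ := Nat.exists_eq_succ_of_ne_zero hi0.ne'
          rw [Nat.succ_eq_add_one]
          rcases Nat.lt_or_ge j (n + 1) with h1 | h1
          · rw [tm j h1, pow_succ]
            -- At a root of `K (n + 1)` the polynomials `K (n + 2)` and `K n` have opposite signs,
            -- and the sign of `K n` there is part of the induction hypothesis.
            have e1 := hsturm n (μ j) (hμ j h1).1 (hμ j h1).2
            have e2 := hsign j h1
            by_contra hcon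
            have e3 : ((-1 : ℝ) ^ j) * (-1) ^ j = 1 := by rw [← mul_pow]; simp
            have e4 : 0 ≤ (-1) ^ j * (K (n + 2)).eval (μ j) := by linarith
            have e5 := mul_nonneg e4 e2.le
            have e6 : (-1) ^ j * (K (n + 2)).eval (μ j) * ((-1) ^ j * (K n).eval (μ j)) =
              (K (n + 2)).eval (μ j) * (K n).eval (μ j) := by
              linear_combination ((K (n + 2)).eval (μ j) * (K n).eval (μ j)) * e3
            linarith
          · obtain rfl : j = n + 1 := by omega
            rw [tn]; exact hx0)
    refine ⟨ν, fun i hi => ⟨?_, (hν i hi).2.2⟩, fun i j hij hj => ?_, fun i hi => ?_⟩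
    · refine (hν i hi).2.1.trans_le ?_
      rcases Nat.eq_zero_or_pos i with rfl | hi0
      · rw [t0]
      · obtain ⟨j, rfl⟩ := Nat.exists_eq_succ_of_ne_zero hi0.ne'
        rw [Nat.succ_eq_add_one, tm j (by omega)]
        exact (hμ j (by omega)).1.le
    · exact strictAnti_of_lt_pred (n := n + 2) (fun i hi =>
        (hν (i + 1) hi).2.1.trans (hν i (by omega)).1) hij hj
    -- The new roots interlace the old ones, so exactly i of the roots μ exceed `ν i`; the
    -- factorization of `K (n + 1)` then has i negative factors.
    · rw [hK1, Polynomial.eval_mul, Polynomial.eval_C, Polynomial.eval_prod, mul_left_comm]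
      simp only [Polynomial.eval_sub, Polynomial.eval_X, Polynomial.eval_C]
      refine mul_pos (hlead (n + 1)) (neg_one_pow_mul_prod_sub_pos (by omega) ?_ ?_)
      · intro j hj
        rw [← tm j (by omega)]
        refine (hν i hi).2.1.trans_le ?_
        rcases Nat.lt_or_ge (j + 1) i with h1 | h1
        · exact (strictAnti_of_lt_pred (n := n + 3) (ν := t)
            (fun i hi => htanti i (by omega)) h1 (by omega)).le
        · rw [show i = j + 1 by omega]
      · intro j hj hij
        rw [← tm j hj]
        refine lt_of_le_of_lt ?_ (hν i hi).1
        rcases Nat.lt_or_ge i j with h1 | h1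
        · exact (strictAnti_of_lt_pred (n := n + 3) (ν := t)
            (fun i hi => htanti i (by omega)) (show i + 1 < j + 1 by omega) (by omega)).le
        · rw [show i = j by omega]

/-! ### Zeros of the exponential Euler spline polynomials. -/

lemma natDegree_eulerSplinePoly_le (h : ℝ) (n : ℕ) : (eulerSplinePoly h n).natDegree ≤ n := by
  rw [Polynomial.natDegree_le_iff_coeff_eq_zero]
  intro k hk
  rw [coeff_eulerSplinePoly]
  rcases Nat.lt_or_ge (n + 1) k with h1 | h1
  · exact splineCoef_eq_zero h h1 h
  · rw [show k = n + 1 by omega, splineCoef_last]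

lemma exists_roots_eulerSplinePoly {h : ℝ} (hh : 0 < h) (n : ℕ) :
    ∃ s : Finset ℝ, s.card = n ∧ ∀ x ∈ s, x < 0 ∧ (eulerSplinePoly h n).eval x = 0 := by
  cases n with
  | zero => exact ⟨∅, by simp⟩
  | succ n =>
    obtain ⟨μ, h1, h2, -⟩ := exists_roots_of_sturm (K := eulerSplinePoly h)
      (natDegree_eulerSplinePoly_le h)
      (fun n => by rw [coeff_eulerSplinePoly]; exact splineCoef_right_pos hh n le_rfl)
      (fun n => by
        rw [← Polynomial.coeff_zero_eq_eval_zero, coeff_eulerSplinePoly]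
        exact splineCoef_right_pos hh n (Nat.zero_le _))
      (fun n l hl h0 => eulerSplinePoly_sturm hh n hl h0) n
    refine ⟨(Finset.range (n + 1)).image μ, ?_, ?_⟩
    · rw [Finset.card_image_of_injOn, Finset.card_range]
      intro i hi j hj hij
      simp only [Finset.coe_range, Set.mem_Iio] at hi hj
      by_contra hne
      rcases lt_or_gt_of_ne hne with h | h
      · exact absurd hij (h2 i j h hj).ne'
      · exact absurd hij (h2 j i h hi).ne
    · intro x hx
      obtain ⟨i, hi, rfl⟩ := Finset.mem_image.1 hx
      exact h1 i (Finset.mem_range.1 hi)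

/-! ### Generating functions -/

/-- The polynomial `1 - 2λ cosh h + λ²`. -/
noncomputable def coshPoly (h : ℝ) : ℝ[X] :=
  1 - Polynomial.C (2 * Real.cosh h) * Polynomial.X + Polynomial.X ^ 2

lemma hasDerivAt_coeff_mul (A : PowerSeries ℝ) {U U' : ℕ → ℝ → ℝ} {x : ℝ}
    (hU : ∀ i, HasDerivAt (U i) (U' i x) x) (k : ℕ) :
    HasDerivAt (fun x => PowerSeries.coeff k (A * PowerSeries.mk fun i => U i x))
      (PowerSeries.coeff k (A * PowerSeries.mk fun i => U' i x)) x := by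
  simp only [PowerSeries.coeff_mul, PowerSeries.coeff_mk]
  exact HasDerivAt.fun_sum fun i _ => (hU i.2).const_mul _

/-- The recurrence sinh(y + h) + sinh(y - h) = 2 cosh(h) sinh(y) kills all coefficients from degree
2 on; the two that survive are those of R_0. -/
lemma coshPoly_mul_mk_sinh (h x : ℝ) :
    (coshPoly h : PowerSeries ℝ) * PowerSeries.mk (fun i : ℕ => Real.sinh (x + i * h)) =
      PowerSeries.mk fun i => splineCoef h 0 i x := by
  have e : (coshPoly h : PowerSeries ℝ) =
      1 - PowerSeries.C (2 * Real.cosh h) * PowerSeries.X + PowerSeries.X ^ 2 := by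
    simp [coshPoly]
  rw [e]
  ext k
  rw [add_mul, sub_mul, one_mul, mul_assoc, pow_two, mul_assoc]
  simp only [map_add, map_sub, PowerSeries.coeff_C_mul, PowerSeries.coeff_mk]
  rcases k with _ | _ | k
  · simp [splineCoef]
  · simp only [zero_add, PowerSeries.coeff_mk, PowerSeries.coeff_zero_X_mul,
      PowerSeries.coeff_succ_X_mul]
    simp [splineCoef, Real.sinh_add, Real.sinh_sub]
    ring
  · rw [PowerSeries.coeff_succ_X_mul, PowerSeries.coeff_succ_X_mul,
      PowerSeries.coeff_succ_X_mul, PowerSeries.coeff_mk, PowerSeries.coeff_mk]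
    simp only [splineCoef, show k + 1 + 1 ≠ 0 by omega, show k + 1 + 1 ≠ 1 by omega, if_false]
    have e1 : x + ((k + 1 + 1 : ℕ) : ℝ) * h = (x + ((k + 1 : ℕ) : ℝ) * h) + h := by push_cast; ring
    have e2 : x + (k : ℝ) * h = (x + ((k + 1 : ℕ) : ℝ) * h) - h := by push_cast; ring
    rw [e1, e2, Real.sinh_add, Real.sinh_sub]
    ring

/-- The generating function of the values of the iterated primitives of `sinh`. -/
lemma mul_mk_primSinh (h : ℝ) (n : ℕ) (x : ℝ) :
    ((1 - PowerSeries.X) ^ n * (coshPoly h : PowerSeries ℝ)) *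
      PowerSeries.mk (fun i : ℕ => primSinh n (x + i * h)) =
      PowerSeries.mk fun i => splineCoef h n i x := by
  induction n generalizing x with
  | zero =>
    have : ∀ y, primSinh 0 y = Real.sinh y := by
      intro y; simp [primSinh, Real.sinh_eq]
    simp only [this, pow_zero, one_mul]
    exact coshPoly_mul_mk_sinh h x
  | succ n ih =>
    set A : PowerSeries ℝ := (1 - PowerSeries.X) ^ (n + 1) * (coshPoly h : PowerSeries ℝ) with hA
    set Δ : ℝ → PowerSeries ℝ := fun x =>
      A * PowerSeries.mk (fun i : ℕ => primSinh (n + 1) (x + i * h)) -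
        PowerSeries.mk (fun i => splineCoef h (n + 1) i x) with hΔ
    -- Differentiating in the point lowers n by one and releases a factor 1 - X, so the induction
    -- hypothesis makes the difference Δ constant in the point.
    have hder : ∀ k y, HasDerivAt (fun y => PowerSeries.coeff k (Δ y)) 0 y := by
      intro k y
      have h1 := hasDerivAt_coeff_mul A (U := fun i y => primSinh (n + 1) (y + i * h))
        (U' := fun i y => primSinh n (y + i * h)) (x := y)
        (fun i => by
          simpa using (hasDerivAt_primSinh n (y + i * h)).comp_add_const y (i * h)) k
      have h2 := h1.fun_sub (hasDerivAt_splineCoef h n k y)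
      simp only [hΔ, map_sub, PowerSeries.coeff_mk]
      refine h2.congr_deriv ?_
      rw [hA, pow_succ', mul_assoc (1 - PowerSeries.X), mul_assoc (1 - PowerSeries.X), ih y,
        sub_mul, one_mul, map_sub, PowerSeries.coeff_mk]
      rcases k with _ | k
      · simp
      · rw [PowerSeries.coeff_succ_X_mul]; simp
    have hconst : ∀ y z, Δ y = Δ z := by
      intro y z
      ext k
      exact is_const_of_deriv_eq_zero (fun y => (hder k y).differentiableAt)
        (fun y => (hder k y).deriv) y z
    -- Both sides of the claim are shifted by one index when the point moves from h to 0. A constant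
    -- Δ with this property satisfies (1 - X) Δ = 0, hence vanishes.
    have hb : Δ 0 = PowerSeries.X * Δ h := by
      have b1 : PowerSeries.mk (fun i : ℕ => primSinh (n + 1) (0 + i * h)) =
          PowerSeries.X * PowerSeries.mk (fun i : ℕ => primSinh (n + 1) (h + i * h)) := by
        ext k
        rcases k with _ | k
        · simp
        · rw [PowerSeries.coeff_succ_X_mul, PowerSeries.coeff_mk, PowerSeries.coeff_mk]
          congr 1; push_cast; ring
      have b2 : PowerSeries.mk (fun i => splineCoef h (n + 1) i 0) =
          PowerSeries.X * PowerSeries.mk (fun i => splineCoef h (n + 1) i h) := by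
        ext k
        rcases k with _ | k
        · rw [PowerSeries.coeff_mk, splineCoef_first]; simp
        · rw [PowerSeries.coeff_succ_X_mul, PowerSeries.coeff_mk, PowerSeries.coeff_mk,
            splineCoef_boundary]
      simp only [hΔ]
      rw [b1, b2]; ring
    have h0 : Δ 0 = 0 := by
      have : (1 - PowerSeries.X) * Δ 0 = 0 := by
        rw [sub_mul, one_mul, hconst 0 h, ← hb, hconst 0 h, sub_self]
      rcases mul_eq_zero.1 this with h1 | h1
      · exfalso
        have := congrArg (PowerSeries.coeff 0) h1
        simp at this
      · exact h1
    have := hconst x 0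
    rw [h0] at this
    exact sub_eq_zero.1 this

lemma X_mul_eulerSplinePoly (h : ℝ) (n : ℕ) :
    (PowerSeries.X : PowerSeries ℝ) * (eulerSplinePoly h n : PowerSeries ℝ) =
      ((1 - PowerSeries.X) ^ n * (coshPoly h : PowerSeries ℝ)) *
        PowerSeries.mk (fun i : ℕ => primSinh n (i * h)) := by
  have := mul_mk_primSinh h n 0
  simp only [zero_add] at this
  rw [this]
  ext k
  rcases k with _ | k
  · rw [PowerSeries.coeff_mk, splineCoef_first]; simp
  · rw [PowerSeries.coeff_succ_X_mul, PowerSeries.coeff_mk, Polynomial.coeff_coe,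
      coeff_eulerSplinePoly, splineCoef_boundary]

/-- The operator X d/dX raises the exponent in ∑ i^{k+1} X^i by one; applied to the right side it
reproduces the recursion of the Euler polynomials. -/
lemma X_mul_eulerPoly (k : ℕ) :
    (PowerSeries.X : PowerSeries ℝ) * (eulerPoly k : PowerSeries ℝ) =
      (1 - PowerSeries.X) ^ (k + 2) * PowerSeries.mk (fun i : ℕ => (i : ℝ) ^ (k + 1)) := by
  induction k with
  | zero =>
    ext n
    have : ((1 : PowerSeries ℝ) - PowerSeries.X) ^ 2 =
      1 - PowerSeries.C 2 * PowerSeries.X + PowerSeries.X ^ 2 := by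
      rw [map_ofNat]; ring
    rw [zero_add, this, add_mul, sub_mul, one_mul, mul_assoc, pow_two, mul_assoc, eulerPoly]
    simp only [map_add, map_sub, PowerSeries.coeff_C_mul, PowerSeries.coeff_mk,
      Polynomial.coe_one, mul_one]
    rcases n with _ | _ | n
    · simp
    · simp [PowerSeries.coeff_succ_X_mul]
    · simp only [PowerSeries.coeff_succ_X_mul, PowerSeries.coeff_mk, PowerSeries.coeff_X]
      push_cast
      simp
      ring
  | succ k ih =>
    set F : PowerSeries ℝ := PowerSeries.mk (fun i : ℕ => (i : ℝ) ^ (k + 1)) with hF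
    have hF' : PowerSeries.mk (fun i : ℕ => (i : ℝ) ^ (k + 1 + 1)) =
        PowerSeries.X * PowerSeries.derivative ℝ F := by
      ext n
      rcases n with _ | n
      · simp
      · rw [PowerSeries.coeff_succ_X_mul, PowerSeries.coeff_derivative, hF, PowerSeries.coeff_mk, PowerSeries.coeff_mk]
        push_cast; ring
    have hd := congrArg (PowerSeries.derivative ℝ) ih
    simp only [Derivation.leibniz, Derivation.leibniz_pow, map_sub, Derivation.map_one_eq_zero,
      PowerSeries.derivative_X, smul_eq_mul, PowerSeries.derivative_coe] at hd
    rw [hF', eulerPoly]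
    simp only [Polynomial.coe_add, Polynomial.coe_mul, Polynomial.coe_one, Polynomial.coe_sub,
      Polynomial.coe_X, Polynomial.coe_C]
    rw [map_add, map_natCast, map_one]
    rw [nsmul_eq_mul] at hd
    rw [show k + 2 - 1 = k + 1 by omega] at hd
    push_cast at hd
    linear_combination (PowerSeries.X * (1 - PowerSeries.X)) * hd +
      ((k + 2) * PowerSeries.X) * ih

end OptimalQuadrature

namespace OptimalQuadrature

/-! ### The roots of `P_{2m-2}` -/

/-- Both sides, multiplied by X, are -2e^h (1-X)^{2k} (1 - 2 cosh(h) X + X²) times the generating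
series of `primSinh (2 * k)` at the nodes. This function is sinh minus odd powers; the sinh part
gives the first term of P, the powers give the Euler polynomials. -/
lemma charP_eq (k : ℕ) (h : ℝ) :
    charP (k + 1) h = Polynomial.C (-2 * Real.exp h) * eulerSplinePoly h (2 * k) := by
  have hX : (PowerSeries.X : PowerSeries ℝ) ≠ 0 := PowerSeries.X_ne_zero
  have h1 := X_mul_eulerSplinePoly h (2 * k)
  have hexp : Real.exp h * Real.exp (-h) = 1 := by rw [← Real.exp_add]; simp
  have hexp2 : Real.exp (2 * h) = Real.exp h * Real.exp h := by rw [← Real.exp_add]; ring_nf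
  have hs : (coshPoly h : PowerSeries ℝ) * PowerSeries.mk (fun i : ℕ => Real.sinh (i * h)) =
      PowerSeries.X * PowerSeries.C (Real.sinh h) := by
    have := coshPoly_mul_mk_sinh h 0
    simp only [zero_add] at this
    rw [this]
    ext n
    rcases n with _ | _ | n
    · simp [splineCoef]
    · simp [splineCoef]
    · rw [PowerSeries.coeff_succ_X_mul, PowerSeries.coeff_C]; simp [splineCoef]
  have hg : PowerSeries.mk (fun i : ℕ => primSinh (2 * k) (i * h)) =
      PowerSeries.mk (fun i : ℕ => Real.sinh (i * h)) -
      ∑ j ∈ Finset.range k, PowerSeries.C (h ^ (2 * j + 1) / ((2 * j + 1).factorial : ℝ)) *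
        PowerSeries.mk (fun i : ℕ => (i : ℝ) ^ (2 * j + 1)) := by
    ext n
    simp only [map_sub, map_sum, PowerSeries.coeff_C_mul, PowerSeries.coeff_mk, primSinh_even,
      Real.sinh_eq]
    congr 1
    exact Finset.sum_congr rfl fun j _ => by rw [mul_pow]; ring
  have hsum : PowerSeries.X * ∑ j ∈ Finset.range k,
      PowerSeries.C (h ^ (2 * j + 1) / ((2 * j + 1).factorial : ℝ)) *
      (1 - PowerSeries.X) ^ (2 * (k + 1) - 4 - 2 * j) * (eulerPoly (2 * j) : PowerSeries ℝ) =
      (1 - PowerSeries.X) ^ (2 * k) * ∑ j ∈ Finset.range k,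
        PowerSeries.C (h ^ (2 * j + 1) / ((2 * j + 1).factorial : ℝ)) *
        PowerSeries.mk (fun i : ℕ => (i : ℝ) ^ (2 * j + 1)) := by
    rw [Finset.mul_sum, Finset.mul_sum]
    refine Finset.sum_congr rfl fun j hj => ?_
    rw [Finset.mem_range] at hj
    rw [mul_left_comm, X_mul_eulerPoly, show 2 * k = 2 * (k + 1) - 4 - 2 * j + (2 * j + 2) by omega,
      pow_add]
    ring
  have hq : (coshPoly h : PowerSeries ℝ) = 1 - PowerSeries.C (2 * Real.cosh h) * PowerSeries.X +
      PowerSeries.X ^ 2 := by simp [coshPoly]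
  have e1 : PowerSeries.C (1 - Real.exp (2 * h)) =
      PowerSeries.C (-2 * Real.exp h) * PowerSeries.C (Real.sinh h) := by
    rw [← map_mul]; congr 1; rw [Real.sinh_eq, hexp2]; linear_combination -hexp
  have e2 : 2 * (PowerSeries.C (Real.exp (2 * h) + 1) * PowerSeries.X -
      PowerSeries.C (Real.exp h) * (PowerSeries.X ^ 2 + 1)) =
      PowerSeries.C (-2 * Real.exp h) * (coshPoly h : PowerSeries ℝ) := by
    have : PowerSeries.C (Real.exp (2 * h) + 1) =
        PowerSeries.C (Real.exp h) * PowerSeries.C (2 * Real.cosh h) := by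
      rw [← map_mul]; congr 1; rw [Real.cosh_eq, hexp2]; linear_combination -hexp
    rw [this, hq, map_mul PowerSeries.C (-2)]
    have : (PowerSeries.C (-2 : ℝ) : PowerSeries ℝ) = -2 := by rw [map_neg, map_ofNat]
    rw [this]; ring
  rw [← Polynomial.coe_inj]
  apply mul_left_cancel₀ hX
  rw [Polynomial.coe_mul, mul_left_comm, h1, hg, charP]
  simp only [Polynomial.coe_add, Polynomial.coe_mul, Polynomial.coe_one, Polynomial.coe_sub,
      Polynomial.coe_X, Polynomial.coe_C, Polynomial.coe_pow, Nat.add_sub_cancel]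
  have e3 : (((2 : ℝ[X])) : PowerSeries ℝ) = 2 := by
    have : (2 : ℝ[X]) = Polynomial.C 2 := by rw [map_ofNat]
    rw [this, Polynomial.coe_C, map_ofNat]
  have e4 : ((∑ j ∈ Finset.range k, Polynomial.C (h ^ (2 * j + 1) / ((2 * j + 1).factorial : ℝ)) *
      (1 - Polynomial.X) ^ (2 * (k + 1) - 4 - 2 * j) * eulerPoly (2 * j) : ℝ[X]) :
        PowerSeries ℝ) = ∑ j ∈ Finset.range k,
      PowerSeries.C (h ^ (2 * j + 1) / ((2 * j + 1).factorial : ℝ)) *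
      (1 - PowerSeries.X) ^ (2 * (k + 1) - 4 - 2 * j) * (eulerPoly (2 * j) : PowerSeries ℝ) := by
    rw [← Polynomial.coeToPowerSeries.ringHom_apply, map_sum]
    simp
  rw [e3, e2, e4, e1, show 2 * (k + 1) - 2 = 2 * k by omega]
  linear_combination (-PowerSeries.C (-2 * Real.exp h) * (coshPoly h : PowerSeries ℝ)) * hsum -
    (PowerSeries.C (-2 * Real.exp h) * (1 - PowerSeries.X) ^ (2 * k)) * hs

lemma natDegree_charP_le (k : ℕ) (h : ℝ) : (charP (k + 1) h).natDegree ≤ 2 * k := by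
  rw [charP_eq]
  exact (Polynomial.natDegree_C_mul_le _ _).trans (natDegree_eulerSplinePoly_le h _)

lemma leadP_neg {h : ℝ} (hh : 0 < h) (k : ℕ) : leadP (k + 1) h < 0 := by
  rw [leadP, charP_eq, Polynomial.coeff_C_mul, coeff_eulerSplinePoly,
    show 2 * (k + 1) - 2 = 2 * k by omega]
  have := splineCoef_right_pos hh (2 * k) (le_refl (2 * k))
  have := Real.exp_pos h
  nlinarith

lemma coeff_charP_reflect (h : ℝ) (k : ℕ) {i : ℕ} (hi : i ≤ 2 * k) :
    (charP (k + 1) h).coeff i = (charP (k + 1) h).coeff (2 * k - i) := by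
  rw [charP_eq, Polynomial.coeff_C_mul, Polynomial.coeff_C_mul, coeff_eulerSplinePoly,
    coeff_eulerSplinePoly, splineCoef_palindrome h _ hi]

lemma coeff_zero_charP (h : ℝ) (k : ℕ) : (charP (k + 1) h).coeff 0 = leadP (k + 1) h := by
  rw [coeff_charP_reflect h k (Nat.zero_le _), leadP]; rfl

lemma eval_charP_inv (h : ℝ) (k : ℕ) {x : ℝ} (hx : x ≠ 0) :
    (charP (k + 1) h).eval x⁻¹ * x ^ (2 * k) = (charP (k + 1) h).eval x := by
  have hd := natDegree_charP_le k h
  rw [Polynomial.eval_eq_sum_range' (Nat.lt_succ_of_le hd),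
    Polynomial.eval_eq_sum_range' (Nat.lt_succ_of_le hd), Finset.sum_mul,
    ← Finset.sum_range_reflect]
  refine Finset.sum_congr rfl fun i hi => ?_
  have hi' : i ≤ 2 * k := by simp at hi; omega
  rw [show 2 * k + 1 - 1 - i = 2 * k - i by omega, ← coeff_charP_reflect h k hi']
  rw [show x ^ (2 * k) = x ^ (2 * k - i) * x ^ i by rw [← pow_add]; congr 1; omega]
  have := pow_ne_zero (2 * k - i) hx
  rw [inv_pow]
  field_simp

/-- The `2m - 2` roots of `P_{2m-2}` are real, negative and simple. -/
lemma exists_charP_eq_prod {h : ℝ} (hh : 0 < h) (k : ℕ) : ∃ s : Finset ℝ, s.card = 2 * k ∧ (∀ x ∈ s, x < 0) ∧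
    charP (k + 1) h = Polynomial.C (leadP (k + 1) h) *
      ∏ x ∈ s, (Polynomial.X - Polynomial.C x) := by
  obtain ⟨s, hs, h1⟩ := exists_roots_eulerSplinePoly hh (2 * k)
  refine ⟨s, hs, fun x hx => (h1 x hx).1, ?_⟩
  have := eq_C_mul_prod_of_roots (p := charP (k + 1) h) (s := s) (μ := id)
    (by rw [hs]; exact natDegree_charP_le k h) Function.injective_id.injOn
    (fun x hx => by rw [charP_eq, Polynomial.eval_mul, id, (h1 x hx).2, mul_zero])
  rw [hs] at this
  rw [leadP, show 2 * (k + 1) - 2 = 2 * k by omega]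
  exact this

/-- Inversion permutes the 2k simple negative roots and exchanges (-1, 0) with (-∞, -1). Its only
fixed point on the negative axis is -1, which would be a single root and make the total odd; so -1
is not a root and k roots lie on each side. -/
lemma exists_charP_roots {h : ℝ} (hh : 0 < h) (k : ℕ) : ∃ t : Finset ℝ, t.card = k ∧ (∀ x ∈ t, -1 < x ∧ x < 0) ∧
    charP (k + 1) h = Polynomial.C (leadP (k + 1) h) *
      ∏ x ∈ t, ((Polynomial.X - Polynomial.C x) * (Polynomial.X - Polynomial.C x⁻¹)) := by
  obtain ⟨s, hs, hneg, hP⟩ := exists_charP_eq_prod hh k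
  have hroot : ∀ x, (charP (k + 1) h).eval x = 0 ↔ x ∈ s := by
    intro x
    rw [hP, Polynomial.eval_mul, Polynomial.eval_C, mul_eq_zero, Polynomial.eval_prod,
      Finset.prod_eq_zero_iff]
    simp only [Polynomial.eval_sub, Polynomial.eval_X, Polynomial.eval_C, (leadP_neg hh k).ne,
      false_or, sub_eq_zero]
    exact ⟨fun ⟨y, hy, e⟩ => e ▸ hy, fun hx => ⟨x, hx, rfl⟩⟩
  have hinv : ∀ x ∈ s, x⁻¹ ∈ s := by
    intro x hx
    rw [← hroot] at hx ⊢
    have hx0 := (hneg x ((hroot x).1 hx)).ne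
    rw [← eval_charP_inv h k hx0] at hx
    exact (mul_eq_zero.1 hx).resolve_right (pow_ne_zero _ hx0)
  have hlt : ∀ x : ℝ, x < 0 → -1 < x → x⁻¹ < -1 := by
    intro x hx hx1
    rw [inv_lt_of_neg hx (by norm_num)]
    simpa using hx1
  have hgt : ∀ x : ℝ, x < -1 → -1 < x⁻¹ := by
    intro x hx1
    rw [lt_inv_of_neg (by norm_num) (by linarith)]
    simpa using hx1
  have e1 : (s.filter fun x => x < -1) = (s.filter fun x => -1 < x).image (·⁻¹) := by
    ext x
    simp only [Finset.mem_filter, Finset.mem_image]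
    constructor
    · rintro ⟨hx, hx1⟩
      exact ⟨x⁻¹, ⟨hinv x hx, hgt x hx1⟩, inv_inv x⟩
    · rintro ⟨y, ⟨hy, hy1⟩, rfl⟩
      exact ⟨hinv y hy, hlt y (hneg y hy) hy1⟩
  have c1 : (s.filter fun x => x < -1).card = (s.filter fun x => -1 < x).card := by
    rw [e1, Finset.card_image_of_injective _ inv_injective]
  have c2 : (s.filter fun x => ¬ -1 < x).card =
      (s.filter fun x => x < -1).card + (s.filter fun x => x = -1).card := by
    rw [← Finset.card_union_of_disjoint]
    · congr 1
      ext x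
      simp only [Finset.mem_filter, Finset.mem_union, not_lt, le_iff_lt_or_eq]
      tauto
    · rw [Finset.disjoint_filter]
      intro x _ hx hx'
      linarith
  have c3 := Finset.card_filter_add_card_filter_not (s := s) (p := fun x => -1 < x)
  have c4 : (s.filter fun x => x = -1).card ≤ 1 := by
    rw [Finset.card_le_one]
    intro a ha b hb
    rw [(Finset.mem_filter.1 ha).2, (Finset.mem_filter.1 hb).2]
  refine ⟨s.filter fun x => -1 < x, by omega, fun x hx => ?_, ?_⟩
  · rw [Finset.mem_filter] at hx
    exact ⟨hx.2, hneg x hx.1⟩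
  · have e2 : (s.filter fun x => ¬ -1 < x) = (s.filter fun x => -1 < x).image (·⁻¹) := by
      rw [← e1]
      refine (Finset.eq_of_subset_of_card_le (fun x hx => ?_) (by omega)).symm
      rw [Finset.mem_filter] at hx ⊢
      exact ⟨hx.1, by linarith [hx.2]⟩
    rw [Finset.prod_mul_distrib, hP, ← Finset.prod_filter_mul_prod_filter_not s (fun x => -1 < x),
      e2, Finset.prod_image inv_injective.injOn]

lemma exists_innerRoots_eq {h : ℝ} (hh : 0 < h) (k : ℕ) : ∃ t : Finset ℝ, t.card = k ∧ (∀ x ∈ t, -1 < x ∧ x < 0) ∧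
    innerRoots (k + 1) h = t.image (fun x : ℝ => (x : ℂ)) ∧
    charP (k + 1) h = Polynomial.C (leadP (k + 1) h) *
      ∏ x ∈ t, ((Polynomial.X - Polynomial.C x) * (Polynomial.X - Polynomial.C x⁻¹)) := by
  obtain ⟨t, ht, h1, h2⟩ := exists_charP_roots hh k
  refine ⟨t, ht, h1, ?_, h2⟩
  have hne : charP (k + 1) h ≠ 0 := by
    intro h0
    have := leadP_neg hh k
    rw [leadP, h0] at this
    simp at this
  ext z
  rw [innerRoots, Finset.mem_filter, Multiset.mem_toFinset, Polynomial.mem_roots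
    ((Polynomial.map_ne_zero_iff (algebraMap ℝ ℂ).injective).2 hne), Polynomial.IsRoot, h2,
    Polynomial.eval_map, Polynomial.eval₂_mul, Polynomial.eval₂_finsetProd, Finset.mem_image,
    mul_eq_zero, Finset.prod_eq_zero_iff]
  simp only [Polynomial.eval₂_C, Polynomial.eval₂_mul, Polynomial.eval₂_sub, Polynomial.eval₂_X,
    mul_eq_zero, Complex.coe_algebraMap, Complex.ofReal_eq_zero, (leadP_neg hh k).ne, false_or,
    sub_eq_zero]
  constructor
  · rintro ⟨⟨x, hx, rfl | rfl⟩, hz⟩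
    · exact ⟨x, hx, rfl⟩
    · exfalso
      obtain ⟨h3, h4⟩ := h1 x hx
      rw [Complex.norm_real, Real.norm_eq_abs, abs_inv, abs_of_neg h4,
        inv_lt_one₀ (by linarith)] at hz
      linarith
  · rintro ⟨x, hx, rfl⟩
    refine ⟨⟨x, hx, Or.inl rfl⟩, ?_⟩
    rw [Complex.norm_real, Real.norm_eq_abs, abs_lt]
    exact ⟨(h1 x hx).1, by linarith [(h1 x hx).2]⟩

lemma card_innerRoots {h : ℝ} (hh : 0 < h) (k : ℕ) : (innerRoots (k + 1) h).card = k := by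
  obtain ⟨t, ht, -, h2, -⟩ := exists_innerRoots_eq hh k
  rw [h2, Finset.card_image_of_injective _ Complex.ofReal_injective, ht]

lemma exists_real_of_mem_innerRoots {h : ℝ} (hh : 0 < h) (k : ℕ) {z : ℂ} (hz : z ∈ innerRoots (k + 1) h) :
    ∃ x : ℝ, z = x ∧ -1 < x ∧ x < 0 ∧ (charP (k + 1) h).eval x = 0 := by
  obtain ⟨t, -, h1, h2, h3⟩ := exists_innerRoots_eq hh k
  rw [h2, Finset.mem_image] at hz
  obtain ⟨x, hx, rfl⟩ := hz
  refine ⟨x, rfl, (h1 x hx).1, (h1 x hx).2, ?_⟩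
  rw [h3, Polynomial.eval_mul, Polynomial.eval_prod, Finset.prod_eq_zero hx (by simp), mul_zero]

/-- With X - 1/z rewritten as a multiple of 1 - zX, both factors of a pair become recurrences of
ratio z, one to the right and one to the left. -/
lemma exists_map_charP_eq_prod {h : ℝ} (hh : 0 < h) (k : ℕ) : ∃ κ : ℂ, κ ≠ 0 ∧ (charP (k + 1) h).map (algebraMap ℝ ℂ) =
    Polynomial.C κ * ∏ z ∈ innerRoots (k + 1) h,
      ((Polynomial.X - Polynomial.C z) * (1 - Polynomial.C z * Polynomial.X)) := by
  obtain ⟨t, -, h1, h2, h3⟩ := exists_innerRoots_eq hh k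
  refine ⟨(leadP (k + 1) h : ℝ) * ∏ x ∈ t, (-(x : ℂ)⁻¹), ?_, ?_⟩
  · refine mul_ne_zero (by simpa using (leadP_neg hh k).ne) (Finset.prod_ne_zero_iff.2 ?_)
    intro x hx
    simpa using (h1 x hx).2.ne
  · rw [h3, h2, Finset.prod_image Complex.ofReal_injective.injOn, Polynomial.map_mul,
      Polynomial.map_prod, map_mul, map_prod, mul_assoc, ← Finset.prod_mul_distrib]
    simp only [Polynomial.map_C, Complex.coe_algebraMap]
    congr 1
    refine Finset.prod_congr rfl fun x hx => ?_
    have hx0 : (x : ℂ) ≠ 0 := by simpa using (h1 x hx).2.ne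
    have : Polynomial.C (x : ℂ)⁻¹ * Polynomial.C (x : ℂ) = 1 := by
      rw [← map_mul, inv_mul_cancel₀ hx0, map_one]
    simp only [Polynomial.map_mul, Polynomial.map_sub, Polynomial.map_X, Polynomial.map_C,
      Complex.coe_algebraMap, map_neg, Complex.ofReal_inv]
    linear_combination (-Polynomial.X * (Polynomial.X - Polynomial.C (x : ℂ))) * this

end OptimalQuadrature

namespace OptimalQuadrature

/-! ### The inner roots are smaller than `e^{-h}` -/

lemma hasSum_coeff_mul_mk (A : ℝ[X]) {f : ℕ → ℝ} {l S : ℝ}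
    (hS : HasSum (fun n => f n * l ^ n) S) :
    HasSum (fun n => PowerSeries.coeff n ((A : PowerSeries ℝ) * PowerSeries.mk f) * l ^ n)
      (A.eval l * S) := by
  induction A using Polynomial.induction_on with
  | C a =>
    simp only [Polynomial.coe_C, PowerSeries.coeff_C_mul, PowerSeries.coeff_mk, Polynomial.eval_C,
      mul_assoc]
    exact hS.mul_left a
  | add p q hp hq =>
    simp only [Polynomial.coe_add, add_mul, map_add, Polynomial.eval_add]
    exact hp.add hq
  | monomial n a ih =>
    have e1 : (Polynomial.C a * Polynomial.X ^ (n + 1) : ℝ[X]) =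
      Polynomial.X * (Polynomial.C a * Polynomial.X ^ n) := by ring
    rw [e1, Polynomial.eval_mul, Polynomial.eval_X, mul_assoc, Polynomial.coe_mul,
      Polynomial.coe_X, mul_assoc]
    rw [← hasSum_nat_add_iff' 1]
    simp only [PowerSeries.coeff_succ_X_mul, Finset.sum_range_one, PowerSeries.coeff_zero_X_mul,
      zero_mul, sub_zero]
    refine (ih.mul_left l).congr_fun fun i => ?_
    rw [pow_succ]; ring

/-- A formal identity between a polynomial, a power series and a polynomial becomes an identity of
numbers wherever the series converges. -/
lemma eval_mul_eq_of_mul_mk_eq {A B : ℝ[X]} {f : ℕ → ℝ} {l S : ℝ}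
    (hS : HasSum (fun n => f n * l ^ n) S)
    (hAB : (A : PowerSeries ℝ) * PowerSeries.mk f = (B : PowerSeries ℝ)) :
    A.eval l * S = B.eval l := by
  have h1 := hasSum_coeff_mul_mk A hS
  have h2 := hasSum_coeff_mul_mk B (f := fun n => if n = 0 then 1 else 0) (l := l) (S := 1) (by
    have := hasSum_ite_eq (0 : ℕ) (1 : ℝ)
    refine this.congr_fun fun n => ?_
    by_cases hn : n = 0 <;> simp [hn])
  have e : (PowerSeries.mk fun n => if n = 0 then (1 : ℝ) else 0) = 1 := by
    ext n; simp [PowerSeries.coeff_one]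
  rw [e, mul_one, mul_one, ← hAB] at h2
  exact h1.unique h2

lemma eval_eulerPoly_mul {l : ℝ} (hl : |l| < 1) (k : ℕ) :
    (1 - l) ^ (k + 2) * ∑' n : ℕ, (n : ℝ) ^ (k + 1) * l ^ n = l * (eulerPoly k).eval l := by
  have hS : Summable fun n : ℕ => (n : ℝ) ^ (k + 1) * l ^ n :=
    summable_pow_mul_geometric_of_norm_lt_one (k + 1) hl
  have := eval_mul_eq_of_mul_mk_eq (A := (1 - Polynomial.X) ^ (k + 2))
    (B := Polynomial.X * eulerPoly k) hS.hasSum (by simp [X_mul_eulerPoly])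
  simpa using this

/-- The value of `P_{2m-2}` in terms of the generating function of the nodes. -/
lemma mul_eval_charP (k : ℕ) (h : ℝ) {l : ℝ} (hl : |l| < 1) (hl0 : l < 0) :
    l * (charP (k + 1) h).eval l = -2 * Real.exp h * (1 - l) ^ (2 * k) *
      (1 - 2 * Real.cosh h * l + l ^ 2) *
      (l * Real.sinh h / (1 - 2 * Real.cosh h * l + l ^ 2) -
        ∑ j ∈ Finset.range k, h ^ (2 * j + 1) / ((2 * j + 1).factorial : ℝ) *
          ∑' n : ℕ, (n : ℝ) ^ (2 * j + 1) * l ^ n) := by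
  have hexp : Real.exp h * Real.exp (-h) = 1 := by rw [← Real.exp_add]; simp
  have hexp2 : Real.exp (2 * h) = Real.exp h * Real.exp h := by rw [← Real.exp_add]; ring_nf
  have hq : 0 < 1 - 2 * Real.cosh h * l + l ^ 2 := by nlinarith [Real.cosh_pos h, sq_nonneg l]
  have e : l * ∑ j ∈ Finset.range k, h ^ (2 * j + 1) / ((2 * j + 1).factorial : ℝ) *
      (1 - l) ^ (2 * (k + 1) - 4 - 2 * j) * (eulerPoly (2 * j)).eval l =
      (1 - l) ^ (2 * k) * ∑ j ∈ Finset.range k, h ^ (2 * j + 1) / ((2 * j + 1).factorial : ℝ) *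
          ∑' n : ℕ, (n : ℝ) ^ (2 * j + 1) * l ^ n := by
    rw [Finset.mul_sum, Finset.mul_sum]
    refine Finset.sum_congr rfl fun j hj => ?_
    rw [Finset.mem_range] at hj
    rw [mul_left_comm, ← eval_eulerPoly_mul hl,
      show 2 * k = 2 * (k + 1) - 4 - 2 * j + (2 * j + 2) by omega, pow_add]
    ring
  have e2 : -2 * Real.exp h * (1 - 2 * Real.cosh h * l + l ^ 2) =
      2 * ((Real.exp (2 * h) + 1) * l - Real.exp h * (l ^ 2 + 1)) := by
    rw [Real.cosh_eq, hexp2]; linear_combination (2 * l) * hexp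
  have e3 : (1 - Real.exp (2 * h)) = -2 * Real.exp h * Real.sinh h := by
    rw [Real.sinh_eq, hexp2]; linear_combination -hexp
  have e4 : (1 - 2 * Real.cosh h * l + l ^ 2) *
      (l * Real.sinh h / (1 - 2 * Real.cosh h * l + l ^ 2)) = l * Real.sinh h := by
    field_simp
  rw [charP]
  simp only [Polynomial.eval_sub, Polynomial.eval_mul, Polynomial.eval_C, Polynomial.eval_pow,
    Polynomial.eval_X, Polynomial.eval_one, Polynomial.eval_add, Polynomial.eval_finsetSum,
    Polynomial.eval_ofNat, Nat.add_sub_cancel]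
  rw [← e2, e3, show 2 * (k + 1) - 2 = 2 * k by omega]
  linear_combination (2 * Real.exp h * (1 - 2 * Real.cosh h * l + l ^ 2)) * e +
    (2 * Real.exp h * (1 - l) ^ (2 * k)) * e4

/-- The angle between ω + is and the real axis is arctan(s/ω), at most |s/ω| in size. The power 2j
multiplies it by 2j and removes the sign of ω, so the result stays in the right half plane. -/
lemma re_pow_pos {ω s : ℝ} (hω : ω ≠ 0) (j : ℕ) (hj : 2 * j * |s / ω| < Real.pi / 2) :
    0 < (((ω : ℂ) + s * Complex.I) ^ (2 * j)).re := by
  set θ := Real.arctan (s / ω) with hθ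
  have hc := Real.cos_arctan_pos (s / ω)
  rw [← hθ] at hc
  have hθle : |θ| ≤ |s / ω| := by
    have : ∀ x : ℝ, 0 ≤ x → Real.arctan x ≤ x := fun x hx => by
      have := Real.le_tan (Real.arctan_nonneg.2 hx) (Real.arctan_lt_pi_div_two x)
      rwa [Real.tan_arctan] at this
    rcases le_total 0 (s / ω) with h1 | h1
    · rw [abs_of_nonneg h1, hθ, abs_of_nonneg (Real.arctan_nonneg.2 h1)]
      exact this _ h1
    · rw [abs_of_nonpos h1, hθ, abs_of_nonpos (Real.arctan_le_zero.2 h1), ← Real.arctan_neg]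
      exact this _ (by linarith)
  have htan : Real.tan θ = s / ω := by rw [hθ, Real.tan_arctan]
  have hv : (ω : ℂ) + s * Complex.I = ((ω / Real.cos θ : ℝ) : ℂ) *
      (Complex.cos (θ : ℂ) + Complex.sin (θ : ℂ) * Complex.I) := by
    rw [← Complex.ofReal_cos, ← Complex.ofReal_sin]
    apply Complex.ext
    · simp only [Complex.add_re, Complex.ofReal_re, Complex.re_ofReal_mul, Complex.I_re,
        mul_zero, add_zero]
      field_simp
    · simp only [Complex.add_im, Complex.ofReal_im, Complex.im_ofReal_mul, Complex.I_im,
        mul_one, zero_add]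
      rw [Real.tan_eq_sin_div_cos] at htan
      field_simp at htan ⊢
      linarith
  rw [hv, mul_pow, Complex.cos_add_sin_mul_I_pow, ← Complex.ofReal_pow, Complex.re_ofReal_mul]
  refine mul_pos ?_ ?_
  · rw [pow_mul]; have := div_ne_zero hω hc.ne'; positivity
  · have e : ((2 * j : ℕ) : ℂ) * (θ : ℂ) = ((2 * j * θ : ℝ) : ℂ) := by push_cast; ring
    rw [e, ← Complex.ofReal_cos, ← Complex.ofReal_sin]
    simp only [Complex.add_re, Complex.ofReal_re, Complex.re_ofReal_mul, Complex.I_re, mul_zero,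
      add_zero]
    apply Real.cos_pos_of_mem_Ioo
    have h1 : |2 * j * θ| < Real.pi / 2 := by
      rw [abs_mul, abs_of_nonneg (by positivity : (0 : ℝ) ≤ 2 * j)]
      exact lt_of_le_of_lt (by gcongr) hj
    exact ⟨by linarith [neg_abs_le (2 * (j : ℝ) * θ)], by linarith [le_abs_self (2 * (j : ℝ) * θ)]⟩

/-! ### Sums over the logarithms of a negative number. -/

/-- The points `log λ + 2πi d` for `λ = -e^{-s}`. -/
noncomputable def logPoint (s : ℝ) (d : ℤ) : ℂ := -s + (2 * d + 1) * Real.pi * Complex.I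

lemma logPoint_sq (s : ℝ) (d : ℤ) :
    logPoint s d ^ 2 = -((((2 * d + 1) * Real.pi : ℝ) : ℂ) + s * Complex.I) ^ 2 := by
  have : logPoint s d = Complex.I * ((((2 * d + 1) * Real.pi : ℝ) : ℂ) + s * Complex.I) := by
    simp only [logPoint]; push_cast; linear_combination -(s : ℂ) * Complex.I_mul_I
  rw [this, mul_pow, Complex.I_sq]; ring

lemma two_mul_add_one_ne_zero (d : ℤ) : (2 * (d : ℝ) + 1) ≠ 0 := by
  have : (2 * d + 1 : ℤ) ≠ 0 := by omega
  exact_mod_cast this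

/-- The real part of w² - h² is -((2d+1)²π² - s² + h²), and s ≤ h keeps the correction from reducing
its size. -/
lemma norm_inv_sub_logPoint_le {s h : ℝ} (hs : 0 < s) (hsh : s ≤ h) (d : ℤ) :
    ‖(logPoint s d ^ 2 - h ^ 2)⁻¹‖ ≤ 1 / ((2 * d + 1 : ℤ) : ℝ) ^ 2 := by
  have h0 := two_mul_add_one_ne_zero d
  have hpi := Real.pi_gt_three
  have hre : (2 * (d : ℝ) + 1) ^ 2 ≤ |(logPoint s d ^ 2 - h ^ 2).re| := by
    have : (logPoint s d ^ 2 - h ^ 2).re =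
        -(((2 * d + 1) * Real.pi) ^ 2 - s ^ 2 + h ^ 2) := by
      rw [logPoint_sq, pow_two, pow_two]
      simp [Complex.mul_re]; ring
    rw [this, abs_neg]
    refine le_trans ?_ (le_abs_self _)
    have : 1 ≤ Real.pi ^ 2 := by nlinarith
    rw [mul_pow]
    nlinarith [sq_nonneg (2 * (d : ℝ) + 1)]
  rw [norm_inv, one_div]
  push_cast
  have hpos : 0 < (2 * (d : ℝ) + 1) ^ 2 := by positivity
  exact inv_anti₀ hpos (hre.trans (Complex.abs_re_le_norm _))

lemma summable_odd_sq : Summable fun d : ℤ => 1 / ((2 * d + 1 : ℤ) : ℝ) ^ 2 := by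
  have := (Real.summable_one_div_int_pow (p := 2)).2 (by norm_num)
  exact this.comp_injective (i := fun d : ℤ => 2 * d + 1) fun a b hab => by
    simp at hab; exact hab

lemma summable_inv_sub_logPoint {s h : ℝ} (hs : 0 < s) (hsh : s ≤ h) :
    Summable fun d : ℤ => (logPoint s d ^ 2 - (h : ℂ) ^ 2)⁻¹ :=
  Summable.of_norm_bounded summable_odd_sq (norm_inv_sub_logPoint_le hs hsh)

lemma logPoint_ne_zero {s : ℝ} (hs : 0 < s) (d : ℤ) : logPoint s d ≠ 0 := by
  intro h0
  have := congrArg Complex.re h0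
  simp [logPoint] at this
  linarith

lemma norm_inv_logPoint_pow_le {s : ℝ} (d : ℤ) (j : ℕ) :
    ‖(logPoint s d ^ (2 * j + 2))⁻¹‖ ≤ 1 / ((2 * d + 1 : ℤ) : ℝ) ^ 2 := by
  have h0 := two_mul_add_one_ne_zero d
  have hpi := Real.pi_gt_three
  have h1 : |2 * (d : ℝ) + 1| ≤ ‖logPoint s d‖ := by
    refine le_trans ?_ (Complex.abs_im_le_norm _)
    have : (logPoint s d).im = (2 * d + 1) * Real.pi := by
      simp [logPoint]
    rw [this, abs_mul, abs_of_pos Real.pi_pos]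
    nlinarith [abs_nonneg (2 * (d : ℝ) + 1)]
  have h2 : 1 ≤ |2 * (d : ℝ) + 1| := by
    have : (1 : ℤ) ≤ |2 * d + 1| := Int.one_le_abs (by omega)
    exact_mod_cast this
  rw [norm_inv, one_div, norm_pow]
  push_cast
  refine inv_anti₀ (by positivity) ?_
  rw [← sq_abs]
  calc |2 * (d : ℝ) + 1| ^ 2 ≤ ‖logPoint s d‖ ^ 2 := by gcongr
    _ ≤ ‖logPoint s d‖ ^ (2 * j + 2) := pow_le_pow_right₀ (h2.trans h1) (by omega)

lemma summable_inv_logPoint_pow (s : ℝ) (j : ℕ) :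
    Summable fun d : ℤ => (logPoint s d ^ (2 * j + 2))⁻¹ :=
  Summable.of_norm_bounded summable_odd_sq fun d => norm_inv_logPoint_pow_le d j

lemma logPoint_eq (s : ℝ) (d : ℤ) : logPoint s d =
    (2 * Real.pi * Complex.I) * ((1 / 2 + s / (2 * Real.pi) * Complex.I) + d) := by
  have : (Real.pi : ℂ) ≠ 0 := by exact_mod_cast Real.pi_ne_zero
  rw [logPoint]
  field_simp
  linear_combination -(s : ℂ) * Complex.I_sq

lemma exp_two_pi_I_logPoint (s : ℝ) :
    Complex.exp (2 * Real.pi * Complex.I * (1 / 2 + s / (2 * Real.pi) * Complex.I)) =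
      ((-Real.exp (-s) : ℝ) : ℂ) := by
  have : (Real.pi : ℂ) ≠ 0 := by exact_mod_cast Real.pi_ne_zero
  have e : 2 * Real.pi * Complex.I * (1 / 2 + s / (2 * Real.pi) * Complex.I) =
      Real.pi * Complex.I + ((-s : ℝ) : ℂ) := by
    field_simp
    push_cast
    linear_combination (s : ℂ) * Complex.I_sq
  rw [e, Complex.exp_add, Complex.exp_pi_mul_I]
  push_cast; ring

/-- This is Lipschitz's formula at the point 1/2 + is/(2π) of the upper half plane, where e^{2πiz} =
-e^{-s}; it is available as the identity behind the q-expansion of Eisenstein series. -/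
lemma tsum_inv_logPoint_pow {s : ℝ} (hs : 0 < s) (j : ℕ) :
    ∑' d : ℤ, (logPoint s d ^ (2 * j + 2))⁻¹ =
      (((∑' n : ℕ, (n : ℝ) ^ (2 * j + 1) * (-Real.exp (-s)) ^ n) /
        ((2 * j + 1).factorial : ℝ) : ℝ) : ℂ) := by
  have hpi := Real.pi_pos
  have hpi' : (Real.pi : ℂ) ≠ 0 := by exact_mod_cast Real.pi_ne_zero
  let z : UpperHalfPlane := ⟨1 / 2 + s / (2 * Real.pi) * Complex.I, by
    have e : (1 / 2 + s / (2 * Real.pi) * Complex.I : ℂ) =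
        ((1 / 2 : ℝ) : ℂ) + ((s / (2 * Real.pi) : ℝ) : ℂ) * Complex.I := by push_cast; ring
    rw [e, Complex.add_im, Complex.ofReal_im, Complex.im_ofReal_mul, Complex.I_im]
    have := div_pos hs (by positivity : 0 < 2 * Real.pi)
    linarith⟩
  have key := EisensteinSeries.qExpansion_identity (k := 2 * j + 1) (by omega) z
  have hz : (z : ℂ) = 1 / 2 + s / (2 * Real.pi) * Complex.I := rfl
  rw [hz, exp_two_pi_I_logPoint s] at key
  push_cast
  have hI : (2 * Real.pi * Complex.I) ≠ 0 := by simp [hpi', Complex.I_ne_zero]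
  have e1 : ∀ d : ℤ, (logPoint s d ^ (2 * j + 2))⁻¹ = ((2 * Real.pi * Complex.I) ^ (2 * j + 2))⁻¹ *
      (1 / ((1 / 2 + s / (2 * Real.pi) * Complex.I) + d) ^ (2 * j + 1 + 1)) := by
    intro d
    rw [logPoint_eq, mul_pow, mul_inv, ← one_div ((_ + _) ^ _)]
  simp_rw [e1]
  rw [tsum_mul_left, key]
  have e2 : (-2 * Real.pi * Complex.I) ^ (2 * j + 1 + 1) = (2 * Real.pi * Complex.I) ^ (2 * j + 2) := by
    rw [show (-2 * Real.pi * Complex.I) = -(2 * Real.pi * Complex.I) by ring]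
    exact Even.neg_pow ⟨j + 1, by ring⟩ _
  rw [e2]
  have := pow_ne_zero (2 * j + 2) hI
  push_cast
  field_simp

/-- Partial fractions: a difference of two values of the cotangent as a sum over `ℤ`. -/
lemma hasSum_cot_sub {a b : ℂ} (ha : a ∈ Complex.integerComplement)
    (hb : b ∈ Complex.integerComplement) (hs : Summable fun d : ℤ => 1 / (b + d) - 1 / (a + d)) :
    HasSum (fun d : ℤ => 1 / (b + d) - 1 / (a + d))
      (Real.pi * Complex.cot (Real.pi * b) - Real.pi * Complex.cot (Real.pi * a)) := by
  obtain ⟨S, hS⟩ := hs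
  -- Pairing d with -d turns the sum over ℤ into the difference of two Mittag-Leffler series of the
  -- cotangent, which are only defined with symmetric pairing.
  have h1 := hS.nat_add_neg
  rw [← hasSum_nat_add_iff' 1] at h1
  have h2 := ((summable_cotTerm hb).hasSum).sub ((summable_cotTerm ha).hasSum)
  have e : ∑' n, cotTerm b n - ∑' n, cotTerm a n =
      (Real.pi * Complex.cot (Real.pi * b) - 1 / b) -
        (Real.pi * Complex.cot (Real.pi * a) - 1 / a) := by
    rw [cot_series_rep' hb, cot_series_rep' ha]
  rw [e] at h2
  have h3 := h1.unique (h2.congr_fun fun n => by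
    simp only [cotTerm]
    push_cast
    ring)
  convert hS using 1
  simp at h3
  simp only [one_div] at *
  linear_combination -h3

lemma mem_integerComplement_of_re (y : ℝ) :
    ((1 / 2 : ℂ) + y * Complex.I) ∈ Complex.integerComplement := by
  rintro ⟨n, hn⟩
  have := congrArg Complex.re hn
  simp at this
  have h2 : (2 * n : ℤ) = 1 := by
    have : (2 * (n : ℝ)) = 1 := by rw [this]; norm_num
    exact_mod_cast this
  omega

/-- The identity 2h/(w² - h²) = 1/(w - h) - 1/(w + h) reduces the sum to a difference of cotangents
at points differing by ih/π; their exponential form yields the generating function of sinh(nh) at λ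
= -e^{-s}. -/
lemma tsum_inv_sub_logPoint {s h : ℝ} (hs : 0 < s) (hsh : s ≤ h) :
    h * ∑' d : ℤ, (logPoint s d ^ 2 - (h : ℂ) ^ 2)⁻¹ =
      ((-Real.exp (-s) * Real.sinh h /
        (1 - 2 * Real.cosh h * -Real.exp (-s) + (-Real.exp (-s)) ^ 2) : ℝ) : ℂ) := by
  have hh : 0 < h := hs.trans_le hsh
  have hpi' : (Real.pi : ℂ) ≠ 0 := by exact_mod_cast Real.pi_ne_zero
  have hhc : (h : ℂ) ≠ 0 := by exact_mod_cast hh.ne'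
  have hI : (2 * Real.pi * Complex.I) ≠ 0 := by simp [hpi', Complex.I_ne_zero]
  set a : ℂ := 1 / 2 + ((s - h) / (2 * Real.pi) : ℝ) * Complex.I with ha
  set b : ℂ := 1 / 2 + ((s + h) / (2 * Real.pi) : ℝ) * Complex.I with hb
  have ha' := mem_integerComplement_of_re ((s - h) / (2 * Real.pi))
  have hb' := mem_integerComplement_of_re ((s + h) / (2 * Real.pi))
  rw [← ha] at ha'
  rw [← hb] at hb'
  have hwa : ∀ d : ℤ, logPoint s d + h = (2 * Real.pi * Complex.I) * (a + d) := by
    intro d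
    rw [logPoint_eq, ha]; push_cast
    field_simp
    linear_combination (h : ℂ) * Complex.I_sq
  have hwb : ∀ d : ℤ, logPoint s d - h = (2 * Real.pi * Complex.I) * (b + d) := by
    intro d
    rw [logPoint_eq, hb]; push_cast
    field_simp
    linear_combination -(h : ℂ) * Complex.I_sq
  have hterm : ∀ d : ℤ, (logPoint s d ^ 2 - (h : ℂ) ^ 2)⁻¹ =
      (2 * h * (2 * Real.pi * Complex.I))⁻¹ * (1 / (b + d) - 1 / (a + d)) := by
    intro d
    have n1 := Complex.integerComplement_add_ne_zero ha' d
    have n2 := Complex.integerComplement_add_ne_zero hb' d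
    have e : (logPoint s d ^ 2 - (h : ℂ) ^ 2) =
        ((2 * Real.pi * Complex.I) * (a + d)) * ((2 * Real.pi * Complex.I) * (b + d)) := by
      rw [← hwa, ← hwb]; ring
    have e' : (2 * Real.pi * Complex.I) * ((a + d) - (b + d)) = 2 * h := by
      rw [mul_sub, ← hwa, ← hwb]; ring
    rw [e, div_sub_div _ _ n2 n1, one_mul, mul_one, ← e']
    have n3 : (a + d) - (b + d) ≠ 0 := by
      intro h0
      rw [h0, mul_zero] at e'
      simp [hhc] at e'
    field_simp
  have hsum : Summable fun d : ℤ => 1 / (b + d) - 1 / (a + d) := by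
    have h1 := (summable_inv_sub_logPoint hs hsh).mul_left (2 * h * (2 * Real.pi * Complex.I))
    refine h1.congr fun d => ?_
    rw [hterm, ← mul_assoc, mul_inv_cancel₀ (by simp [hhc, hpi', Complex.I_ne_zero]), one_mul]
  have hc := (hasSum_cot_sub ha' hb' hsum).tsum_eq
  simp_rw [hterm]
  rw [tsum_mul_left, hc, Complex.cot_pi_eq_exp_ratio, Complex.cot_pi_eq_exp_ratio]
  have ea : Complex.exp (2 * Real.pi * Complex.I * a) = ((-Real.exp (-s) * Real.exp h : ℝ) : ℂ) := by
    have := exp_two_pi_I_logPoint (s - h)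
    rw [ha]
    push_cast at this ⊢
    rw [this, neg_sub, sub_eq_add_neg, add_comm, Complex.exp_add]; ring
  have eb : Complex.exp (2 * Real.pi * Complex.I * b) =
      ((-Real.exp (-s) * Real.exp (-h) : ℝ) : ℂ) := by
    have := exp_two_pi_I_logPoint (s + h)
    rw [hb]
    push_cast at this ⊢
    rw [this, neg_add, Complex.exp_add]; ring
  rw [ea, eb]
  have p1 : 0 < Real.exp (-s) * Real.exp h := by positivity
  have p2 : 0 < Real.exp (-s) * Real.exp (-h) := by positivity
  have d1 : (1 - ((-Real.exp (-s) * Real.exp h : ℝ) : ℂ)) ≠ 0 := by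
    rw [← Complex.ofReal_one, ← Complex.ofReal_sub, Complex.ofReal_ne_zero]
    nlinarith
  have d2 : (1 - ((-Real.exp (-s) * Real.exp (-h) : ℝ) : ℂ)) ≠ 0 := by
    rw [← Complex.ofReal_one, ← Complex.ofReal_sub, Complex.ofReal_ne_zero]
    nlinarith
  have hexp : Complex.exp h * Complex.exp (-h) = 1 := by rw [← Complex.exp_add]; simp
  have hden : (((1 - 2 * Real.cosh h * -Real.exp (-s) + (-Real.exp (-s)) ^ 2 : ℝ)) : ℂ) =
      (1 - ((-Real.exp (-s) * Real.exp h : ℝ) : ℂ)) *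
        (1 - ((-Real.exp (-s) * Real.exp (-h) : ℝ) : ℂ)) := by
    rw [Real.cosh_eq]; push_cast
    linear_combination -(Complex.exp (-s)) ^ 2 * hexp
  have hnum : ((-Real.exp (-s) * Real.sinh h : ℝ) : ℂ) =
      (((-Real.exp (-s) * Real.exp h : ℝ) : ℂ) - ((-Real.exp (-s) * Real.exp (-h) : ℝ) : ℂ)) / 2 := by
    rw [Real.sinh_eq]; push_cast; ring
  rw [Complex.ofReal_div, hden, hnum]
  generalize ((-Real.exp (-s) * Real.exp h : ℝ) : ℂ) = u at *
  generalize ((-Real.exp (-s) * Real.exp (-h) : ℝ) : ℂ) = v at *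
  have hI0 := Complex.I_ne_zero
  field_simp
  rw [Complex.I_sq]
  ring

/-- `P_{2m-2}` has no zero in `(-1, -e^{-h}]` if `m h ≤ 2`. -/
lemma eval_charP_ne_zero {k : ℕ} {s h : ℝ} (hs : 0 < s) (hsh : s ≤ h) (hkh : (k + 1) * h ≤ 2) :
    (charP (k + 1) h).eval (-Real.exp (-s)) ≠ 0 := by
  have hh : 0 < h := hs.trans_le hsh
  have hpi := Real.pi_gt_three
  set l : ℝ := -Real.exp (-s) with hl
  have hl0 : l < 0 := by rw [hl]; linarith [Real.exp_pos (-s)]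
  have hl1 : |l| < 1 := by
    rw [hl, abs_neg, abs_of_pos (Real.exp_pos _)]
    rw [← Real.exp_zero]
    exact Real.exp_lt_exp.2 (by linarith)
  have hw : ∀ d, logPoint s d ≠ 0 := logPoint_ne_zero hs
  -- positivity of the real parts
  have hre : ∀ d : ℤ, 0 < (((-1 : ℂ) ^ (k + 1) * (logPoint s d ^ (2 * k) *
      (logPoint s d ^ 2 - (h : ℂ) ^ 2)))).re := by
    intro d
    set ω : ℝ := (2 * d + 1) * Real.pi with hω
    have h0 := two_mul_add_one_ne_zero d
    have hω0 : ω ≠ 0 := mul_ne_zero h0 Real.pi_pos.ne'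
    have e : (-1 : ℂ) ^ (k + 1) * (logPoint s d ^ (2 * k) *
      (logPoint s d ^ 2 - (h : ℂ) ^ 2)) = ((ω : ℂ) + s * Complex.I) ^ (2 * (k + 1)) +
        ((h ^ 2 : ℝ) : ℂ) * ((ω : ℂ) + s * Complex.I) ^ (2 * k) := by
      rw [pow_mul (logPoint s d), logPoint_sq, ← hω, neg_pow (_ ^ 2) k, pow_mul, pow_mul,
        pow_succ (-1 : ℂ)]
      have : ((-1 : ℂ) ^ k) * (-1) ^ k = 1 := by rw [← mul_pow]; simp
      push_cast
      linear_combination (((ω : ℂ) + s * Complex.I) ^ 2) ^ k *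
        (((ω : ℂ) + s * Complex.I) ^ 2 + (h : ℂ) ^ 2) * this
    have hsω : |s / ω| ≤ h / Real.pi := by
      rw [abs_div, abs_of_pos hs]
      have : Real.pi ≤ |ω| := by
        rw [hω, abs_mul, abs_of_pos Real.pi_pos]
        have : (1 : ℤ) ≤ |2 * d + 1| := Int.one_le_abs (by omega)
        have : (1 : ℝ) ≤ |2 * (d : ℝ) + 1| := by exact_mod_cast this
        nlinarith
      gcongr
    -- The angles are at most 2(k+1)h/π ≤ 4/π, and 4/π < π/2 because π² > 8. This is where the bound
    -- (k + 1) h ≤ 2 enters.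
    have hb : ∀ j : ℕ, j ≤ k + 1 → 2 * (j : ℝ) * |s / ω| < Real.pi / 2 := by
      intro j hj
      have hj' : (j : ℝ) ≤ k + 1 := by exact_mod_cast hj
      calc 2 * (j : ℝ) * |s / ω| ≤ 2 * (k + 1) * (h / Real.pi) := by gcongr
        _ = 2 * ((k + 1) * h) / Real.pi := by ring
        _ ≤ 2 * 2 / Real.pi := by gcongr
        _ < Real.pi / 2 := by
          rw [div_lt_div_iff₀ (by positivity) (by norm_num)]
          nlinarith
    rw [e, Complex.add_re, Complex.re_ofReal_mul]
    have p1 := re_pow_pos (s := s) hω0 (k + 1) (by push_cast; exact_mod_cast hb (k + 1) le_rfl)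
    have p2 := re_pow_pos (s := s) hω0 k (hb k (by omega))
    positivity
  have hne : ∀ d : ℤ, logPoint s d ^ 2 - (h : ℂ) ^ 2 ≠ 0 := by
    intro d h0
    have := hre d
    rw [h0] at this
    simp at this
  -- the geometric sum
  have hgeo : ∀ d : ℤ, (logPoint s d ^ 2 - (h : ℂ) ^ 2)⁻¹ -
      ∑ j ∈ Finset.range k, (h : ℂ) ^ (2 * j) * (logPoint s d ^ (2 * j + 2))⁻¹ =
      (h : ℂ) ^ (2 * k) * (logPoint s d ^ (2 * k) * (logPoint s d ^ 2 - (h : ℂ) ^ 2))⁻¹ := by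
    intro d
    have n1 := hne d
    have n2 := hw d
    have : ∀ j : ℕ, (logPoint s d ^ 2 - (h : ℂ) ^ 2)⁻¹ -
      ∑ i ∈ Finset.range j, (h : ℂ) ^ (2 * i) * (logPoint s d ^ (2 * i + 2))⁻¹ =
      (h : ℂ) ^ (2 * j) * (logPoint s d ^ (2 * j) * (logPoint s d ^ 2 - (h : ℂ) ^ 2))⁻¹ := by
      intro j
      induction j with
      | zero => simp
      | succ j ih =>
        rw [Finset.sum_range_succ, ← sub_sub, ih, mul_add, pow_add, pow_add]
        field_simp
        ring
    exact this k
  set T : ℤ → ℂ := fun d => (logPoint s d ^ 2 - (h : ℂ) ^ 2)⁻¹ -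
      ∑ j ∈ Finset.range k, (h : ℂ) ^ (2 * j) * (logPoint s d ^ (2 * j + 2))⁻¹ with hT
  have hsT : HasSum T ((∑' d : ℤ, (logPoint s d ^ 2 - (h : ℂ) ^ 2)⁻¹) -
      ∑ j ∈ Finset.range k, (h : ℂ) ^ (2 * j) * ∑' d : ℤ, (logPoint s d ^ (2 * j + 2))⁻¹) :=
    (summable_inv_sub_logPoint hs hsh).hasSum.sub
      (hasSum_sum fun j _ => (summable_inv_logPoint_pow s j).hasSum.mul_left _)
  -- Inverting a complex number preserves the sign of its real part.
  have hTpos : ∀ d, 0 < ((-1 : ℂ) ^ (k + 1) * T d).re := by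
    intro d
    have e : (-1 : ℂ) ^ (k + 1) * T d = ((h ^ (2 * k) : ℝ) : ℂ) *
        ((-1 : ℂ) ^ (k + 1) * (logPoint s d ^ (2 * k) *
          (logPoint s d ^ 2 - (h : ℂ) ^ 2)))⁻¹ := by
      rw [hT]
      dsimp only
      rw [hgeo d, mul_inv ((-1 : ℂ) ^ (k + 1)), ← inv_pow]
      push_cast
      norm_num
      ring
    rw [e, Complex.re_ofReal_mul, Complex.inv_re]
    have := hre d
    refine mul_pos (by positivity) (div_pos this ?_)
    rw [Complex.normSq_pos]
    intro h0
    rw [h0] at this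
    simp at this
  intro h0
  -- For s ≤ h the series ∑ sinh(nh) λ^n diverges; only its closed form enters, and this closed form
  -- is what the sum of cotangents produces.
  have hG := mul_eval_charP k h hl1 hl0
  rw [h0, mul_zero] at hG
  have hq : 0 < 1 - 2 * Real.cosh h * l + l ^ 2 := by nlinarith [Real.cosh_pos h, sq_nonneg l]
  have hG0 : (l * Real.sinh h / (1 - 2 * Real.cosh h * l + l ^ 2) -
        ∑ j ∈ Finset.range k, h ^ (2 * j + 1) / ((2 * j + 1).factorial : ℝ) *
          ∑' n : ℕ, (n : ℝ) ^ (2 * j + 1) * l ^ n) = 0 := by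
    have hne : -2 * Real.exp h * (1 - l) ^ (2 * k) * (1 - 2 * Real.cosh h * l + l ^ 2) ≠ 0 := by
      have := pow_pos (show 0 < 1 - l by linarith) (2 * k)
      have := Real.exp_pos h
      have : 0 < Real.exp h * (1 - l) ^ (2 * k) * (1 - 2 * Real.cosh h * l + l ^ 2) := by positivity
      intro h1
      linarith
    exact (mul_eq_zero.1 hG.symm).resolve_left hne
  have hsum0 : (∑' d : ℤ, (logPoint s d ^ 2 - (h : ℂ) ^ 2)⁻¹) -
      ∑ j ∈ Finset.range k, (h : ℂ) ^ (2 * j) * ∑' d : ℤ, (logPoint s d ^ (2 * j + 2))⁻¹ = 0 := by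
    have hhc : (h : ℂ) ≠ 0 := by exact_mod_cast hh.ne'
    apply mul_left_cancel₀ hhc
    rw [mul_zero, mul_sub, tsum_inv_sub_logPoint hs hsh, Finset.mul_sum, ← hl]
    have := congrArg (fun x : ℝ => (x : ℂ)) hG0
    simp only [Complex.ofReal_sub, Complex.ofReal_sum, Complex.ofReal_zero] at this
    rw [← this]
    congr 1
    refine Finset.sum_congr rfl fun j _ => ?_
    rw [tsum_inv_logPoint_pow hs, ← hl]
    push_cast
    ring
  -- A zero of P would make the sum of the terms T vanish, although after multiplication by
  -- (-1)^{k+1} every term has positive real part.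
  rw [hsum0] at hsT
  have h1 := Complex.hasSum_re (hsT.mul_left ((-1 : ℂ) ^ (k + 1)))
  have h2 := h1.summable.tsum_pos (fun d => (hTpos d).le) 0 (hTpos 0)
  rw [h1.tsum_eq] at h2
  simp at h2

lemma norm_lt_exp_of_mem_innerRoots {k : ℕ} {h : ℝ} (hh : 0 < h) (hkh : k = 0 ∨ (k + 1) * h ≤ 2)
    {z : ℂ} (hz : z ∈ innerRoots (k + 1) h) : ‖z‖ < Real.exp (-h) := by
  rcases hkh with rfl | hkh
  · have := card_innerRoots hh 0
    rw [Finset.card_eq_zero] at this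
    rw [this] at hz
    simp at hz
  obtain ⟨x, rfl, h1, h2, h3⟩ := exists_real_of_mem_innerRoots hh k hz
  rw [Complex.norm_real, Real.norm_eq_abs, abs_of_neg h2]
  by_contra hcon
  rw [not_lt] at hcon
  have hlog : -Real.exp (-(-Real.log (-x))) = x := by
    rw [neg_neg, Real.exp_log (by linarith), neg_neg]
  rw [← hlog] at h3
  refine eval_charP_ne_zero ?_ ?_ hkh h3
  · have := Real.log_neg (x := -x) (by linarith) (by linarith)
    linarith
  · have := (Real.le_log_iff_exp_le (by linarith : 0 < -x)).2 hcon
    linarith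

end OptimalQuadrature

namespace OptimalQuadrature

/-! ### Two-sided sequences and the shift -/

/-- The shift `u ↦ u(· - 1)` on two-sided sequences. -/
def shift : Module.End ℂ (ℤ → ℂ) where
  toFun u β := u (β - 1)
  map_add' _ _ := rfl
  map_smul' _ _ := rfl

@[simp] lemma shift_apply (u : ℤ → ℂ) (β : ℤ) : shift u β = u (β - 1) := rfl

/-- The action of a polynomial in the shift. -/
noncomputable def act (p : ℂ[X]) : Module.End ℂ (ℤ → ℂ) := Polynomial.aeval shift p

lemma act_mul (p q : ℂ[X]) (u : ℤ → ℂ) : act (p * q) u = act p (act q u) := by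
  simp [act]

lemma act_comm (p q : ℂ[X]) (u : ℤ → ℂ) : act p (act q u) = act q (act p u) := by
  rw [← act_mul, mul_comm, act_mul]

@[simp] lemma act_add (p q : ℂ[X]) (u : ℤ → ℂ) : act (p + q) u = act p u + act q u := by
  simp [act]

@[simp] lemma act_sub (p q : ℂ[X]) (u : ℤ → ℂ) : act (p - q) u = act p u - act q u := by
  simp [act]

@[simp] lemma act_C (a : ℂ) (u : ℤ → ℂ) : act (Polynomial.C a) u = a • u := by
  simp [act]

@[simp] lemma act_one (u : ℤ → ℂ) : act 1 u = u := by
  simp [act]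

@[simp] lemma act_X (u : ℤ → ℂ) : act Polynomial.X u = shift u := by
  simp [act]

lemma act_X_pow (i : ℕ) (u : ℤ → ℂ) (β : ℤ) : act (Polynomial.X ^ i) u β = u (β - i) := by
  induction i generalizing β with
  | zero => simp
  | succ i ih =>
    rw [pow_succ', act_mul, act_X, shift_apply, ih]
    congr 1; push_cast; ring

lemma act_sum {ι : Type*} (s : Finset ι) (p : ι → ℂ[X]) (u : ℤ → ℂ) :
    act (∑ i ∈ s, p i) u = ∑ i ∈ s, act (p i) u := by
  simp [act]

lemma act_apply (p : ℂ[X]) (u : ℤ → ℂ) (β : ℤ) :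
    act p u β = ∑ i ∈ Finset.range (p.natDegree + 1), p.coeff i * u (β - i) := by
  conv_lhs => rw [p.as_sum_range_C_mul_X_pow]
  rw [act_sum, Finset.sum_apply]
  refine Finset.sum_congr rfl fun i _ => ?_
  rw [act_mul, act_C, Pi.smul_apply, act_X_pow, smul_eq_mul]

/-- The unit sequence `δ`. -/
def unitSeq : ℤ → ℂ := fun β => if β = 0 then 1 else 0

/-! ### Growth and decay classes, and convolution between them. -/

/-- At most exponential growth with rate `h`. -/
def Grows (h : ℝ) (u : ℤ → ℂ) : Prop := ∃ C : ℝ, ∀ β : ℤ, ‖u β‖ ≤ C * Real.exp (h * |(β : ℝ)|)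

/-- Summability against `e^{h|β|}`. -/
def Decays (h : ℝ) (D : ℤ → ℂ) : Prop := Summable fun β : ℤ => ‖D β‖ * Real.exp (h * |(β : ℝ)|)

lemma exp_abs_le {h : ℝ} (hh : 0 ≤ h) {x y d : ℝ} (hxy : |x| ≤ |y| + d) :
    Real.exp (h * |x|) ≤ Real.exp (h * d) * Real.exp (h * |y|) := by
  rw [← Real.exp_add]
  apply Real.exp_le_exp.2
  nlinarith

lemma Grows.add {h : ℝ} {u v : ℤ → ℂ} (hu : Grows h u) (hv : Grows h v) : Grows h (u + v) := by
  obtain ⟨C, hC⟩ := hu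
  obtain ⟨C', hC'⟩ := hv
  refine ⟨C + C', fun β => (norm_add_le _ _).trans ?_⟩
  rw [add_mul]
  exact add_le_add (hC β) (hC' β)

lemma Grows.smul {h : ℝ} {u : ℤ → ℂ} (hu : Grows h u) (a : ℂ) : Grows h (a • u) := by
  obtain ⟨C, hC⟩ := hu
  refine ⟨‖a‖ * C, fun β => ?_⟩
  rw [Pi.smul_apply, norm_smul, mul_assoc]
  exact mul_le_mul_of_nonneg_left (hC β) (norm_nonneg a)

lemma Grows.sub {h : ℝ} {u v : ℤ → ℂ} (hu : Grows h u) (hv : Grows h v) : Grows h (u - v) := by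
  have := hu.add (hv.smul (-1))
  rwa [neg_one_smul, ← sub_eq_add_neg] at this

lemma Grows.shift {h : ℝ} (hh : 0 ≤ h) {u : ℤ → ℂ} (hu : Grows h u) : Grows h (shift u) := by
  obtain ⟨C, hC⟩ := hu
  have hC0 : 0 ≤ C := by
    have := (norm_nonneg _).trans (hC 0)
    exact nonneg_of_mul_nonneg_left this (Real.exp_pos _)
  refine ⟨C * Real.exp (h * 1), fun β => (hC _).trans ?_⟩
  rw [mul_assoc]
  refine mul_le_mul_of_nonneg_left (exp_abs_le hh ?_) hC0
  push_cast
  have := abs_sub (β : ℝ) 1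
  rwa [abs_one] at this

lemma Grows.act {h : ℝ} (hh : 0 ≤ h) {u : ℤ → ℂ} (hu : Grows h u) (p : ℂ[X]) :
    Grows h (act p u) := by
  induction p using Polynomial.induction_on with
  | C a => rw [act_C]; exact hu.smul a
  | add p q hp hq => rw [act_add]; exact hp.add hq
  | monomial n a ih =>
    rw [show (Polynomial.C a * Polynomial.X ^ (n + 1) : ℂ[X]) =
      Polynomial.X * (Polynomial.C a * Polynomial.X ^ n) by ring, act_mul, act_X]
    exact ih.shift hh

lemma Decays.add {h : ℝ} {u v : ℤ → ℂ} (hu : Decays h u) (hv : Decays h v) : Decays h (u + v) := by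
  refine Summable.of_nonneg_of_le (fun β => by positivity) (fun β => ?_) (Summable.add hu hv)
  rw [← add_mul]
  exact mul_le_mul_of_nonneg_right (norm_add_le _ _) (Real.exp_pos _).le

lemma Decays.smul {h : ℝ} {u : ℤ → ℂ} (hu : Decays h u) (a : ℂ) : Decays h (a • u) := by
  refine (Summable.mul_left ‖a‖ hu).congr fun β => ?_
  rw [Pi.smul_apply, norm_smul, mul_assoc]

lemma Decays.shift {h : ℝ} (hh : 0 ≤ h) {u : ℤ → ℂ} (hu : Decays h u) : Decays h (shift u) := by
  have h1 := hu.comp_injective (i := fun β : ℤ => β - 1) (fun a b hab => by simpa using hab)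
  refine Summable.of_nonneg_of_le (fun β => by positivity) (fun β => ?_)
    (h1.mul_left (Real.exp (h * 1)))
  simp only [Function.comp, shift_apply]
  rw [mul_left_comm]
  refine mul_le_mul_of_nonneg_left (exp_abs_le hh ?_) (norm_nonneg _)
  push_cast
  have := abs_add_le ((β : ℝ) - 1) 1
  rwa [sub_add_cancel, abs_one] at this

lemma Decays.act {h : ℝ} (hh : 0 ≤ h) {u : ℤ → ℂ} (hu : Decays h u) (p : ℂ[X]) :
    Decays h (act p u) := by
  induction p using Polynomial.induction_on with
  | C a => rw [act_C]; exact hu.smul a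
  | add p q hp hq => rw [act_add]; exact hp.add hq
  | monomial n a ih =>
    rw [show (Polynomial.C a * Polynomial.X ^ (n + 1) : ℂ[X]) =
      Polynomial.X * (Polynomial.C a * Polynomial.X ^ n) by ring, act_mul, act_X]
    exact ih.shift hh

lemma decays_unitSeq (h : ℝ) : Decays h unitSeq := by
  refine summable_of_ne_finset_zero (s := {0}) fun β hβ => ?_
  simp at hβ
  simp [unitSeq, hβ]

/-- The discrete convolution of two-sided sequences. -/
noncomputable def conv (D u : ℤ → ℂ) (β : ℤ) : ℂ := ∑' γ : ℤ, D (β - γ) * u γ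

/-- From |γ| ≤ |β| + |β - γ| the growth of u at γ is paid for by the weighted decay of D at β - γ
and a factor depending on β alone. -/
lemma norm_conv_term_le {h : ℝ} (hh : 0 ≤ h) {D u : ℤ → ℂ} {C : ℝ}
    (hC : ∀ β : ℤ, ‖u β‖ ≤ C * Real.exp (h * |(β : ℝ)|)) (β γ : ℤ) :
    ‖D (β - γ) * u γ‖ ≤ C * Real.exp (h * |(β : ℝ)|) *
      (‖D (β - γ)‖ * Real.exp (h * |((β - γ : ℤ) : ℝ)|)) := by
  have hC0 : 0 ≤ C := by
    have := (norm_nonneg _).trans (hC 0)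
    exact nonneg_of_mul_nonneg_left this (Real.exp_pos _)
  rw [norm_mul]
  calc ‖D (β - γ)‖ * ‖u γ‖ ≤ ‖D (β - γ)‖ * (C * Real.exp (h * |(γ : ℝ)|)) := by
        gcongr; exact hC γ
    _ ≤ ‖D (β - γ)‖ * (C * (Real.exp (h * |(β : ℝ)|) * Real.exp (h * |((β - γ : ℤ) : ℝ)|))) := by
        gcongr
        refine exp_abs_le hh ?_
        push_cast
        have := abs_sub (β : ℝ) ((β : ℝ) - γ)
        rw [sub_sub_cancel] at this
        linarith
    _ = _ := by ring

lemma Decays.summable_conv {h : ℝ} (hh : 0 ≤ h) {D u : ℤ → ℂ} (hD : Decays h D)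
    (hu : Grows h u) (β : ℤ) : Summable fun γ : ℤ => D (β - γ) * u γ := by
  obtain ⟨C, hC⟩ := hu
  have h1 := hD.comp_injective (i := fun γ : ℤ => β - γ) (fun a b hab => by simpa using hab)
  exact Summable.of_norm_bounded (h1.mul_left _) (norm_conv_term_le hh hC β)

lemma Decays.grows_conv {h : ℝ} (hh : 0 ≤ h) {D u : ℤ → ℂ} (hD : Decays h D)
    (hu : Grows h u) : Grows h (conv D u) := by
  obtain ⟨C, hC⟩ := hu
  refine ⟨C * ∑' γ : ℤ, ‖D γ‖ * Real.exp (h * |(γ : ℝ)|), fun β => ?_⟩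
  have h1 := hD.comp_injective (i := fun γ : ℤ => β - γ) (fun a b hab => by simpa using hab)
  refine (tsum_of_norm_bounded (h1.mul_left _).hasSum (norm_conv_term_le hh hC β)).trans
    (le_of_eq ?_)
  rw [tsum_mul_left]
  have h2 := (Equiv.subLeft β).tsum_eq (fun γ : ℤ => ‖D γ‖ * Real.exp (h * |(γ : ℝ)|))
  simp only [Function.comp, Equiv.subLeft_apply] at h2 ⊢
  rw [h2]; ring

lemma conv_smul_left (a : ℂ) (D u : ℤ → ℂ) : conv (a • D) u = a • conv D u := by
  ext β
  simp only [conv, Pi.smul_apply, smul_eq_mul, mul_assoc]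
  exact tsum_mul_left

lemma conv_add_left {h : ℝ} (hh : 0 ≤ h) {D D' u : ℤ → ℂ} (hD : Decays h D) (hD' : Decays h D')
    (hu : Grows h u) : conv (D + D') u = conv D u + conv D' u := by
  ext β
  simp only [conv, Pi.add_apply, add_mul]
  exact (hD.summable_conv hh hu β).tsum_add (hD'.summable_conv hh hu β)

lemma conv_sub_right {h : ℝ} (hh : 0 ≤ h) {D u v : ℤ → ℂ} (hD : Decays h D)
    (hu : Grows h u) (hv : Grows h v) : conv D (u - v) = conv D u - conv D v := by
  ext β
  simp only [conv, Pi.sub_apply, mul_sub]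
  exact (hD.summable_conv hh hu β).tsum_sub (hD.summable_conv hh hv β)

lemma act_conv {h : ℝ} (hh : 0 ≤ h) {D u : ℤ → ℂ} (hD : Decays h D) (hu : Grows h u) (p : ℂ[X]) :
    act p (conv D u) = conv (act p D) u := by
  induction p using Polynomial.induction_on with
  | C a => rw [act_C, act_C, conv_smul_left]
  | add p q hp hq =>
    rw [act_add, act_add, hp, hq, conv_add_left hh (hD.act hh p) (hD.act hh q) hu]
  | monomial n a ih =>
    rw [show (Polynomial.C a * Polynomial.X ^ (n + 1) : ℂ[X]) =
      Polynomial.X * (Polynomial.C a * Polynomial.X ^ n) by ring, act_mul Polynomial.X,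
      act_mul Polynomial.X, act_X, act_X, ih]
    ext β
    simp only [shift_apply, conv]
    congr 1
    ext γ
    rw [show β - 1 - γ = β - γ - 1 by ring]

lemma conv_unitSeq (u : ℤ → ℂ) : conv unitSeq u = u := by
  ext β
  rw [conv, tsum_eq_single β]
  · simp [unitSeq]
  · intro γ hγ
    simp [unitSeq, sub_eq_zero, hγ.symm]

/-! ### Uniqueness for recurrences under a growth bound. -/

lemma tendsto_pow_mul_exp {h : ℝ} {z : ℂ} (hz : ‖z‖ < Real.exp (-h)) (c : ℝ) :
    Filter.Tendsto (fun n : ℕ => c * (‖z‖ * Real.exp h) ^ n) Filter.atTop (nhds 0) := by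
  have h1 : ‖z‖ * Real.exp h < 1 := by
    calc ‖z‖ * Real.exp h < Real.exp (-h) * Real.exp h := by gcongr
      _ = 1 := by rw [← Real.exp_add]; simp
  simpa using (tendsto_pow_atTop_nhds_zero_of_lt_one (by positivity) h1).const_mul c

/-- After n steps |u(β)| is at most a constant times (|z| e^h)^n, which tends to 0. The strict bound
|z| < e^{-h} is exactly what beats growth of rate h. -/
lemma Grows.eq_zero_of_step {h : ℝ} (hh : 0 ≤ h) {u : ℤ → ℂ} (hu : Grows h u) {z : ℂ}
    (hz : ‖z‖ < Real.exp (-h)) {ε : ℤ} (hε : |ε| = 1) (hstep : ∀ β, u β = z * u (β + ε)) :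
    u = 0 := by
  obtain ⟨C, hC⟩ := hu
  have hC0 : 0 ≤ C := by
    have := (norm_nonneg _).trans (hC 0)
    exact nonneg_of_mul_nonneg_left this (Real.exp_pos _)
  ext β
  have hn : ∀ n : ℕ, u β = z ^ n * u (β + n * ε) := by
    intro n
    induction n with
    | zero => simp
    | succ n ih =>
      rw [ih, hstep (β + n * ε), pow_succ, mul_assoc]
      congr 3; push_cast; ring
  have hle : ∀ n : ℕ, ‖u β‖ ≤ (C * Real.exp (h * |(β : ℝ)|)) * (‖z‖ * Real.exp h) ^ n := by
    intro n
    rw [hn n, norm_mul, norm_pow, mul_pow, ← Real.exp_nat_mul]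
    have h1 : Real.exp (h * |((β + n * ε : ℤ) : ℝ)|) ≤
        Real.exp (h * n) * Real.exp (h * |(β : ℝ)|) := by
      refine exp_abs_le hh ?_
      push_cast
      have := abs_add_le (β : ℝ) (n * ε)
      have hε' : |(ε : ℝ)| = 1 := by exact_mod_cast hε
      rwa [abs_mul, Nat.abs_cast, hε', mul_one] at this
    calc ‖z‖ ^ n * ‖u (β + n * ε)‖
        ≤ ‖z‖ ^ n * (C * (Real.exp (h * n) * Real.exp (h * |(β : ℝ)|))) := by
          gcongr
          exact (hC _).trans (by gcongr)
      _ = _ := by rw [mul_comm h n]; ring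
  have := ge_of_tendsto' (tendsto_pow_mul_exp hz _) hle
  simpa using this

/-- The factors are removed one at a time: each is a first order recurrence of ratio z in one of the
two directions, and applying the remaining factors keeps the growth class. -/
lemma eq_zero_of_act_prod {h : ℝ} (hh : 0 ≤ h) {s : Finset ℂ}
    (hs : ∀ z ∈ s, ‖z‖ < Real.exp (-h)) {u : ℤ → ℂ} (hu : Grows h u)
    (h0 : act (∏ z ∈ s, ((Polynomial.X - Polynomial.C z) *
      (1 - Polynomial.C z * Polynomial.X))) u = 0) : u = 0 := by
  induction s using Finset.induction_on generalizing u with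
  | empty => simpa using h0
  | insert z s hzs ih =>
    rw [Finset.prod_insert hzs, mul_comm, act_mul] at h0
    have h1 := ih (fun w hw => hs w (Finset.mem_insert_of_mem hw)) (hu.act hh _) h0
    have hz := hs z (Finset.mem_insert_self z s)
    rw [act_mul] at h1
    have h2 : act (1 - Polynomial.C z * Polynomial.X) u = 0 := by
      refine (hu.act hh _).eq_zero_of_step hh hz (ε := 1) (by simp) fun β => ?_
      have := congrFun h1 (β + 1)
      rw [act_sub, act_X, act_C] at this
      simp only [Pi.sub_apply, shift_apply, Pi.smul_apply, smul_eq_mul, Pi.zero_apply,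
        add_sub_cancel_right] at this
      exact sub_eq_zero.1 this
    refine hu.eq_zero_of_step hh hz (ε := -1) (by simp) fun β => ?_
    have := congrFun h2 β
    rw [act_sub, act_one, act_mul, act_X, act_C] at this
    simp only [Pi.sub_apply, shift_apply, Pi.smul_apply, smul_eq_mul, Pi.zero_apply] at this
    exact sub_eq_zero.1 this

/-- A sequence annihilated by a polynomial in the shift is determined by its values on a left half
line. -/
lemma eq_zero_of_act_eq_zero_of_left {p : ℂ[X]} (hp : p.coeff 0 ≠ 0) {v : ℤ → ℂ} {β₀ : ℤ}
    (h0 : act p v = 0) (hv : ∀ β < β₀, v β = 0) : v = 0 := by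
  have key : ∀ n : ℕ, ∀ β < β₀ + n, v β = 0 := by
    intro n
    induction n with
    | zero => simpa using hv
    | succ n ih =>
      intro β hβ
      rcases lt_or_ge β (β₀ + n) with h1 | h1
      · exact ih β h1
      · have h2 := congrFun h0 β
        rw [act_apply, Finset.sum_range_succ', Finset.sum_eq_zero] at h2
        · simpa [hp] using h2
        · intro i _
          rw [ih _ (by push_cast at hβ ⊢; omega), mul_zero]
  ext β
  exact key (β - β₀ + 1).toNat β (by omega)

/-! ### Sequences annihilated by the shift polynomial -/

lemma act_exp (p : ℂ[X]) (c : ℝ) : act p (fun β : ℤ => ((Real.exp (c * β) : ℝ) : ℂ)) =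
    p.eval ((Real.exp (-c) : ℝ) : ℂ) • fun β : ℤ => ((Real.exp (c * β) : ℝ) : ℂ) := by
  induction p using Polynomial.induction_on with
  | C a => rw [act_C, Polynomial.eval_C]
  | add p q hp hq => rw [act_add, Polynomial.eval_add, hp, hq, add_smul]
  | monomial n a ih =>
    rw [show (Polynomial.C a * Polynomial.X ^ (n + 1) : ℂ[X]) =
      Polynomial.X * (Polynomial.C a * Polynomial.X ^ n) by ring, act_mul, act_X, ih]
    ext β
    simp only [shift_apply, Pi.smul_apply, smul_eq_mul, Polynomial.eval_mul, Polynomial.eval_X]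
    push_cast
    rw [show (c : ℂ) * (β - 1) = -c + c * β by ring, Complex.exp_add]
    ring

lemma act_one_sub_X_pow (n : ℕ) (f : ℂ → ℂ) (β : ℤ) :
    act ((1 - Polynomial.X) ^ n) (fun β : ℤ => f β) β = (fwdDiff 1)^[n] f (β - n) := by
  induction n generalizing f with
  | zero => simp
  | succ n ih =>
    rw [pow_succ, act_mul]
    have : act (1 - Polynomial.X) (fun β : ℤ => f β) =
        fun β : ℤ => (fun y => fwdDiff 1 f (y + (-1))) (β : ℂ) := by
      ext β
      simp [fwdDiff, ← sub_eq_add_neg]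
    rw [this, ih (fun y => fwdDiff 1 f (y + (-1))), fwdDiff_iter_comp_add, Function.iterate_succ_apply]
    have e : (β : ℂ) - n + (-1) = β - (n + 1 : ℕ) := by push_cast; ring
    rw [e]

lemma act_one_sub_X_pow_eval {n : ℕ} {q : ℂ[X]} (hq : q.degree < n) :
    act ((1 - Polynomial.X) ^ n) (fun β : ℤ => q.eval (β : ℂ)) = 0 := by
  rcases eq_or_ne q 0 with rfl | hq0
  · have : (fun β : ℤ => (0 : ℂ[X]).eval (β : ℂ)) = 0 := by ext; simp
    rw [this, map_zero]
  · ext β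
    rw [act_one_sub_X_pow n (fun x => q.eval x), Polynomial.fwdDiff_iter_eq_zero_of_degree_lt
      ((Polynomial.natDegree_lt_iff_degree_lt hq0).2 hq)]
    rfl

/-- The polynomial `2 (1 - λ)^{2m-2} (λ (e^{2h} + 1) - e^h (λ² + 1))`, `m = k + 1`. -/
noncomputable def opPoly (k : ℕ) (h : ℝ) : ℝ[X] :=
  Polynomial.C (-2 * Real.exp h) * ((1 - Polynomial.X) ^ (2 * k) * coshPoly h)

/-- `opPoly` with complex coefficients. -/
noncomputable def opPolyC (k : ℕ) (h : ℝ) : ℂ[X] := (opPoly k h).map (algebraMap ℝ ℂ)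

/-- `P_{2m-2}` with complex coefficients, `m = k + 1`. -/
noncomputable def charPC (k : ℕ) (h : ℝ) : ℂ[X] := (charP (k + 1) h).map (algebraMap ℝ ℂ)

lemma opPolyC_eq (k : ℕ) (h : ℝ) : opPolyC k h = Polynomial.C ((-2 * Real.exp h : ℝ) : ℂ) *
    ((1 - Polynomial.X) ^ (2 * k) * (coshPoly h).map (algebraMap ℝ ℂ)) := by
  simp [opPolyC, opPoly]

lemma eval_opPoly_exp (k : ℕ) {h c : ℝ} (hc : c = h ∨ c = -h) :
    (opPolyC k h).eval ((Real.exp (-c) : ℝ) : ℂ) = 0 := by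
  have e : (coshPoly h).eval (Real.exp (-c)) = 0 := by
    have hexp : Real.exp h * Real.exp (-h) = 1 := by rw [← Real.exp_add]; simp
    simp only [coshPoly, Polynomial.eval_add, Polynomial.eval_sub, Polynomial.eval_one,
      Polynomial.eval_mul, Polynomial.eval_C, Polynomial.eval_X, Polynomial.eval_pow, Real.cosh_eq]
    rcases hc with rfl | rfl
    · linear_combination -hexp
    · rw [neg_neg]; linear_combination -hexp
  rw [opPolyC, opPoly, ← Complex.coe_algebraMap, Polynomial.eval_map_apply, Polynomial.eval_mul,
    Polynomial.eval_mul, e]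
  simp

lemma act_opPoly_exp (k : ℕ) {h c : ℝ} (hc : c = h ∨ c = -h) :
    act (opPolyC k h) (fun β : ℤ => ((Real.exp (c * β) : ℝ) : ℂ)) = 0 := by
  rw [act_exp, eval_opPoly_exp k hc, zero_smul]

lemma act_opPoly_eval (k : ℕ) (h : ℝ) {q : ℝ[X]} (hq : q.degree < (2 * k : ℕ)) :
    act (opPolyC k h) (fun β : ℤ => ((q.eval (h * β) : ℝ) : ℂ)) = 0 := by
  have e : (fun β : ℤ => ((q.eval (h * β) : ℝ) : ℂ)) = fun β : ℤ =>
      ((q.comp (Polynomial.C h * Polynomial.X)).map (algebraMap ℝ ℂ)).eval (β : ℂ) := by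
    ext β
    have : (β : ℂ) = algebraMap ℝ ℂ (β : ℝ) := by simp
    rw [this, Polynomial.eval_map_apply, Polynomial.eval_comp]
    simp
  rw [e, opPolyC_eq, mul_comm ((1 - Polynomial.X) ^ (2 * k)), ← mul_assoc, act_mul,
    act_one_sub_X_pow_eval, map_zero]
  rw [Polynomial.degree_map]
  refine lt_of_le_of_lt ?_ hq
  rw [Polynomial.degree_le_iff_coeff_zero]
  intro n hn
  rw [Polynomial.comp_C_mul_X_coeff, Polynomial.coeff_eq_zero_of_degree_lt hn, zero_mul]

/-! ### Generating functions as two-sided sequences -/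

/-- The coefficients of a power series as a two-sided sequence. -/
noncomputable def seriesSeq (f : PowerSeries ℝ) : ℤ → ℂ :=
  fun β => if 0 ≤ β then ((PowerSeries.coeff β.toNat f : ℝ) : ℂ) else 0

lemma seriesSeq_mul (A : ℝ[X]) (f : PowerSeries ℝ) :
    seriesSeq ((A : PowerSeries ℝ) * f) = act (A.map (algebraMap ℝ ℂ)) (seriesSeq f) := by
  induction A using Polynomial.induction_on with
  | C a =>
    rw [Polynomial.map_C, act_C]
    ext β
    simp only [seriesSeq, Pi.smul_apply, Polynomial.coe_C, PowerSeries.coeff_C_mul]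
    split_ifs <;> simp
  | add p q hp hq =>
    rw [Polynomial.coe_add, add_mul, Polynomial.map_add, act_add, ← hp, ← hq]
    ext β
    simp only [seriesSeq, Pi.add_apply, map_add]
    split_ifs <;> simp
  | monomial n a ih =>
    rw [show (Polynomial.C a * Polynomial.X ^ (n + 1) : ℝ[X]) =
      Polynomial.X * (Polynomial.C a * Polynomial.X ^ n) by ring, Polynomial.map_mul, act_mul,
      ← ih, Polynomial.map_X, act_X, Polynomial.coe_mul, Polynomial.coe_X, mul_assoc]
    ext β
    simp only [seriesSeq, shift_apply]
    rcases lt_trichotomy β 0 with h1 | rfl | h1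
    · rw [if_neg (by omega), if_neg (by omega)]
    · simp
    · rw [if_pos (by omega), if_pos (by omega), show β.toNat = (β - 1).toNat + 1 by omega,
        PowerSeries.coeff_succ_X_mul]

lemma seriesSeq_one : seriesSeq 1 = unitSeq := by
  ext β
  simp only [seriesSeq, unitSeq, PowerSeries.coeff_one]
  rcases lt_trichotomy β 0 with h1 | rfl | h1
  · rw [if_neg (by omega), if_neg (by omega)]
  · simp
  · rw [if_pos (by omega), if_neg (by omega), if_neg (by omega), Complex.ofReal_zero]

lemma opPoly_mul_mk (k : ℕ) (h : ℝ) :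
    (opPoly k h : PowerSeries ℝ) * PowerSeries.mk (fun i : ℕ => primSinh (2 * k) (i * h)) =
      ((Polynomial.X * charP (k + 1) h : ℝ[X]) : PowerSeries ℝ) := by
  rw [charP_eq, Polynomial.coe_mul, Polynomial.coe_mul, Polynomial.coe_X, mul_left_comm,
    X_mul_eulerSplinePoly, opPoly]
  simp only [Polynomial.coe_mul, Polynomial.coe_sub, Polynomial.coe_one, Polynomial.coe_pow,
    Polynomial.coe_X]
  ring

/-- On the whole line `primSinh (2 * k)` is a combination of e^x, e^{-x} and a polynomial of degree
below 2k, all of which are killed. -/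
lemma act_opPoly_primSinh (k : ℕ) (h : ℝ) :
    act (opPolyC k h) (fun β : ℤ => ((primSinh (2 * k) (h * β) : ℝ) : ℂ)) = 0 := by
  set q : ℝ[X] := ∑ j ∈ Finset.range k,
    Polynomial.C (1 / ((2 * j + 1).factorial : ℝ)) * Polynomial.X ^ (2 * j + 1) with hq
  have e : (fun β : ℤ => ((primSinh (2 * k) (h * β) : ℝ) : ℂ)) =
      (1 / 2 : ℂ) • (fun β : ℤ => ((Real.exp (h * β) : ℝ) : ℂ)) -
      (1 / 2 : ℂ) • (fun β : ℤ => ((Real.exp (-h * β) : ℝ) : ℂ)) -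
      fun β : ℤ => ((q.eval (h * β) : ℝ) : ℂ) := by
    ext β
    have hqe : q.eval (h * β) =
        ∑ j ∈ Finset.range k, (h * β) ^ (2 * j + 1) / ((2 * j + 1).factorial : ℝ) := by
      rw [hq, Polynomial.eval_finsetSum]
      refine Finset.sum_congr rfl fun j _ => ?_
      simp only [Polynomial.eval_mul, Polynomial.eval_C, Polynomial.eval_pow, Polynomial.eval_X]
      ring
    rw [primSinh_even, ← hqe]
    simp only [Pi.sub_apply, Pi.smul_apply, smul_eq_mul, neg_mul]
    push_cast
    ring
  rw [e, map_sub, map_sub, map_smul, map_smul, act_opPoly_exp k (Or.inl rfl),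
    act_opPoly_exp k (Or.inr rfl), act_opPoly_eval]
  · simp
  · rw [Polynomial.degree_lt_iff_coeff_zero]
    intro i hi
    rw [hq, Polynomial.finsetSum_coeff]
    refine Finset.sum_eq_zero fun j hj => ?_
    rw [Finset.mem_range] at hj
    rw [Polynomial.coeff_C_mul, Polynomial.coeff_X_pow, if_neg (by omega), mul_zero]

/-- `D^{2m-2}(D² - 1)`, discretized, maps `ψ_m` to the coefficients of `λ P_{2m-2}`. -/
lemma act_opPoly_psi (k : ℕ) (h : ℝ) (hh : 0 < h) :
    act (opPolyC k h) (fun β : ℤ => ((psi (k + 1) (h * β) : ℝ) : ℂ)) =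
      act (Polynomial.X * charPC k h) unitSeq := by
  -- ψ_m is `primSinh (2 * k)` cut off to the right half line, minus half of the uncut function. The
  -- uncut part is killed, and the cut part is an ordinary power series.
  have e : (fun β : ℤ => ((psi (k + 1) (h * β) : ℝ) : ℂ)) =
      seriesSeq (PowerSeries.mk (fun i : ℕ => primSinh (2 * k) (i * h))) -
        (1 / 2 : ℂ) • (fun β : ℤ => ((primSinh (2 * k) (h * β) : ℝ) : ℂ)) := by
    ext β
    simp only [seriesSeq, Pi.sub_apply, Pi.smul_apply, smul_eq_mul, PowerSeries.coeff_mk]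
    split_ifs with hβ
    · have h1 : ((β.toNat : ℕ) : ℝ) = (β : ℝ) := by
        have : ((β.toNat : ℕ) : ℤ) = β := Int.toNat_of_nonneg hβ
        exact_mod_cast this
      have h2 : (0 : ℝ) ≤ β := by exact_mod_cast hβ
      rw [psi_of_nonneg k (by positivity), h1, mul_comm (β : ℝ) h]
      push_cast
      ring
    · have h2 : (β : ℝ) ≤ 0 := by exact_mod_cast (not_le.1 hβ).le
      rw [psi_of_nonpos k (mul_nonpos_of_nonneg_of_nonpos hh.le h2)]
      push_cast
      ring
  rw [e, map_sub, map_smul, act_opPoly_primSinh, smul_zero, sub_zero, opPolyC, ← seriesSeq_mul,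
    opPoly_mul_mk, ← mul_one ((Polynomial.X * charP (k + 1) h : ℝ[X]) : PowerSeries ℝ),
    seriesSeq_mul, seriesSeq_one, charPC, Polynomial.map_mul, Polynomial.map_X]

end OptimalQuadrature

namespace OptimalQuadrature

/-! ### The discrete operator `D_m` -/

/-- Both geometric branches of z^{|β|} satisfy the second order recurrence; only the corner at 0
leaves a defect, moved to index 1 by the shift. -/
lemma act_pow_natAbs (z : ℂ) :
    act ((Polynomial.X - Polynomial.C z) * (1 - Polynomial.C z * Polynomial.X))
      (fun β : ℤ => z ^ β.natAbs) = (1 - z ^ 2) • shift unitSeq := by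
  have e : ((Polynomial.X - Polynomial.C z) * (1 - Polynomial.C z * Polynomial.X) : ℂ[X]) =
      Polynomial.C (1 + z ^ 2) * Polynomial.X - Polynomial.C z * Polynomial.X ^ 2 -
        Polynomial.C z := by
    simp only [map_add, map_one, map_pow]; ring
  rw [e]
  ext β
  simp only [act_sub, act_mul, act_C, Pi.sub_apply, Pi.smul_apply, act_X, act_X_pow, shift_apply,
    smul_eq_mul, unitSeq]
  rcases lt_trichotomy β 1 with h1 | rfl | h1
  · obtain ⟨n, rfl⟩ : ∃ n : ℕ, β = -n := ⟨(-β).toNat, by omega⟩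
    rw [show (-(n : ℤ) - 1).natAbs = n + 1 by omega, show (-(n : ℤ) - (2 : ℕ)).natAbs = n + 2 by omega,
      show (-(n : ℤ)).natAbs = n by omega, if_neg (by omega)]
    ring
  · norm_num
    ring
  · obtain ⟨n, rfl⟩ : ∃ n : ℕ, β = n + 2 := ⟨(β - 2).toNat, by omega⟩
    rw [show ((n : ℤ) + 2 - 1).natAbs = n + 1 by omega,
      show ((n : ℤ) + 2 - (2 : ℕ)).natAbs = n by omega,
      show ((n : ℤ) + 2).natAbs = n + 2 by omega, if_neg (by omega)]
    ring

lemma coeff_zero_opPoly (k : ℕ) (h : ℝ) : (opPoly k h).coeff 0 = -2 * Real.exp h := by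
  rw [Polynomial.coeff_zero_eq_eval_zero]
  simp [opPoly, coshPoly]

/-- This coefficient is the source of the constant C: half of it is C without the term involving
p_{2m-3}. -/
lemma coeff_one_opPoly (k : ℕ) (h : ℝ) : (opPoly k h).coeff 1 =
    2 * (1 + 2 * k * Real.exp h + Real.exp (2 * h)) := by
  have hexp : Real.exp h * Real.exp (-h) = 1 := by rw [← Real.exp_add]; simp
  have hexp2 : Real.exp (2 * h) = Real.exp h * Real.exp h := by rw [← Real.exp_add]; ring_nf
  have h1 := Polynomial.coeff_derivative (opPoly k h) 0
  rw [Polynomial.coeff_zero_eq_eval_zero] at h1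
  have h2 : (Polynomial.derivative (opPoly k h)).eval 0 =
      2 * (1 + 2 * k * Real.exp h + Real.exp (2 * h)) := by
    simp only [opPoly, coshPoly, Polynomial.derivative_mul, Polynomial.derivative_C,
      Polynomial.derivative_pow, Polynomial.derivative_add, Polynomial.derivative_sub,
      Polynomial.derivative_one, Polynomial.derivative_X, Polynomial.eval_add,
      Polynomial.eval_mul, Polynomial.eval_C, Polynomial.eval_pow, Polynomial.eval_sub,
      Polynomial.eval_one, Polynomial.eval_X, Polynomial.eval_zero, Real.cosh_eq]
    push_cast
    rw [hexp2]
    simp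
    linear_combination (2 : ℝ) * hexp
  rw [h2] at h1
  simpa using h1.symm

lemma natDegree_opPoly_le (k : ℕ) (h : ℝ) : (opPoly k h).natDegree ≤ 2 * k + 2 := by
  have h1 : (coshPoly h).natDegree ≤ 2 := by unfold coshPoly; compute_degree
  have h2 : ((1 - Polynomial.X : ℝ[X]) ^ (2 * k)).natDegree ≤ 2 * k := by
    refine Polynomial.natDegree_pow_le.trans ?_
    have : (1 - Polynomial.X : ℝ[X]).natDegree ≤ 1 := by compute_degree
    nlinarith
  exact (Polynomial.natDegree_C_mul_le _ _).trans
    (Polynomial.natDegree_mul_le.trans (add_le_add h2 h1))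

lemma coeff_last_opPoly (k : ℕ) (h : ℝ) : (opPoly k h).coeff (2 * k + 2) = -2 * Real.exp h := by
  have e : opPoly k h = Polynomial.C (-2 * Real.exp h) *
      ((Polynomial.X - Polynomial.C 1) ^ (2 * k) * coshPoly h) := by
    rw [opPoly, map_one, ← Even.neg_pow (n := 2 * k) (by simp) (Polynomial.X - 1 : ℝ[X]), neg_sub]
  have h1 : (coshPoly h).natDegree = 2 := by unfold coshPoly; compute_degree!
  have h2 : (coshPoly h).Monic := by
    rw [Polynomial.Monic, Polynomial.leadingCoeff, h1]
    simp [coshPoly, Polynomial.coeff_one]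
  have h3 : ((Polynomial.X - Polynomial.C 1 : ℝ[X]) ^ (2 * k)).Monic :=
    (Polynomial.monic_X_sub_C 1).pow _
  have h4 := h3.mul h2
  have h5 : ((Polynomial.X - Polynomial.C 1 : ℝ[X]) ^ (2 * k) * coshPoly h).natDegree =
      2 * k + 2 := by
    rw [h3.natDegree_mul h2, h1, (Polynomial.monic_X_sub_C (1 : ℝ)).natDegree_pow,
      Polynomial.natDegree_X_sub_C, mul_one]
  rw [e, Polynomial.coeff_C_mul, ← h5, h4.coeff_natDegree, mul_one]

/-- The factor of `P_{2m-2}` belonging to the pair of roots `z`, `1/z`. -/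
noncomputable def pairPoly (z : ℂ) : ℂ[X] :=
  (Polynomial.X - Polynomial.C z) * (1 - Polynomial.C z * Polynomial.X)

lemma eval_pairPoly (z w : ℂ) : (pairPoly z).eval w = (w - z) * (1 - z * w) := by
  simp [pairPoly]

lemma eval_inv_pairPoly (z : ℂ) {w : ℂ} (hw : w ≠ 0) :
    (pairPoly z).eval w⁻¹ = (w⁻¹) ^ 2 * (pairPoly z).eval w := by
  rw [eval_pairPoly, eval_pairPoly]
  field_simp

lemma natDegree_prod_pairPoly_le (s : Finset ℂ) :
    (∏ z ∈ s, pairPoly z).natDegree ≤ 2 * s.card := by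
  refine (Polynomial.natDegree_prod_le _ _).trans ?_
  rw [mul_comm]
  refine Finset.sum_le_card_nsmul _ _ _ fun z _ => ?_
  unfold pairPoly
  compute_degree

lemma eval_inv_prod_pairPoly (s : Finset ℂ) {w : ℂ} (hw : w ≠ 0) :
    (∏ z ∈ s, pairPoly z).eval w⁻¹ =
      (w⁻¹) ^ (2 * s.card) * (∏ z ∈ s, pairPoly z).eval w := by
  rw [Polynomial.eval_prod, Polynomial.eval_prod, pow_mul, ← Finset.prod_const,
    ← Finset.prod_mul_distrib]
  exact Finset.prod_congr rfl fun z _ => eval_inv_pairPoly z hw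

lemma eval_inv_opPolyC (k : ℕ) (h : ℝ) {w : ℂ} (hw : w ≠ 0) :
    (opPolyC k h).eval w⁻¹ = (w⁻¹) ^ (2 * k + 2) * (opPolyC k h).eval w := by
  rw [opPolyC_eq]
  simp only [Polynomial.eval_mul, Polynomial.eval_C, Polynomial.eval_pow, Polynomial.eval_sub,
    Polynomial.eval_one, Polynomial.eval_X, coshPoly, Polynomial.map_add, Polynomial.map_sub,
    Polynomial.map_one, Polynomial.map_mul, Polynomial.map_C, Polynomial.map_X, Polynomial.map_pow,
    Polynomial.eval_add]
  have e : (1 - w⁻¹) ^ (2 * k) = (w⁻¹) ^ (2 * k) * (1 - w) ^ (2 * k) := by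
    rw [← mul_pow, ← Even.neg_pow (n := 2 * k) (by simp) (1 - w⁻¹)]
    congr 1
    field_simp
    ring
  rw [e, pow_add]
  field_simp
  ring

section PartialFractions

variable {h : ℝ} {k : ℕ} {κ : ℂ} {s : Finset ℂ}

lemma derivative_prod_pairPoly_eval {z : ℂ} (hz : z ∈ s) :
    (Polynomial.derivative (Polynomial.C κ * ∏ z ∈ s, pairPoly z)).eval z =
      (1 - z ^ 2) * (Polynomial.C κ * ∏ w ∈ s.erase z, pairPoly w).eval z := by
  have hd : (Polynomial.derivative (pairPoly z)).eval z = 1 - z ^ 2 := by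
    simp [pairPoly, Polynomial.derivative_mul]
    ring
  rw [← Finset.mul_prod_erase s _ hz, mul_left_comm, Polynomial.derivative_mul, Polynomial.eval_add,
    Polynomial.eval_mul, Polynomial.eval_mul (p := pairPoly z), hd, eval_pairPoly, sub_self,
    zero_mul, zero_mul, add_zero]

lemma eval_prod_erase_ne_zero (hκ : κ ≠ 0) (hs : ∀ z ∈ s, ‖z‖ < 1) {z : ℂ} (hz : z ∈ s) :
    (Polynomial.C κ * ∏ w ∈ s.erase z, pairPoly w).eval z ≠ 0 := by
  rw [Polynomial.eval_mul, Polynomial.eval_C, Polynomial.eval_prod]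
  refine mul_ne_zero hκ (Finset.prod_ne_zero_iff.2 fun w hw => ?_)
  rw [Finset.mem_erase] at hw
  rw [eval_pairPoly]
  refine mul_ne_zero (sub_ne_zero.2 hw.1.symm) ?_
  intro h0
  have h1 : ‖w * z‖ = 1 := by rw [← sub_eq_zero.1 h0]; simp
  rw [norm_mul] at h1
  have := hs w hw.2
  have := hs z hz
  nlinarith [norm_nonneg w, norm_nonneg z]

/-- In this form A_k is recognizable as p_* times the residue of M(λ)/(λ P(λ)) at λ_k. -/
lemma coefA_eq (k : ℕ) (h : ℝ) (z : ℂ) : coefA (k + 1) h z =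
    (opPolyC k h).eval z * ((leadP (k + 1) h : ℝ) : ℂ) /
      (z * (Polynomial.derivative (charPC k h)).eval z) := by
  have hexp : Complex.exp h * Complex.exp (-h) = 1 := by rw [← Complex.exp_add]; simp
  have hexp2 : Complex.exp (2 * h) = Complex.exp h * Complex.exp h := by
    rw [← Complex.exp_add]; ring_nf
  rw [coefA, opPolyC_eq, charPC, Polynomial.derivative_map, Polynomial.aeval_def,
    ← Polynomial.eval_map]
  congr 2
  simp only [Polynomial.eval_mul, Polynomial.eval_C, Polynomial.eval_pow, Polynomial.eval_sub,
    Polynomial.eval_one, Polynomial.eval_X, coshPoly, Polynomial.map_add, Polynomial.map_sub,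
    Polynomial.map_one, Polynomial.map_mul, Polynomial.map_C, Polynomial.map_X, Polynomial.map_pow,
    Polynomial.eval_add, Complex.coe_algebraMap, Real.cosh_eq]
  push_cast
  rw [hexp2, show 2 * (k + 1) - 2 = 2 * k by omega]
  linear_combination -(1 - z) ^ (2 * k) * 2 * z * hexp

/-- The partial fraction decomposition behind the explicit form of `D_m`. -/
lemma partial_fractions (hh : 0 < h) (hκ : κ ≠ 0)
    (hs : s = innerRoots (k + 1) h) (hP : charPC k h = Polynomial.C κ * ∏ z ∈ s, pairPoly z) :
    Polynomial.C ((leadP (k + 1) h : ℝ) : ℂ) * opPolyC k h =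
      (Polynomial.C (2 * ((constC (k + 1) h : ℝ) : ℂ)) * Polynomial.X -
        Polynomial.C (2 * ((Real.exp h : ℝ) : ℂ)) * (Polynomial.X ^ 2 + 1)) * charPC k h +
      ∑ z ∈ s, Polynomial.C (coefA (k + 1) h z / z * (1 - z ^ 2)) *
        (Polynomial.X ^ 2 * (Polynomial.C κ * ∏ w ∈ s.erase z, pairPoly w)) := by
  have hcard : s.card = k := by rw [hs]; exact card_innerRoots hh k
  have hlead := (leadP_neg hh k).ne
  have hnorm : ∀ z ∈ s, ‖z‖ < 1 := fun z hz => by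
    rw [hs, innerRoots, Finset.mem_filter] at hz; exact hz.2
  have hz0 : ∀ z ∈ s, z ≠ 0 := fun z hz => by
    rw [hs] at hz
    obtain ⟨x, rfl, -, h2, -⟩ := exists_real_of_mem_innerRoots hh k hz
    exact_mod_cast h2.ne
  set lead : ℂ := ((leadP (k + 1) h : ℝ) : ℂ) with hle
  have hlead' : lead ≠ 0 := by rw [hle]; exact_mod_cast hlead
  have hcP0 : (charPC k h).coeff 0 = lead := by
    rw [charPC, Polynomial.coeff_map, coeff_zero_charP]; rfl
  -- By palindromicity the coefficient of λ equals that of λ^{2m-3}; for m = 1 the polynomial is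
  -- constant and both are 0.
  have hcP1 : (charPC k h).coeff 1 = ((subleadP (k + 1) h : ℝ) : ℂ) := by
    rw [charPC, Polynomial.coeff_map, subleadP]
    rcases Nat.eq_zero_or_pos k with rfl | hk
    · rw [Polynomial.coeff_eq_zero_of_natDegree_lt
        ((natDegree_charP_le 0 h).trans_lt (by norm_num))]
      simp
    · rw [coeff_charP_reflect h k (by omega), if_neg (by omega),
        show 2 * (k + 1) - 3 = 2 * k - 1 by omega]
      rfl
  have hcP2 : (charPC k h).coeff (2 * k) = lead := by
    rw [charPC, Polynomial.coeff_map, hle, leadP]; rfl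
  have hcPd : (charPC k h).natDegree ≤ 2 * k :=
    Polynomial.natDegree_map_le.trans (natDegree_charP_le k h)
  have hM0 : (opPolyC k h).coeff 0 = -2 * ((Real.exp h : ℝ) : ℂ) := by
    rw [opPolyC, Polynomial.coeff_map, coeff_zero_opPoly]; simp
  have hM1 : (opPolyC k h).coeff 1 =
      2 * (1 + 2 * k * ((Real.exp h : ℝ) : ℂ) + ((Real.exp (2 * h) : ℝ) : ℂ)) := by
    rw [opPolyC, Polynomial.coeff_map, coeff_one_opPoly]; simp
  have hM2 : (opPolyC k h).coeff (2 * k + 2) = -2 * ((Real.exp h : ℝ) : ℂ) := by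
    rw [opPolyC, Polynomial.coeff_map, coeff_last_opPoly]; simp
  have hMd : (opPolyC k h).natDegree ≤ 2 * k + 2 :=
    Polynomial.natDegree_map_le.trans (natDegree_opPoly_le k h)
  have hYd : ∀ z ∈ s, (Polynomial.C κ * ∏ w ∈ s.erase z, pairPoly w).natDegree ≤ 2 * (k - 1) := by
    intro z hz
    refine (Polynomial.natDegree_C_mul_le _ _).trans ((natDegree_prod_pairPoly_le _).trans ?_)
    rw [Finset.card_erase_of_mem hz, hcard]
  set R : ℂ[X] := ∑ z ∈ s, Polynomial.C (coefA (k + 1) h z / z * (1 - z ^ 2)) *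
        (Polynomial.X ^ 2 * (Polynomial.C κ * ∏ w ∈ s.erase z, pairPoly w)) with hR
  set c : ℂ := 2 * ((constC (k + 1) h : ℝ) : ℂ) with hc
  set e : ℂ := 2 * ((Real.exp h : ℝ) : ℂ) with he
  have hcoeffR : ∀ n, 2 * k < n → R.coeff n = 0 := by
    intro n hn
    rw [hR, Polynomial.finsetSum_coeff]
    refine Finset.sum_eq_zero fun z hz => ?_
    have hk : 1 ≤ k := by rw [← hcard]; exact Finset.card_pos.2 ⟨z, hz⟩
    rw [Polynomial.coeff_C_mul]
    obtain ⟨j, rfl⟩ : ∃ j, n = j + 2 := ⟨n - 2, by omega⟩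
    rw [Polynomial.coeff_X_pow_mul, Polynomial.coeff_eq_zero_of_natDegree_lt
      ((hYd z hz).trans_lt (by omega)), mul_zero]
  have hcoeffR' : ∀ n < 2, R.coeff n = 0 := by
    intro n hn
    rw [hR, Polynomial.finsetSum_coeff]
    refine Finset.sum_eq_zero fun z hz => ?_
    rw [Polynomial.coeff_C_mul, Polynomial.coeff_X_pow_mul', if_neg (by omega), mul_zero]
  set Δ : ℂ[X] := Polynomial.C lead * opPolyC k h -
    ((Polynomial.C c * Polynomial.X - Polynomial.C e * (Polynomial.X ^ 2 + 1)) * charPC k h + R)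
    with hΔ
  have hsplit : Δ = Polynomial.C lead * opPolyC k h -
      (Polynomial.C c * (Polynomial.X * charPC k h) -
        (Polynomial.C e * (Polynomial.X ^ 2 * charPC k h) + Polynomial.C e * charPC k h)) - R := by
    rw [hΔ]; ring
  have hΔ0 : Δ.coeff 0 = 0 := by
    rw [hsplit]
    simp only [Polynomial.coeff_sub, Polynomial.coeff_add, Polynomial.coeff_C_mul,
      hcoeffR' 0 (by norm_num), hcP0, hM0, Polynomial.coeff_X_mul_zero, Polynomial.coeff_X_pow_mul',
      if_neg (show ¬ 2 ≤ 0 by norm_num)]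
    rw [he]; ring
  -- Matching the coefficient of λ is the condition that determines C.
  have hΔ1 : Δ.coeff 1 = 0 := by
    have e1 : (Polynomial.X * charPC k h).coeff 1 = lead := by
      rw [Polynomial.coeff_X_mul, hcP0]
    rw [hsplit]
    simp only [Polynomial.coeff_sub, Polynomial.coeff_add, Polynomial.coeff_C_mul,
      hcoeffR' 1 (by norm_num), hcP1, hM1, e1, Polynomial.coeff_X_pow_mul',
      if_neg (show ¬ 2 ≤ 1 by norm_num)]
    rw [he, hc, constC, ]
    push_cast
    rw [← hle]
    field_simp
    ring
  have hΔtop : ∀ n, 2 * k + 2 ≤ n → Δ.coeff n = 0 := by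
    intro n hn
    obtain ⟨j, rfl⟩ : ∃ j, n = j + 2 := ⟨n - 2, by omega⟩
    have e1 : (Polynomial.X * charPC k h).coeff (j + 2) = 0 := by
      rw [show j + 2 = j + 1 + 1 by ring, Polynomial.coeff_X_mul,
        Polynomial.coeff_eq_zero_of_natDegree_lt (hcPd.trans_lt (by omega))]
    have e2 : (charPC k h).coeff (j + 2) = 0 :=
      Polynomial.coeff_eq_zero_of_natDegree_lt (hcPd.trans_lt (by omega))
    rw [hsplit]
    simp only [Polynomial.coeff_sub, Polynomial.coeff_add, Polynomial.coeff_C_mul,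
      hcoeffR (j + 2) (by omega), e1, e2, Polynomial.coeff_X_pow_mul]
    rcases Nat.lt_or_ge (2 * k) j with hj | hj
    · rw [Polynomial.coeff_eq_zero_of_natDegree_lt (hMd.trans_lt (by omega)),
        Polynomial.coeff_eq_zero_of_natDegree_lt (hcPd.trans_lt hj)]
      ring
    · obtain rfl : j = 2 * k := by omega
      rw [hM2, hcP2, he]; ring
  -- The low and high coefficients of Δ vanish, so Δ = X² Δ' with deg Δ' < 2k. It remains to see
  -- that Δ vanishes at the 2k distinct points λ_k and 1/λ_k.
  obtain ⟨Δ', hΔ'⟩ : Polynomial.X ^ 2 ∣ Δ := by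
    rw [Polynomial.X_pow_dvd_iff]
    intro d hd
    interval_cases d
    · exact hΔ0
    · exact hΔ1
  have hPz : ∀ z ∈ s, (charPC k h).eval z = 0 := by
    intro z hz
    rw [hP, Polynomial.eval_mul, Polynomial.eval_prod, Finset.prod_eq_zero hz, mul_zero]
    rw [eval_pairPoly, sub_self, zero_mul]
  have hPz' : ∀ z ∈ s, (charPC k h).eval z⁻¹ = 0 := by
    intro z hz
    rw [hP, Polynomial.eval_mul, Polynomial.eval_prod, Finset.prod_eq_zero hz, mul_zero]
    rw [eval_pairPoly, mul_inv_cancel₀ (hz0 z hz), sub_self, mul_zero]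
  have hRz : ∀ z ∈ s, ∀ x, (pairPoly z).eval x = 0 →
      R.eval x = coefA (k + 1) h z / z * (1 - z ^ 2) *
        (x ^ 2 * (Polynomial.C κ * ∏ w ∈ s.erase z, pairPoly w).eval x) := by
    intro z hz x hx
    rw [hR, Polynomial.eval_finsetSum, Finset.sum_eq_single_of_mem z hz]
    · simp only [Polynomial.eval_mul, Polynomial.eval_C, Polynomial.eval_pow, Polynomial.eval_X]
    · intro w hw hwz
      simp only [Polynomial.eval_mul, Polynomial.eval_prod]
      rw [Finset.prod_eq_zero (Finset.mem_erase.2 ⟨hwz.symm, hz⟩) hx]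
      ring
  have hA : ∀ z ∈ s, coefA (k + 1) h z / z * (1 - z ^ 2) *
      (z ^ 2 * (Polynomial.C κ * ∏ w ∈ s.erase z, pairPoly w).eval z) =
      lead * (opPolyC k h).eval z := by
    intro z hz
    have n1 := hz0 z hz
    have n2 := eval_prod_erase_ne_zero hκ hnorm hz
    have n3 : 1 - z ^ 2 ≠ 0 := by
      intro h0
      have h1 : ‖z ^ 2‖ = 1 := by rw [← sub_eq_zero.1 h0]; simp
      rw [norm_pow] at h1
      have := hnorm z hz
      nlinarith [norm_nonneg z]
    rw [coefA_eq, hP, derivative_prod_pairPoly_eval hz, ← hle]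
    field_simp
  have hΔz : ∀ z ∈ s, Δ.eval z = 0 := by
    intro z hz
    rw [hΔ, Polynomial.eval_sub, Polynomial.eval_add, Polynomial.eval_mul, Polynomial.eval_mul,
      hPz z hz, hRz z hz z (by rw [eval_pairPoly, sub_self, zero_mul]), hA z hz, Polynomial.eval_C]
    ring
  -- Every polynomial involved is self-reciprocal, so the identity at 1/z is the one at z multiplied
  -- by a power of 1/z.
  have hΔz' : ∀ z ∈ s, Δ.eval z⁻¹ = 0 := by
    intro z hz
    have n1 := hz0 z hz
    have hk : 1 ≤ k := by rw [← hcard]; exact Finset.card_pos.2 ⟨z, hz⟩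
    have hh' := hA z hz
    rw [hΔ, Polynomial.eval_sub, Polynomial.eval_add, Polynomial.eval_mul, Polynomial.eval_mul,
      hPz' z hz, hRz z hz z⁻¹ (by rw [eval_pairPoly, mul_inv_cancel₀ n1, sub_self, mul_zero]),
      Polynomial.eval_C, Polynomial.eval_mul, Polynomial.eval_C, eval_inv_prod_pairPoly _ n1,
      eval_inv_opPolyC _ _ n1, Finset.card_erase_of_mem hz, hcard]
    rw [Polynomial.eval_mul, Polynomial.eval_C] at hh'
    have e1 : (z⁻¹) ^ (2 * k + 2) = (z⁻¹) ^ 2 * ((z⁻¹) ^ (2 * (k - 1)) * (z⁻¹) ^ 2) := by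
      rw [← pow_add, ← pow_add]; congr 1; omega
    have e2 : (z⁻¹) ^ 2 * z ^ 2 = 1 := by rw [← mul_pow, inv_mul_cancel₀ n1, one_pow]
    rw [e1]
    linear_combination (-(z⁻¹) ^ 2 * ((z⁻¹) ^ (2 * (k - 1)) * (z⁻¹) ^ 2)) * hh' +
      ((z⁻¹) ^ 2 * (z⁻¹) ^ (2 * (k - 1)) * (coefA (k + 1) h z / z * (1 - z ^ 2)) *
        (κ * Polynomial.eval z (∏ w ∈ s.erase z, pairPoly w))) * e2
  have hdisj : Disjoint s (s.image (·⁻¹)) := by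
    rw [Finset.disjoint_left]
    intro z hz hz'
    obtain ⟨w, hw, rfl⟩ := Finset.mem_image.1 hz'
    have h1 := hnorm _ hz
    have h2 := hnorm w hw
    rw [norm_inv, inv_lt_one₀ (norm_pos_iff.2 (hz0 w hw))] at h1
    linarith
  have hΔ'0 : Δ' = 0 := by
    refine Polynomial.eq_zero_of_degree_lt_of_eval_finset_eq_zero (s ∪ s.image (·⁻¹)) ?_ ?_
    · rw [Finset.card_union_of_disjoint hdisj, Finset.card_image_of_injective _ inv_injective,
        hcard, Polynomial.degree_lt_iff_coeff_zero]
      intro n hn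
      have := hΔtop (n + 2) (by omega)
      rwa [hΔ', Polynomial.coeff_X_pow_mul] at this
    · intro x hx
      have hx' : Δ.eval x = 0 ∧ x ≠ 0 := by
        rcases Finset.mem_union.1 hx with h1 | h1
        · exact ⟨hΔz x h1, hz0 x h1⟩
        · obtain ⟨w, hw, rfl⟩ := Finset.mem_image.1 h1
          exact ⟨hΔz' w hw, inv_ne_zero (hz0 w hw)⟩
      have h2 := hx'.1
      rw [hΔ', Polynomial.eval_mul, Polynomial.eval_pow, Polynomial.eval_X] at h2
      exact (mul_eq_zero.1 h2).resolve_left (pow_ne_zero 2 hx'.2)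
  rw [hΔ'0, mul_zero] at hΔ'
  exact sub_eq_zero.1 hΔ'

end PartialFractions

/-- Since A_k λ_k^{|β|-1} = (A_k/λ_k) λ_k^{|β|}, the sum over the roots is the same expression for
all β; the cases |β| ≤ 1 only add multiples of δ and its two neighbours. -/
lemma discD_eq {k : ℕ} {h : ℝ} (hh : 0 < h) : (discD (k + 1) h : ℤ → ℂ) =
    (1 / ((leadP (k + 1) h : ℝ) : ℂ)) •
      ((2 * ((constC (k + 1) h : ℝ) : ℂ)) • unitSeq -
        (2 * ((Real.exp h : ℝ) : ℂ)) • (shift unitSeq + fun β => if β = -1 then 1 else 0) +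
        ∑ z ∈ innerRoots (k + 1) h, (coefA (k + 1) h z / z) • fun β : ℤ => z ^ β.natAbs) := by
  have hz0 : ∀ z ∈ innerRoots (k + 1) h, z ≠ 0 := fun z hz => by
    obtain ⟨x, rfl, -, h2, -⟩ := exists_real_of_mem_innerRoots hh k hz
    exact_mod_cast h2.ne
  ext β
  rw [discD]
  simp only [Pi.smul_apply, Pi.add_apply, Pi.sub_apply, Finset.sum_apply, smul_eq_mul, unitSeq,
    shift_apply]
  congr 1
  by_cases h0 : β = 0
  · subst h0
    simp
  by_cases h1 : β.natAbs = 1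
  · rw [if_neg h0, if_pos h1, if_neg h0, h1]
    have hs : ∑ z ∈ innerRoots (k + 1) h, coefA (k + 1) h z / z * z ^ 1 =
        ∑ z ∈ innerRoots (k + 1) h, coefA (k + 1) h z :=
      Finset.sum_congr rfl fun z hz => by rw [pow_one, div_mul_cancel₀ _ (hz0 z hz)]
    rw [hs]
    rcases Int.natAbs_eq_iff.1 h1 with h2 | h2
    · rw [h2]; norm_num
    · rw [h2]; norm_num
  · rw [if_neg h0, if_neg h1, if_neg h0, if_neg (by omega), if_neg (by omega)]
    have hs : ∑ z ∈ innerRoots (k + 1) h, coefA (k + 1) h z / z * z ^ β.natAbs =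
        ∑ z ∈ innerRoots (k + 1) h, coefA (k + 1) h z * z ^ (β.natAbs - 1) :=
      Finset.sum_congr rfl fun z hz => by
        have := hz0 z hz
        obtain ⟨j, hj⟩ : ∃ j, β.natAbs = j + 1 := ⟨β.natAbs - 1, by omega⟩
        rw [hj, Nat.add_sub_cancel, pow_succ]
        field_simp
    rw [hs]; ring

lemma decays_pow_natAbs {h : ℝ} {z : ℂ} (hz : ‖z‖ < Real.exp (-h)) :
    Decays h fun β : ℤ => z ^ β.natAbs := by
  have h1 : ‖z‖ * Real.exp h < 1 := by
    calc ‖z‖ * Real.exp h < Real.exp (-h) * Real.exp h := by gcongr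
      _ = 1 := by rw [← Real.exp_add]; simp
  have hg := summable_geometric_of_lt_one (by positivity) h1
  refine Summable.of_nat_of_neg ?_ ?_
  · refine hg.congr fun n => ?_
    simp only [norm_pow, Int.natAbs_natCast, Int.cast_natCast, Nat.abs_cast, mul_pow]
    rw [← Real.exp_nat_mul, mul_comm h]
  · refine hg.congr fun n => ?_
    simp only [norm_pow, Int.natAbs_neg, Int.natAbs_natCast, Int.cast_neg, Int.cast_natCast,
      abs_neg, Nat.abs_cast, mul_pow]
    rw [← Real.exp_nat_mul, mul_comm h]

lemma decays_discD {k : ℕ} {h : ℝ} (hh : 0 < h) (hkh : k = 0 ∨ (k + 1) * h ≤ 2) :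
    Decays h (discD (k + 1) h) := by
  rw [discD_eq hh]
  refine Decays.smul (Decays.add ?_ ?_) _
  · rw [sub_eq_add_neg, ← neg_smul]
    refine ((decays_unitSeq h).smul _).add (Decays.smul (((decays_unitSeq h).shift hh.le).add ?_) _)
    refine summable_of_ne_finset_zero (s := {-1}) fun β hβ => ?_
    simp at hβ
    simp [hβ]
  · have : ∀ t : Finset ℂ, t ⊆ innerRoots (k + 1) h →
        Decays h (∑ z ∈ t, (coefA (k + 1) h z / z) • fun β : ℤ => z ^ β.natAbs) := by
      intro t
      induction t using Finset.induction_on with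
      | empty =>
        intro _
        exact summable_zero.congr fun β => by simp
      | insert z t hz ih =>
        intro ht
        rw [Finset.sum_insert hz]
        exact ((decays_pow_natAbs (norm_lt_exp_of_mem_innerRoots hh hkh
          (ht (Finset.mem_insert_self z t)))).smul _).add
            (ih fun w hw => ht (Finset.mem_insert_of_mem hw))
    exact this _ (Finset.Subset.refl _)

/-- `λ P_{2m-2}`, acting on `D_m`, gives the coefficients of the shift polynomial. -/
lemma act_discD {k : ℕ} {h : ℝ} (hh : 0 < h) :
    act (Polynomial.X * charPC k h) (discD (k + 1) h) = act (opPolyC k h) unitSeq := by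
  obtain ⟨κ, hκ, hP⟩ := exists_map_charP_eq_prod hh k
  have hpf := partial_fractions (k := k) hh hκ rfl hP
  set s := innerRoots (k + 1) h with hs
  have hlead : ((leadP (k + 1) h : ℝ) : ℂ) ≠ 0 := by exact_mod_cast (leadP_neg hh k).ne
  have h1 : act (Polynomial.X * charPC k h) (fun β : ℤ => if β = -1 then 1 else 0) =
      act (charPC k h) unitSeq := by
    rw [mul_comm, act_mul, act_X]
    congr 1
    ext β
    simp only [shift_apply, unitSeq]
    congr 1
    apply propext
    omega
  have h2 : ∀ z ∈ s, act (Polynomial.X * charPC k h) (fun β : ℤ => z ^ β.natAbs) =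
      act (Polynomial.C (1 - z ^ 2) * (Polynomial.X ^ 2 *
        (Polynomial.C κ * ∏ w ∈ s.erase z, pairPoly w))) unitSeq := by
    intro z hz
    have e : Polynomial.X * charPC k h =
        Polynomial.X * (Polynomial.C κ * ∏ w ∈ s.erase z, pairPoly w) * pairPoly z := by
      rw [charPC, hP]
      have := Finset.mul_prod_erase s pairPoly hz
      change Polynomial.X * (Polynomial.C κ * ∏ z ∈ s, pairPoly z) = _
      rw [← this]; ring
    rw [e, act_mul, pairPoly, act_pow_natAbs, map_smul, ← act_X, ← act_mul, act_mul (Polynomial.C _),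
      act_C]
    congr 2
    ring_nf
  rw [discD_eq hh, map_smul, map_add, map_sub, map_smul, map_smul, map_add, map_sum, h1,
    ← act_X, ← act_mul]
  have h3 : ((leadP (k + 1) h : ℝ) : ℂ) • act (opPolyC k h) unitSeq =
      act (Polynomial.C ((leadP (k + 1) h : ℝ) : ℂ) * opPolyC k h) unitSeq := by rw [act_mul, act_C]
  rw [one_div, inv_smul_eq_iff₀ hlead, h3, hpf, act_add, act_sum]
  congr 1
  · rw [show (Polynomial.C (2 * ((constC (k + 1) h : ℝ) : ℂ)) * Polynomial.X -
        Polynomial.C (2 * ((Real.exp h : ℝ) : ℂ)) * (Polynomial.X ^ 2 + 1)) * charPC k h =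
        Polynomial.C (2 * ((constC (k + 1) h : ℝ) : ℂ)) * (Polynomial.X * charPC k h) -
        Polynomial.C (2 * ((Real.exp h : ℝ) : ℂ)) *
          (Polynomial.X * charPC k h * Polynomial.X + charPC k h) by ring]
    rw [act_sub, act_mul (Polynomial.C _), act_mul (Polynomial.C _), act_C, act_C, act_add]
  · refine Finset.sum_congr rfl fun z hz => ?_
    rw [map_smul, h2 z hz, map_mul, mul_assoc, act_mul (Polynomial.C (coefA (k + 1) h z / z)),
      act_C]

/-- Uniqueness for the equation `λ P_{2m-2} u = 0` among sequences of growth `e^{h|β|}`. -/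
lemma eq_zero_of_act_charPC {k : ℕ} {h : ℝ} (hh : 0 < h) (hkh : k = 0 ∨ (k + 1) * h ≤ 2)
    {u : ℤ → ℂ} (hu : Grows h u) (h0 : act (Polynomial.X * charPC k h) u = 0) : u = 0 := by
  obtain ⟨κ, hκ, hP⟩ := exists_map_charP_eq_prod hh k
  have h1 : act (charPC k h) u = 0 := by
    rw [act_mul, act_X] at h0
    ext β
    have := congrFun h0 (β + 1)
    simpa using this
  rw [charPC, hP, act_mul, act_C] at h1
  have h2 := (smul_eq_zero.1 h1).resolve_left hκ
  exact eq_zero_of_act_prod hh.le (fun z hz => norm_lt_exp_of_mem_innerRoots hh hkh hz) hu h2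

/-- The polynomial λP acts on the factor D_m, where it leaves M δ; convolution with δ is then the
identity. The decay of D_m legitimizes moving the polynomial inside. -/
lemma act_conv_discD {k : ℕ} {h : ℝ} (hh : 0 < h) (hkh : k = 0 ∨ (k + 1) * h ≤ 2)
    {u : ℤ → ℂ} (hu : Grows h u) :
    act (Polynomial.X * charPC k h) (conv (discD (k + 1) h) u) = act (opPolyC k h) u := by
  rw [act_conv hh.le (decays_discD hh hkh) hu, act_discD hh,
    ← act_conv hh.le (decays_unitSeq h) hu, conv_unitSeq]

/-- `D_m` annihilates the kernel of the shift polynomial. -/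
lemma conv_discD_eq_zero {k : ℕ} {h : ℝ} (hh : 0 < h) (hkh : k = 0 ∨ (k + 1) * h ≤ 2)
    {u : ℤ → ℂ} (hu : Grows h u) (h0 : act (opPolyC k h) u = 0) :
    conv (discD (k + 1) h) u = 0 := by
  refine eq_zero_of_act_charPC hh hkh ((decays_discD hh hkh).grows_conv hh.le hu) ?_
  rw [act_conv_discD hh hkh hu, h0]

/-- `D_m` inverts the convolution with `ψ_m`. -/
lemma conv_discD_act_psi {k : ℕ} {h : ℝ} (hh : 0 < h) (hkh : k = 0 ∨ (k + 1) * h ≤ 2)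
    (hψ : Grows h (fun β : ℤ => ((psi (k + 1) (h * β) : ℝ) : ℂ))) (c : ℂ[X]) :
    conv (discD (k + 1) h) (act c (fun β : ℤ => ((psi (k + 1) (h * β) : ℝ) : ℂ))) =
      act c unitSeq := by
  have hD := decays_discD hh hkh
  have hδ : Grows h unitSeq := ⟨1, fun β => by
    have : ‖unitSeq β‖ ≤ 1 := by unfold unitSeq; split_ifs <;> simp
    refine this.trans ?_
    rw [one_mul]
    exact Real.one_le_exp (by positivity)⟩
  -- Both sides have the same image under λP, since M sends ψ_m to λP applied to δ; injectivity on
  -- sequences of growth e^{h|β|} gives equality.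
  rw [← sub_eq_zero]
  refine eq_zero_of_act_charPC hh hkh ((hD.grows_conv hh.le (hψ.act hh.le c)).sub
    (hδ.act hh.le c)) ?_
  rw [map_sub, act_conv_discD hh hkh (hψ.act hh.le c), act_comm, act_opPoly_psi k h hh,
    act_comm, sub_self]

end OptimalQuadrature

namespace OptimalQuadrature

/-! ### Exponential polynomials and their samples -/

/-- The samples `f(hβ)`, as a complex sequence. -/
noncomputable abbrev sample (h : ℝ) (f : ℝ → ℝ) : ℤ → ℂ := fun β => ((f (h * β) : ℝ) : ℂ)

/-- At most the growth of `e^{|x|}`. -/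
def ExpBounded (f : ℝ → ℝ) : Prop := ∃ C, ∀ x, |f x| ≤ C * Real.exp |x|

lemma ExpBounded.add {f g : ℝ → ℝ} (hf : ExpBounded f) (hg : ExpBounded g) :
    ExpBounded fun x => f x + g x := by
  obtain ⟨C, hC⟩ := hf
  obtain ⟨C', hC'⟩ := hg
  refine ⟨C + C', fun x => (abs_add_le _ _).trans ?_⟩
  rw [add_mul]
  exact add_le_add (hC x) (hC' x)

lemma ExpBounded.const_mul {f : ℝ → ℝ} (hf : ExpBounded f) (a : ℝ) :
    ExpBounded fun x => a * f x := by
  obtain ⟨C, hC⟩ := hf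
  refine ⟨|a| * C, fun x => ?_⟩
  rw [abs_mul, mul_assoc]
  exact mul_le_mul_of_nonneg_left (hC x) (abs_nonneg a)

lemma expBounded_exp : ExpBounded Real.exp :=
  ⟨1, fun x => by rw [abs_of_pos (Real.exp_pos x), one_mul]; exact Real.exp_le_exp.2 (le_abs_self x)⟩

lemma expBounded_exp_neg : ExpBounded fun x => Real.exp (-x) :=
  ⟨1, fun x => by
    rw [abs_of_pos (Real.exp_pos _), one_mul]; exact Real.exp_le_exp.2 (neg_le_abs x)⟩

lemma expBounded_pow (n : ℕ) : ExpBounded fun x => x ^ n := by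
  refine ⟨n.factorial, fun x => ?_⟩
  have := Real.pow_div_factorial_le_exp |x| (abs_nonneg x) n
  rw [div_le_iff₀ (by positivity)] at this
  rw [abs_pow, mul_comm]
  exact this

lemma expBounded_eval (q : ℝ[X]) : ExpBounded fun x => q.eval x := by
  induction q using Polynomial.induction_on' with
  | add p q hp hq => simpa using hp.add hq
  | monomial n a => simpa using (expBounded_pow n).const_mul a

lemma expBounded_psi (k : ℕ) : ExpBounded (psi (k + 1)) :=
  ⟨1, fun x => by simpa using abs_psi_le k x⟩

lemma expBounded_fm (k : ℕ) {p : ℝ → ℝ} (hp : IntegrableOn p (Set.Icc 0 1)) :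
    ExpBounded (fm (k + 1) p) := by
  have hp' : IntervalIntegrable p volume 0 1 :=
    (intervalIntegrable_iff_integrableOn_Icc_of_le zero_le_one).2 hp
  refine ⟨(∫ x in (0 : ℝ)..1, |p x|) * Real.exp 1, fun t => ?_⟩
  have h1 : ∀ x ∈ Set.Ioc (0 : ℝ) 1,
      ‖p x * psi (k + 1) (x - t)‖ ≤ |p x| * (Real.exp 1 * Real.exp |t|) := by
    intro x hx
    rw [norm_mul, Real.norm_eq_abs, Real.norm_eq_abs, ← Real.exp_add]
    refine mul_le_mul_of_nonneg_left ((abs_psi_le k _).trans (Real.exp_le_exp.2 ?_)) (abs_nonneg _)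
    refine (abs_sub _ _).trans (add_le_add ?_ le_rfl)
    rw [abs_of_pos hx.1]; exact hx.2
  have := intervalIntegral.norm_integral_le_of_norm_le zero_le_one
    (Filter.Eventually.of_forall h1) (hp'.abs.mul_const _)
  rw [intervalIntegral.integral_mul_const] at this
  rw [mul_assoc]
  exact this

lemma ExpBounded.grows {f : ℝ → ℝ} (hf : ExpBounded f) {h : ℝ} (hh : 0 ≤ h) :
    Grows h (sample h f) := by
  obtain ⟨C, hC⟩ := hf
  refine ⟨C, fun β => ?_⟩
  have := hC (h * β)
  rw [abs_mul, abs_of_nonneg hh] at this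
  rwa [Complex.norm_real]

/-- The function `A e^x + q(x) + B e^{-x}`. -/
noncomputable def expPoly (A : ℝ) (q : ℝ[X]) (B : ℝ) (x : ℝ) : ℝ :=
  A * Real.exp x + q.eval x + B * Real.exp (-x)

lemma expBounded_expPoly (A : ℝ) (q : ℝ[X]) (B : ℝ) : ExpBounded (expPoly A q B) :=
  ((expBounded_exp.const_mul A).add (expBounded_eval q)).add (expBounded_exp_neg.const_mul B)

lemma expPoly_sub (A A' : ℝ) (q q' : ℝ[X]) (B B' x : ℝ) :
    expPoly A q B x - expPoly A' q' B' x = expPoly (A - A') (q - q') (B - B') x := by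
  simp only [expPoly, Polynomial.eval_sub]; ring

lemma act_opPoly_expPoly (k : ℕ) (h A : ℝ) {q : ℝ[X]} (hq : q.degree < (2 * k : ℕ)) (B : ℝ) :
    act (opPolyC k h) (sample h (expPoly A q B)) = 0 := by
  have e : sample h (expPoly A q B) = (A : ℂ) • (fun β : ℤ => ((Real.exp (h * β) : ℝ) : ℂ)) +
      (fun β : ℤ => ((q.eval (h * β) : ℝ) : ℂ)) +
      (B : ℂ) • (fun β : ℤ => ((Real.exp (-h * β) : ℝ) : ℂ)) := by
    ext β
    simp only [sample, expPoly, Pi.add_apply, Pi.smul_apply, smul_eq_mul, neg_mul]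
    push_cast
    ring
  rw [e, map_add, map_add, map_smul, map_smul, act_opPoly_exp k (Or.inl rfl),
    act_opPoly_exp k (Or.inr rfl), act_opPoly_eval k h hq]
  simp

lemma tendsto_mul_nat_atTop {h : ℝ} (hh : 0 < h) :
    Filter.Tendsto (fun n : ℕ => h * (n : ℝ)) Filter.atTop Filter.atTop :=
  tendsto_natCast_atTop_atTop.const_mul_atTop hh

/-- An exponential polynomial that vanishes at all large grid points is zero. -/
lemma expPoly_eq_zero {h : ℝ} (hh : 0 < h) {A : ℝ} {q : ℝ[X]} {B : ℝ} {N : ℕ}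
    (h0 : ∀ n : ℕ, N < n → expPoly A q B (h * n) = 0) : A = 0 ∧ q = 0 ∧ B = 0 := by
  have ht := tendsto_mul_nat_atTop hh
  have hev : ∀ᶠ n : ℕ in Filter.atTop, expPoly A q B (h * n) = 0 :=
    (Filter.eventually_gt_atTop N).mono h0
  have hexp : Filter.Tendsto (fun n : ℕ => Real.exp (-(h * n))) Filter.atTop (nhds 0) :=
    Real.tendsto_exp_neg_atTop_nhds_zero.comp ht
  -- Dividing by e^x at large grid points isolates A, as the remaining terms tend to 0.
  have hA : A = 0 := by
    have h1 : Filter.Tendsto (fun n : ℕ => q.eval (h * n) / Real.exp (h * n) +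
        B * (Real.exp (-(h * n)) * Real.exp (-(h * n)))) Filter.atTop (nhds (0 + B * (0 * 0))) :=
      ((Polynomial.tendsto_div_exp_atTop q).comp ht).add ((hexp.mul hexp).const_mul B)
    have h2 : Filter.Tendsto (fun n : ℕ => q.eval (h * n) / Real.exp (h * n) +
        B * (Real.exp (-(h * n)) * Real.exp (-(h * n)))) Filter.atTop (nhds (-A)) := by
      refine tendsto_const_nhds.congr' (hev.mono fun n hn => ?_)
      rw [expPoly] at hn
      have h3 := Real.exp_pos (h * n)
      simp only [Real.exp_neg] at hn ⊢
      field_simp at hn ⊢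
      linear_combination -hn
    have := tendsto_nhds_unique h1 h2
    linarith
  subst hA
  have hq : Filter.Tendsto (fun n : ℕ => q.eval (h * n)) Filter.atTop (nhds 0) := by
    have h1 := hexp.const_mul (-B)
    rw [mul_zero] at h1
    refine h1.congr' (hev.mono fun n hn => ?_)
    rw [expPoly] at hn
    linear_combination -hn
  -- A polynomial of positive degree is unbounded along the grid, but q tends to 0 there.
  have hdeg : q.degree ≤ 0 := by
    by_contra hd
    have h1 := (Polynomial.abs_tendsto_atTop q (not_le.1 hd)).comp ht
    exact not_tendsto_nhds_of_tendsto_atTop h1 _ hq.abs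
  rw [Polynomial.eq_C_of_degree_le_zero hdeg] at hq h0 ⊢
  simp only [Polynomial.eval_C] at hq
  have hc := tendsto_nhds_unique tendsto_const_nhds hq
  rw [hc] at h0 ⊢
  refine ⟨rfl, by simp, ?_⟩
  have := h0 (N + 1) (by omega)
  rw [expPoly] at this
  simpa using this

/-! ### The polynomial part of the convolution with `ψ_m` outside the interval -/

/-- The polynomial `½ ∑_{j=1}^k ∑_{α<2j} (-1)^α M_α x^{2j-1-α} / ((2j-1-α)! α!)`. -/
noncomputable def momentPoly (k : ℕ) (M : ℕ → ℝ) : ℝ[X] :=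
  Polynomial.C (1 / 2) * ∑ j ∈ Finset.Icc 1 k, ∑ α ∈ Finset.range (2 * j),
    Polynomial.C ((-1) ^ α * M α / (((2 * j - 1 - α).factorial : ℝ) * (α.factorial : ℝ))) *
      Polynomial.X ^ (2 * j - 1 - α)

lemma momentPoly_sub (k : ℕ) (M M' : ℕ → ℝ) :
    momentPoly k (fun α => M α - M' α) = momentPoly k M - momentPoly k M' := by
  rw [momentPoly, momentPoly, momentPoly, ← mul_sub, ← Finset.sum_sub_distrib]
  congr 1
  refine Finset.sum_congr rfl fun j _ => ?_
  rw [← Finset.sum_sub_distrib]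
  refine Finset.sum_congr rfl fun α _ => ?_
  rw [← sub_mul, ← map_sub]
  congr 2
  ring

lemma coeff_momentPoly (k : ℕ) (M : ℕ → ℝ) (n : ℕ) : (momentPoly k M).coeff n =
    1 / 2 * ∑ j ∈ Finset.Icc 1 k, ∑ α ∈ Finset.range (2 * j), if n = 2 * j - 1 - α then
      (-1) ^ α * M α / (((2 * j - 1 - α).factorial : ℝ) * (α.factorial : ℝ)) else 0 := by
  simp only [momentPoly, Polynomial.coeff_C_mul, Polynomial.finsetSum_coeff,
    Polynomial.coeff_X_pow, mul_ite, mul_one, mul_zero]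

lemma degree_momentPoly_lt (k : ℕ) (M : ℕ → ℝ) : (momentPoly k M).degree < (2 * k : ℕ) := by
  rw [Polynomial.degree_lt_iff_coeff_zero]
  intro n hn
  rw [coeff_momentPoly, Finset.sum_eq_zero, mul_zero]
  intro j hj
  refine Finset.sum_eq_zero fun α hα => if_neg ?_
  simp at hj hα
  omega

/-- Only α ≥ k contribute, and then 2j - 1 - α ≤ 2k - 1 - k. -/
lemma momentPoly_mem_degreeLT {k : ℕ} {M : ℕ → ℝ} (hM : ∀ α < k, M α = 0) :
    momentPoly k M ∈ Polynomial.degreeLT ℝ k := by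
  rw [Polynomial.mem_degreeLT, Polynomial.degree_lt_iff_coeff_zero]
  intro n hn
  rw [coeff_momentPoly, Finset.sum_eq_zero, mul_zero]
  intro j hj
  refine Finset.sum_eq_zero fun α hα => ?_
  simp at hj hα
  rcases lt_or_ge α k with h | h
  · rw [hM α h]; simp
  · exact if_neg (by omega)

/-- The coefficients of high degree determine the first moments. -/
lemma eq_zero_of_momentPoly_mem_degreeLT {k : ℕ} {M : ℕ → ℝ}
    (hM : momentPoly k M ∈ Polynomial.degreeLT ℝ k) : ∀ α < k, M α = 0 := by
  rw [Polynomial.mem_degreeLT, Polynomial.degree_lt_iff_coeff_zero] at hM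
  intro α
  induction α using Nat.strong_induction_on with
  | _ α ih =>
    intro hα
    have h1 := hM (2 * k - 1 - α) (by omega)
    -- In the coefficient of degree 2k - 1 - α, the terms with j < k involve moments of index α -
    -- 2(k - j), which vanish by induction. The term j = k isolates the moment of index α.
    rw [coeff_momentPoly, Finset.sum_eq_single_of_mem k (by simp; omega),
      Finset.sum_eq_single_of_mem α (by simp; omega), if_pos rfl] at h1
    · have h2 : (-1 : ℝ) ^ α ≠ 0 := by simp
      have h3 : ((2 * k - 1 - α).factorial : ℝ) * (α.factorial : ℝ) ≠ 0 := by positivity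
      simpa [h2, Nat.factorial_ne_zero] using h1
    · intro b hb hne
      simp at hb
      exact if_neg (by omega)
    · intro j hj hne
      refine Finset.sum_eq_zero fun b hb => ?_
      simp at hj hb
      split_ifs with hs
      · rw [ih b (by omega) (by omega)]; simp
      · rfl

/-- The index [(m+1)/2] separates the j with 2j ≤ k from those with 2j > k. In both ranges α runs
below min(2j, k), so the double sum is the full moment polynomial with moments of index at least k
set to zero. -/
lemma polyQ_eq (k : ℕ) (p : ℝ → ℝ) :
    polyQ (k + 1) p = momentPoly k (fun α => if α < k then moment p α else 0) := by
  rw [polyQ, momentPoly]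
  congr 1
  have hs : Finset.Icc 1 k = Finset.Icc 1 ((k + 1 + 1) / 2 - 1) ∪
      Finset.Icc ((k + 1 + 1) / 2) (k + 1 - 1) := by
    ext j; simp; omega
  rw [hs, Finset.sum_union]
  · congr 1
    · refine Finset.sum_congr rfl fun j hj => Finset.sum_congr rfl fun α hα => ?_
      simp at hj hα
      rw [if_pos (by omega)]
    · refine Finset.sum_congr rfl fun j hj => ?_
      simp at hj
      refine Finset.sum_subset_zero_on_sdiff (fun α hα => ?_) (fun α hα => ?_) (fun α hα => ?_)
      · simp at hα ⊢; omega
      · simp at hα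
        rw [if_neg (by omega)]; simp
      · simp at hα
        rw [if_pos (by omega)]
  · rw [Finset.disjoint_left]
    intro j hj hj'
    simp at hj hj'
    omega

/-- The power sums `∑ c_γ (hγ)^α`. -/
noncomputable def powerSum (N : ℕ) (c : Fin (N + 1) → ℝ) (α : ℕ) : ℝ :=
  ∑ γ : Fin (N + 1), c γ * grid N (γ : ℕ) ^ α

lemma polyQlow_eq (k N : ℕ) (c : Fin (N + 1) → ℝ) :
    polyQlow (k + 1) N c = momentPoly k (fun α => if α < k then 0 else powerSum N c α) := by
  rw [polyQlow, momentPoly]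
  congr 1
  refine Finset.sum_subset_zero_on_sdiff (fun j hj => ?_) (fun j hj => ?_) (fun j hj => ?_)
  · simp at hj ⊢; omega
  · refine Finset.sum_eq_zero fun α hα => ?_
    simp at hj hα
    rw [if_pos (by omega)]; simp
  · simp at hj
    refine Finset.sum_subset_zero_on_sdiff (fun α hα => ?_) (fun α hα => ?_) (fun α hα => ?_)
    · simp at hα ⊢; omega
    · simp at hα
      rw [if_pos (by omega)]; simp
    · simp at hα
      rw [if_neg (by omega)]; rfl

/-- By linearity in the moments: those below k are known from the weight and give Q^{(2m-3)}, the
others give Q_{m-2}. -/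
lemma momentPoly_powerSum {k N : ℕ} {p : ℝ → ℝ} {c : Fin (N + 1) → ℝ}
    (hc : ∀ α < k, powerSum N c α = moment p α) :
    momentPoly k (powerSum N c) = polyQ (k + 1) p + polyQlow (k + 1) N c := by
  rw [polyQlow_eq, polyQ_eq, ← sub_eq_iff_eq_add, ← momentPoly_sub]
  congr 1
  ext α
  split_ifs with h
  · rw [sub_zero, hc α h]
  · rw [sub_self]

lemma sub_pow_div_factorial (x t : ℝ) (n : ℕ) : (x - t) ^ n / (n.factorial : ℝ) =
    ∑ α ∈ Finset.range (n + 1),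
      (-1) ^ α * t ^ α / (((n - α).factorial : ℝ) * (α.factorial : ℝ)) * x ^ (n - α) := by
  rw [sub_eq_add_neg, add_comm, add_pow, Finset.sum_div]
  refine Finset.sum_congr rfl fun α hα => ?_
  have hα' : α ≤ n := by simp at hα; omega
  rw [Nat.cast_choose ℝ hα', neg_pow]
  have := Nat.factorial_ne_zero n
  field_simp

/-- The convolution of the coefficients with `ψ_m`. -/
noncomputable def psiSum (k N : ℕ) (c : Fin (N + 1) → ℝ) (x : ℝ) : ℝ :=
  ∑ γ : Fin (N + 1), c γ * psi (k + 1) (x - grid N (γ : ℕ))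

lemma sum_Icc_one (k : ℕ) (f : ℕ → ℝ) :
    ∑ j ∈ Finset.Icc 1 k, f j = ∑ j ∈ Finset.range k, f (j + 1) := by
  rw [Finset.range_eq_Ico, Finset.sum_Ico_add']
  refine Finset.sum_congr ?_ fun _ _ => rfl
  ext j; simp

lemma eval_momentPoly_powerSum (k N : ℕ) (c : Fin (N + 1) → ℝ) (x : ℝ) :
    (momentPoly k (powerSum N c)).eval x = 1 / 2 * ∑ γ : Fin (N + 1), c γ *
      ∑ j ∈ Finset.range k, (x - grid N (γ : ℕ)) ^ (2 * j + 1) / ((2 * j + 1).factorial : ℝ) := by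
  simp only [momentPoly, Polynomial.eval_mul, Polynomial.eval_C, Polynomial.eval_finsetSum,
    Polynomial.eval_pow, Polynomial.eval_X]
  congr 1
  rw [sum_Icc_one]
  simp_rw [sub_pow_div_factorial, Finset.mul_sum]
  rw [Finset.sum_comm]
  refine Finset.sum_congr rfl fun j _ => ?_
  rw [Finset.sum_comm]
  refine Finset.sum_congr (by congr 1) fun α _ => ?_
  rw [powerSum, Finset.mul_sum, Finset.sum_div, Finset.sum_mul]
  refine Finset.sum_congr rfl fun γ _ => ?_
  rw [show 2 * (j + 1) - 1 - α = 2 * j + 1 - α by omega]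
  ring

lemma sum_mul_primSinh (k N : ℕ) (c : Fin (N + 1) → ℝ) (x : ℝ) :
    ∑ γ : Fin (N + 1), c γ * primSinh (2 * k) (x - grid N (γ : ℕ)) =
      2 * expPoly ((∑ γ : Fin (N + 1), c γ * Real.exp (-grid N (γ : ℕ))) / 4)
        (-momentPoly k (powerSum N c)) (-constD N c) x := by
  have e2 : ∀ γ : Fin (N + 1), c γ * ((Real.exp (x - grid N (γ : ℕ)) -
      Real.exp (-(x - grid N (γ : ℕ)))) / 2) =
      Real.exp x / 2 * (c γ * Real.exp (-grid N (γ : ℕ))) -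
        Real.exp (-x) / 2 * (c γ * Real.exp (grid N (γ : ℕ))) := by
    intro γ
    rw [neg_sub, sub_eq_add_neg x, sub_eq_add_neg (grid N _), Real.exp_add, Real.exp_add]
    ring
  simp only [primSinh_even, mul_sub, Finset.sum_sub_distrib, e2, ← Finset.mul_sum]
  rw [expPoly, Polynomial.eval_neg, eval_momentPoly_powerSum, constD]
  ring

lemma grid_nonneg (N : ℕ) (γ : ℕ) : 0 ≤ grid N (γ : ℤ) := by
  unfold grid; positivity

lemma grid_le_one {N : ℕ} (hN : 1 ≤ N) {γ : ℕ} (hγ : γ ≤ N) : grid N (γ : ℤ) ≤ 1 := by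
  have : (0 : ℝ) < N := by exact_mod_cast hN
  rw [grid, one_div, inv_mul_le_iff₀ this, mul_one]
  exact_mod_cast hγ

/-- To the left of all nodes every difference has the same sign, so the absolute value in ψ_m
resolves and the sum expands into moments of the coefficients. To the right of all nodes only the
overall sign changes. -/
lemma psiSum_of_nonpos (k N : ℕ) (c : Fin (N + 1) → ℝ) {x : ℝ} (hx : x ≤ 0) :
    psiSum k N c x = expPoly (-(∑ γ : Fin (N + 1), c γ * Real.exp (-grid N (γ : ℕ))) / 4)
        (momentPoly k (powerSum N c)) (constD N c) x := by
  have h1 := sum_mul_primSinh k N c x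
  have h2 : psiSum k N c x =
      -(∑ γ : Fin (N + 1), c γ * primSinh (2 * k) (x - grid N (γ : ℕ))) / 2 := by
    rw [psiSum, ← Finset.sum_neg_distrib, Finset.sum_div]
    refine Finset.sum_congr rfl fun γ _ => ?_
    rw [psi_of_nonpos k (by linarith [grid_nonneg N γ])]
    ring
  rw [h2, h1, expPoly, expPoly, Polynomial.eval_neg]
  ring

lemma psiSum_of_one_le {k N : ℕ} (hN : 1 ≤ N) (c : Fin (N + 1) → ℝ) {x : ℝ} (hx : 1 ≤ x) :
    psiSum k N c x = expPoly ((∑ γ : Fin (N + 1), c γ * Real.exp (-grid N (γ : ℕ))) / 4)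
        (-momentPoly k (powerSum N c)) (-constD N c) x := by
  have h1 := sum_mul_primSinh k N c x
  have h2 : psiSum k N c x =
      (∑ γ : Fin (N + 1), c γ * primSinh (2 * k) (x - grid N (γ : ℕ))) / 2 := by
    rw [psiSum, Finset.sum_div]
    refine Finset.sum_congr rfl fun γ _ => ?_
    rw [psi_of_nonneg k (by linarith [grid_le_one hN (Nat.lt_succ_iff.1 γ.2)])]
    ring
  rw [h2, h1]
  ring

lemma expBounded_psiSum (k N : ℕ) (c : Fin (N + 1) → ℝ) : ExpBounded (psiSum k N c) := by
  refine ⟨∑ γ : Fin (N + 1), |c γ| * Real.exp (grid N (γ : ℕ)), fun x => ?_⟩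
  rw [psiSum, Finset.sum_mul]
  refine (Finset.abs_sum_le_sum_abs _ _).trans (Finset.sum_le_sum fun γ _ => ?_)
  rw [abs_mul, mul_assoc, ← Real.exp_add]
  refine mul_le_mul_of_nonneg_left ((abs_psi_le k _).trans (Real.exp_le_exp.2 ?_)) (abs_nonneg _)
  have := abs_sub x (grid N (γ : ℕ))
  rw [abs_of_nonneg (grid_nonneg N γ)] at this
  linarith

/-! ### Finitely supported sequences as polynomials in the shift. -/

/-- The polynomial `∑ c_γ X^γ`. -/
noncomputable def genPoly (N : ℕ) (c : Fin (N + 1) → ℝ) : ℂ[X] :=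
  ∑ γ : Fin (N + 1), Polynomial.C ((c γ : ℝ) : ℂ) * Polynomial.X ^ (γ : ℕ)

lemma act_genPoly (N : ℕ) (c : Fin (N + 1) → ℝ) (u : ℤ → ℂ) (β : ℤ) :
    act (genPoly N c) u β = ∑ γ : Fin (N + 1), ((c γ : ℝ) : ℂ) * u (β - (γ : ℕ)) := by
  rw [genPoly, act_sum, Finset.sum_apply]
  refine Finset.sum_congr rfl fun γ _ => ?_
  rw [act_mul, act_C, Pi.smul_apply, act_X_pow, smul_eq_mul]

lemma act_genPoly_psi (k N : ℕ) (c : Fin (N + 1) → ℝ) :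
    act (genPoly N c) (sample (1 / (N : ℝ)) (psi (k + 1))) =
      sample (1 / (N : ℝ)) (psiSum k N c) := by
  ext β
  rw [act_genPoly]
  simp only [sample, psiSum]
  push_cast
  refine Finset.sum_congr rfl fun γ _ => ?_
  rw [grid, ← mul_sub]
  norm_num

lemma act_genPoly_unitSeq_of_le {N : ℕ} (c : Fin (N + 1) → ℝ) (β : Fin (N + 1)) :
    act (genPoly N c) unitSeq (β : ℕ) = ((c β : ℝ) : ℂ) := by
  rw [act_genPoly, Finset.sum_eq_single β]
  · simp [unitSeq]
  · intro γ _ hγ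
    rw [unitSeq, if_neg, mul_zero]
    intro h
    exact hγ (Fin.ext (by omega))
  · simp

lemma act_genPoly_unitSeq_of_outside {N : ℕ} (c : Fin (N + 1) → ℝ) {β : ℤ}
    (hβ : β < 0 ∨ (N : ℤ) < β) : act (genPoly N c) unitSeq β = 0 := by
  rw [act_genPoly]
  refine Finset.sum_eq_zero fun γ _ => ?_
  rw [unitSeq, if_neg, mul_zero]
  have := γ.2
  omega

lemma exists_genPoly_unitSeq {N : ℕ} {u : ℤ → ℝ} (hu : ∀ β : ℤ, (β < 0 ∨ (N : ℤ) < β) → u β = 0) :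
    (fun β => ((u β : ℝ) : ℂ)) = act (genPoly N fun β => u (β : ℕ)) unitSeq := by
  ext β
  by_cases hβ : β < 0 ∨ (N : ℤ) < β
  · rw [act_genPoly_unitSeq_of_outside _ hβ, hu β hβ, Complex.ofReal_zero]
  · obtain ⟨n, rfl⟩ : ∃ n : ℕ, β = n := ⟨β.toNat, by omega⟩
    have hn : n < N + 1 := by omega
    exact (act_genPoly_unitSeq_of_le (fun β => u (β : ℕ)) ⟨n, hn⟩).symm

end OptimalQuadrature

namespace OptimalQuadrature

/-! ### The extension `u` of `f_m` and the explicit coefficients -/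

lemma mesh_pos {N : ℕ} (hN : 1 ≤ N) : (0 : ℝ) < 1 / (N : ℝ) := by
  have : (0 : ℝ) < N := by exact_mod_cast hN
  positivity

/-- From k ≤ N and N ≥ 1 one has k + 1 ≤ N + 1 ≤ 2N; the condition m ≤ N + 1 supplies the root bound
in this way. -/
lemma mesh_bound {k N : ℕ} (hN : 1 ≤ N) (hk : k ≤ N) :
    k = 0 ∨ ((k : ℝ) + 1) * (1 / (N : ℝ)) ≤ 2 := by
  have h1 : (1 : ℝ) ≤ N := by exact_mod_cast hN
  have h2 : (k : ℝ) ≤ N := by exact_mod_cast hk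
  right
  rw [mul_one_div, div_le_iff₀ (by linarith)]
  linarith

lemma Grows.ite {h : ℝ} {u v : ℤ → ℂ} (hu : Grows h u) (hv : Grows h v) (P : ℤ → Prop)
    [DecidablePred P] : Grows h fun β => if P β then u β else v β := by
  obtain ⟨C, hC⟩ := hu
  obtain ⟨C', hC'⟩ := hv
  refine ⟨max C C', fun β => ?_⟩
  dsimp only
  split_ifs
  · exact (hC β).trans (mul_le_mul_of_nonneg_right (le_max_left _ _) (Real.exp_pos _).le)
  · exact (hC' β).trans (mul_le_mul_of_nonneg_right (le_max_right _ _) (Real.exp_pos _).le)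

lemma grows_zero (h : ℝ) : Grows h fun _ => 0 := ⟨0, fun β => by simp⟩

lemma uFun_of_neg (m N : ℕ) (p : ℝ → ℝ) (Qm Qp : ℝ[X]) (am ap : ℝ) {β : ℤ} (hβ : β < 0) :
    uFun m N p Qm Qp am ap β =
      expPoly (-expMoment p / 4) (polyQ m p + Qm) am ((1 / (N : ℝ)) * β) := by
  rw [uFun, if_pos hβ, expPoly, Polynomial.eval_add, grid]
  ring

lemma uFun_of_gt (m N : ℕ) (p : ℝ → ℝ) (Qm Qp : ℝ[X]) (am ap : ℝ) {β : ℤ} (hβ : (N : ℤ) < β) :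
    uFun m N p Qm Qp am ap β =
      expPoly (expMoment p / 4) (Qp - polyQ m p) ap ((1 / (N : ℝ)) * β) := by
  rw [uFun, if_neg (by omega), if_neg (by omega), expPoly, Polynomial.eval_sub, grid]
  ring

lemma uFun_of_mem (m N : ℕ) (p : ℝ → ℝ) (Qm Qp : ℝ[X]) (am ap : ℝ) {β : ℤ} (h0 : 0 ≤ β)
    (hβ : β ≤ N) : uFun m N p Qm Qp am ap β = fm m p (grid N β) := by
  rw [uFun, if_neg (by omega), if_pos hβ]

lemma grows_uFun (k N : ℕ) {p : ℝ → ℝ} (hp : IntegrableOn p (Set.Icc 0 1)) (Qm Qp : ℝ[X])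
    (am ap : ℝ) :
    Grows (1 / (N : ℝ)) fun β => ((uFun (k + 1) N p Qm Qp am ap β : ℝ) : ℂ) := by
  have hh : (0 : ℝ) ≤ 1 / (N : ℝ) := by positivity
  have h1 := ((expBounded_expPoly (-expMoment p / 4) (polyQ (k + 1) p + Qm) am).grows hh).ite
    (((expBounded_fm k hp).grows hh).ite
      ((expBounded_expPoly (expMoment p / 4) (Qp - polyQ (k + 1) p) ap).grows hh)
      (fun β => β ≤ (N : ℤ))) (fun β => β < 0)
  obtain ⟨C, hC⟩ := h1
  refine ⟨C, fun β => (le_of_eq ?_).trans (hC β)⟩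
  congr 1
  dsimp only
  split_ifs with h1 h2
  · rw [uFun_of_neg _ _ _ _ _ _ _ h1]
  · rw [uFun_of_mem _ _ _ _ _ _ _ (not_lt.1 h1) h2]; rfl
  · rw [uFun_of_gt _ _ _ _ _ _ _ (not_le.1 h2)]

lemma leftTerm_eq (m N : ℕ) (p : ℝ → ℝ) (Qm Qp : ℝ[X]) (am ap : ℝ) (n : ℕ) :
    leftTerm m N p Qm am (n + 1) = uFun m N p Qm Qp am ap (-(n + 1 : ℕ) : ℤ) -
      fm m p (grid N (-(n + 1 : ℕ) : ℤ)) := by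
  have e : grid N (-(n + 1 : ℕ) : ℤ) = -grid N (n + 1 : ℕ) := by simp [grid]; ring
  rw [uFun, if_pos (by omega), e, leftTerm, neg_neg]

lemma rightTerm_eq {N : ℕ} (hN : 1 ≤ N) (m : ℕ) (p : ℝ → ℝ) (Qm Qp : ℝ[X]) (am ap : ℝ) (n : ℕ) :
    rightTerm m N p Qp ap (n + 1) = uFun m N p Qm Qp am ap (N + (n + 1 : ℕ) : ℤ) -
      fm m p (grid N (N + (n + 1 : ℕ) : ℤ)) := by
  have hN' : (N : ℝ) ≠ 0 := by positivity
  have e : grid N (N + (n + 1 : ℕ) : ℤ) = 1 + grid N (n + 1 : ℕ) := by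
    simp only [grid]; push_cast; field_simp
  rw [uFun, if_neg (by omega), if_neg (by omega), e, rightTerm, neg_add, ← sub_eq_add_neg]

/-- Here j is the distance from the node to the end of the interval and n + 1 the number of steps
beyond it. Splitting the power lets the sum over n separate from z^j; the extra -2e^h at distance 1
occurs only at an end node and becomes a or b. -/
lemma discD_tail {k : ℕ} {h : ℝ} (hh : 0 < h) (j n : ℕ) {β : ℤ} (hβ : β.natAbs = j + (n + 1)) :
    discD (k + 1) h β = ∑ z ∈ innerRoots (k + 1) h,
      coefA (k + 1) h z / (z * ((leadP (k + 1) h : ℝ) : ℂ)) * z ^ j * z ^ (n + 1) +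
      if j = 0 ∧ n = 0 then ((-(2 * Real.exp h / leadP (k + 1) h) : ℝ) : ℂ) else 0 := by
  have hz0 : ∀ z ∈ innerRoots (k + 1) h, z ≠ 0 := fun z hz => by
    obtain ⟨x, rfl, -, h2, -⟩ := exists_real_of_mem_innerRoots hh k hz
    exact_mod_cast h2.ne
  have hlead : ((leadP (k + 1) h : ℝ) : ℂ) ≠ 0 := by exact_mod_cast (leadP_neg hh k).ne
  have hs : ∑ z ∈ innerRoots (k + 1) h,
      coefA (k + 1) h z / (z * ((leadP (k + 1) h : ℝ) : ℂ)) * z ^ j * z ^ (n + 1) =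
      1 / ((leadP (k + 1) h : ℝ) : ℂ) *
        ∑ z ∈ innerRoots (k + 1) h, coefA (k + 1) h z * z ^ (j + n) := by
    rw [Finset.mul_sum]
    refine Finset.sum_congr rfl fun z hz => ?_
    have := hz0 z hz
    field_simp
    ring
  rw [hs, discD, if_neg (by omega)]
  by_cases h1 : j = 0 ∧ n = 0
  · obtain ⟨rfl, rfl⟩ := h1
    rw [if_pos (by omega), if_pos ⟨rfl, rfl⟩]
    simp only [add_zero, pow_zero, mul_one]
    push_cast
    ring
  · rw [if_neg (by omega), if_neg h1, add_zero, show β.natAbs - 1 = j + n by omega]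

lemma summable_pow_mul {h : ℝ} {z : ℂ} (hz : ‖z‖ < Real.exp (-h)) {C : ℝ} {F : ℕ → ℂ}
    (hF : ∀ n : ℕ, ‖F n‖ ≤ C * Real.exp (h * n)) : Summable fun n : ℕ => z ^ n * F n := by
  have h1 : ‖z‖ * Real.exp h < 1 := by
    calc ‖z‖ * Real.exp h < Real.exp (-h) * Real.exp h := by gcongr
      _ = 1 := by rw [← Real.exp_add]; simp
  refine Summable.of_norm_bounded
    ((summable_geometric_of_lt_one (by positivity) h1).mul_left C) fun n => ?_
  rw [norm_mul, norm_pow, mul_pow, ← Real.exp_nat_mul, mul_comm (n : ℝ) h]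
  calc ‖z‖ ^ n * ‖F n‖ ≤ ‖z‖ ^ n * (C * Real.exp (h * n)) := by gcongr; exact hF n
    _ = _ := by ring

lemma summable_left {k N : ℕ} (hN : 1 ≤ N) (hk : k ≤ N) {p : ℝ → ℝ}
    (hp : IntegrableOn p (Set.Icc 0 1)) (Q : ℝ[X]) (a : ℝ) {z : ℂ}
    (hz : z ∈ innerRoots (k + 1) (1 / (N : ℝ))) : Summable fun γ : ℕ =>
      z ^ (γ + 1) * ((leftTerm (k + 1) N p Q a (γ + 1) : ℝ) : ℂ) := by
  have hz' := norm_lt_exp_of_mem_innerRoots (mesh_pos hN) (mesh_bound hN hk) hz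
  obtain ⟨C, hC⟩ := (grows_uFun k N hp Q 0 a 0).sub
    ((expBounded_fm k hp).grows (mesh_pos hN).le)
  have h1 := summable_pow_mul (C := C) (F := fun n : ℕ =>
    ((uFun (k + 1) N p Q 0 a 0 (-n : ℤ) - fm (k + 1) p (grid N (-n : ℤ)) : ℝ) : ℂ)) hz' (fun n => by
      have := hC (-n)
      simp only [Int.cast_neg, Int.cast_natCast, abs_neg, Nat.abs_cast, Pi.sub_apply] at this
      rw [Complex.ofReal_sub]
      simpa [sample, grid] using this)
  refine ((summable_nat_add_iff 1).2 h1).congr fun n => ?_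
  rw [leftTerm_eq (k + 1) N p Q 0 a 0 n]

lemma summable_right {k N : ℕ} (hN : 1 ≤ N) (hk : k ≤ N) {p : ℝ → ℝ}
    (hp : IntegrableOn p (Set.Icc 0 1)) (Q : ℝ[X]) (a : ℝ) {z : ℂ}
    (hz : z ∈ innerRoots (k + 1) (1 / (N : ℝ))) : Summable fun γ : ℕ =>
      z ^ (γ + 1) * ((rightTerm (k + 1) N p Q a (γ + 1) : ℝ) : ℂ) := by
  have hz' := norm_lt_exp_of_mem_innerRoots (mesh_pos hN) (mesh_bound hN hk) hz
  obtain ⟨C, hC⟩ := (grows_uFun k N hp 0 Q 0 a).sub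
    ((expBounded_fm k hp).grows (mesh_pos hN).le)
  have h1 := summable_pow_mul (C := C * Real.exp (1 / (N : ℝ) * N)) (F := fun n : ℕ =>
    ((uFun (k + 1) N p 0 Q 0 a (N + n : ℤ) - fm (k + 1) p (grid N (N + n : ℤ)) : ℝ) : ℂ)) hz'
    (fun n => by
      have := hC (N + n)
      have e : |(((N : ℤ) + (n : ℤ) : ℤ) : ℝ)| = N + n := by
        push_cast
        exact abs_of_nonneg (by positivity)
      rw [e, mul_add, Real.exp_add, ← mul_assoc, Pi.sub_apply] at this
      rw [Complex.ofReal_sub]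
      exact this)
  refine ((summable_nat_add_iff 1).2 h1).congr fun n => ?_
  rw [rightTerm_eq hN (k + 1) p 0 Q 0 a n]

lemma summable_conv_fm {k N : ℕ} (hN : 1 ≤ N) (hk : k ≤ N) {p : ℝ → ℝ}
    (hp : IntegrableOn p (Set.Icc 0 1)) (β : ℤ) : Summable fun γ : ℤ =>
      discD (k + 1) (1 / (N : ℝ)) (β - γ) * ((fm (k + 1) p (grid N γ) : ℝ) : ℂ) :=
  (decays_discD (mesh_pos hN) (mesh_bound hN hk)).summable_conv (mesh_pos hN).le
    ((expBounded_fm k hp).grows (mesh_pos hN).le) β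

/-- The convolution of `D_m` with a one-sided sequence. -/
lemma tsum_discD_mul {k N : ℕ} (hN : 1 ≤ N) (T : ℕ → ℝ)
    (hT : ∀ z ∈ innerRoots (k + 1) (1 / (N : ℝ)),
      Summable fun n : ℕ => z ^ (n + 1) * ((T (n + 1) : ℝ) : ℂ)) (j : ℕ) (δ : ℕ → ℤ)
    (hδ : ∀ n, (δ n).natAbs = j + (n + 1)) :
    ∑' n : ℕ, discD (k + 1) (1 / (N : ℝ)) (δ n) * ((T (n + 1) : ℝ) : ℂ) =
      (if j = 0 then ((-(2 * Real.exp (1 / (N : ℝ)) / leadP (k + 1) (1 / (N : ℝ))) * T 1 : ℝ) : ℂ)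
        else 0) +
      ∑ z ∈ innerRoots (k + 1) (1 / (N : ℝ)),
        coefA (k + 1) (1 / (N : ℝ)) z / (z * ((leadP (k + 1) (1 / (N : ℝ)) : ℝ) : ℂ)) *
          (∑' n : ℕ, z ^ (n + 1) * ((T (n + 1) : ℝ) : ℂ)) * z ^ j := by
  set s := innerRoots (k + 1) (1 / (N : ℝ)) with hs
  have e : ∀ n : ℕ, discD (k + 1) (1 / (N : ℝ)) (δ n) * ((T (n + 1) : ℝ) : ℂ) =
      (∑ z ∈ s, coefA (k + 1) (1 / (N : ℝ)) z /
        (z * ((leadP (k + 1) (1 / (N : ℝ)) : ℝ) : ℂ)) * z ^ j *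
          (z ^ (n + 1) * ((T (n + 1) : ℝ) : ℂ))) +
      if n = 0 then (if j = 0 then
        ((-(2 * Real.exp (1 / (N : ℝ)) / leadP (k + 1) (1 / (N : ℝ))) * T 1 : ℝ) : ℂ) else 0)
        else 0 := by
    intro n
    rw [discD_tail (mesh_pos hN) j n (hδ n), add_mul, Finset.sum_mul]
    congr 1
    · exact Finset.sum_congr rfl fun z _ => by ring
    · by_cases hn : n = 0
      · by_cases hj : j = 0
        · simp only [hn, hj]; simp
        · simp [hn, hj]
      · simp [hn]
  rw [tsum_congr e, Summable.tsum_add, tsum_ite_eq, Summable.tsum_finsetSum, add_comm]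
  · congr 1
    refine Finset.sum_congr rfl fun z _ => ?_
    rw [tsum_mul_left]
    ring
  · exact fun z hz => (hT z hz).mul_left _
  · exact summable_sum fun z hz => (hT z hz).mul_left _
  · exact (hasSum_ite_eq 0 _).summable

lemma tsum_int_eq_tsum_nat {F : ℤ → ℂ} {i : ℕ → ℤ} (hi : Function.Injective i)
    (hF : ∀ γ, γ ∉ Set.range i → F γ = 0) : ∑' γ, F γ = ∑' n, F (i n) :=
  (hi.tsum_eq fun γ hγ => by_contra fun h => hγ (hF γ h)).symm

/-- The convolution of `D_m` with the extension of `f_m` is the explicit formula. -/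
theorem conv_uFun_eq_explicitCoef {k N : ℕ} (hN : 1 ≤ N) (hk : k ≤ N) {p : ℝ → ℝ}
    (hp : IntegrableOn p (Set.Icc 0 1)) (Qm Qp : ℝ[X]) (am ap : ℝ) {n : ℕ} (hn : n ≤ N) :
    conv (discD (k + 1) (1 / (N : ℝ))) (fun β => ((uFun (k + 1) N p Qm Qp am ap β : ℝ) : ℂ)) n =
      explicitCoef (k + 1) N p Qm Qp am ap n := by
  have hh := mesh_pos hN
  have hD := decays_discD hh (mesh_bound hN hk)
  set u : ℤ → ℂ := fun β => ((uFun (k + 1) N p Qm Qp am ap β : ℝ) : ℂ) with hu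
  set f : ℤ → ℂ := fun γ => ((fm (k + 1) p (grid N γ) : ℝ) : ℂ) with hf
  have hug : Grows (1 / (N : ℝ)) u := grows_uFun k N hp Qm Qp am ap
  have hfg : Grows (1 / (N : ℝ)) f := (expBounded_fm k hp).grows hh.le
  -- u is f_m plus corrections supported strictly to the left and strictly to the right of the
  -- interval; these yield a_k, a and b_k, b.
  set L : ℤ → ℂ := fun γ => if γ < 0 then u γ - f γ else 0 with hL
  set R : ℤ → ℂ := fun γ => if (N : ℤ) < γ then u γ - f γ else 0 with hR
  have hLg : Grows (1 / (N : ℝ)) L := (hug.sub hfg).ite (grows_zero _) _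
  have hRg : Grows (1 / (N : ℝ)) R := (hug.sub hfg).ite (grows_zero _) _
  have hsplit : ∀ γ, u γ = f γ + (L γ + R γ) := by
    intro γ
    simp only [hL, hR]
    split_ifs with h1 h2 h2
    · omega
    · ring
    · ring
    · simp only [hu, hf]
      rw [uFun_of_mem _ _ _ _ _ _ _ (by omega) (by omega)]
      ring
  have h1 : conv (discD (k + 1) (1 / (N : ℝ))) u n = conv (discD (k + 1) (1 / (N : ℝ))) f n +
      (conv (discD (k + 1) (1 / (N : ℝ))) L n + conv (discD (k + 1) (1 / (N : ℝ))) R n) := by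
    have s1 := hD.summable_conv hh.le hfg n
    have s2 := hD.summable_conv hh.le hLg n
    have s3 := hD.summable_conv hh.le hRg n
    simp only [conv]
    rw [← s2.tsum_add s3, ← s1.tsum_add (s2.add s3)]
    refine tsum_congr fun γ => ?_
    rw [hsplit γ]; ring
  have h2 : conv (discD (k + 1) (1 / (N : ℝ))) L n =
      (if n = 0 then ((boundLeft (k + 1) N p Qm am : ℝ) : ℂ) else 0) +
      ∑ z ∈ innerRoots (k + 1) (1 / (N : ℝ)), coefLeft (k + 1) N p Qm am z * z ^ n := by
    rw [conv, tsum_int_eq_tsum_nat (i := fun j : ℕ => (-(j + 1 : ℕ) : ℤ))]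
    · refine Eq.trans ?_ (tsum_discD_mul hN (leftTerm (k + 1) N p Qm am)
        (fun z hz => summable_left hN hk hp Qm am hz) n
        (fun j => (n : ℤ) - (-(j + 1 : ℕ) : ℤ)) (fun j => by omega))
      refine tsum_congr fun j => ?_
      rw [leftTerm_eq (k + 1) N p Qm Qp am ap j]
      simp only [hL]
      rw [if_pos (by omega), Complex.ofReal_sub]
    · intro a b hab
      simp at hab
      exact hab
    · intro γ hγ
      simp only [hL]
      rw [if_neg, mul_zero]
      intro h0
      exact hγ ⟨(-γ - 1).toNat, by simp only []; omega⟩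
  have h3 : conv (discD (k + 1) (1 / (N : ℝ))) R n =
      (if N - n = 0 then ((boundRight (k + 1) N p Qp ap : ℝ) : ℂ) else 0) +
      ∑ z ∈ innerRoots (k + 1) (1 / (N : ℝ)), coefRight (k + 1) N p Qp ap z * z ^ (N - n) := by
    rw [conv, tsum_int_eq_tsum_nat (i := fun j : ℕ => (N + (j + 1 : ℕ) : ℤ))]
    · refine Eq.trans ?_ (tsum_discD_mul hN (rightTerm (k + 1) N p Qp ap)
        (fun z hz => summable_right hN hk hp Qp ap hz) (N - n)
        (fun j => (n : ℤ) - (N + (j + 1 : ℕ) : ℤ)) (fun j => by omega))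
      refine tsum_congr fun j => ?_
      rw [rightTerm_eq hN (k + 1) p Qm Qp am ap j]
      simp only [hR]
      rw [if_pos (by omega), Complex.ofReal_sub]
    · intro a b hab
      simp at hab
      exact hab
    · intro γ hγ
      simp only [hR]
      rw [if_neg, mul_zero]
      intro h0
      exact hγ ⟨(γ - N - 1).toNat, by simp only []; omega⟩
  rw [h1, h2, h3, explicitCoef]
  have hf' : ∀ β : ℤ, conv (discD (k + 1) (1 / (N : ℝ))) f β =
      convD (k + 1) N (fun γ => fm (k + 1) p (grid N γ)) β := fun _ => rfl
  rw [hf']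
  by_cases hn0 : n = 0
  · subst hn0
    rw [if_pos rfl, if_pos rfl, if_neg (by omega)]
    simp only [pow_zero, mul_one, Nat.sub_zero, Finset.sum_add_distrib, Nat.cast_zero]
    ring
  · rw [if_neg hn0, if_neg hn0]
    by_cases hnN : n = N
    · subst hnN
      rw [if_pos (by omega), if_pos rfl]
      simp only [Nat.sub_self, pow_zero, mul_one, Finset.sum_add_distrib]
      ring
    · rw [if_neg (by omega), if_neg hnN]
      simp only [Finset.sum_add_distrib]
      ring

end OptimalQuadrature

namespace OptimalQuadrature

/-! ### The outer equations are equivalent to the linear system -/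

lemma mem_degreeLT_degree_lt {q : ℝ[X]} {n l : ℕ} (hq : q ∈ Polynomial.degreeLT ℝ n) (hl : n ≤ l) :
    q.degree < (l : ℕ) :=
  (Polynomial.mem_degreeLT.1 hq).trans_le (by exact_mod_cast hl)

lemma degree_polyQ_lt (k : ℕ) (p : ℝ → ℝ) : (polyQ (k + 1) p).degree < (2 * k : ℕ) := by
  rw [polyQ_eq]; exact degree_momentPoly_lt k _

lemma polyQlow_mem_degreeLT (k N : ℕ) (c : Fin (N + 1) → ℝ) :
    polyQlow (k + 1) N c ∈ Polynomial.degreeLT ℝ k := by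
  rw [polyQlow_eq]
  exact momentPoly_mem_degreeLT fun α hα => if_pos hα

lemma one_le_mesh_mul {N : ℕ} (hN : 1 ≤ N) {β : ℤ} (hβ : (N : ℤ) ≤ β) :
    1 ≤ (1 / (N : ℝ)) * β := by
  have : (0 : ℝ) < N := by exact_mod_cast hN
  rw [one_div, ← div_eq_inv_mul, le_div_iff₀ this, one_mul]
  exact_mod_cast hβ

lemma mesh_mul_nonpos (N : ℕ) {β : ℤ} (hβ : β ≤ 0) : (1 / (N : ℝ)) * β ≤ 0 :=
  mul_nonpos_of_nonneg_of_nonpos (by positivity) (by exact_mod_cast hβ)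

/-- Inside the interval this is the first equation of the system. Outside, the exactness conditions
turn the coefficients of the exponential polynomial `psiSum` into those prescribed for u, and
Q_{m-2} and D enter with opposite signs on the two sides. -/
lemma uFun_eq_of_solvesSystem {k N : ℕ} (hN : 1 ≤ N) {p : ℝ → ℝ} {c : Fin (N + 1) → ℝ} {P : ℝ[X]}
    {d : ℝ} (hs : SolvesSystem (k + 1) N p c P d) (β : ℤ) :
    uFun (k + 1) N p (P + polyQlow (k + 1) N c) (P - polyQlow (k + 1) N c) (d + constD N c)
      (d - constD N c) β = psiSum k N c ((1 / (N : ℝ)) * β) + expPoly 0 P d ((1 / (N : ℝ)) * β) := by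
  obtain ⟨-, h1, h2, h3⟩ := hs
  have hM := momentPoly_powerSum (k := k) (N := N) (p := p) (c := c)
    fun α hα => h2 α (by simpa using hα)
  rcases lt_or_ge β 0 with hβ | hβ
  · rw [uFun_of_neg _ _ _ _ _ _ _ hβ, psiSum_of_nonpos _ _ _ (mesh_mul_nonpos N hβ.le), h3, hM]
    simp only [expPoly, Polynomial.eval_add]
    ring
  rcases lt_or_ge (N : ℤ) β with hβ' | hβ'
  · rw [uFun_of_gt _ _ _ _ _ _ _ hβ', psiSum_of_one_le hN _ (one_le_mesh_mul hN hβ'.le), h3, hM]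
    simp only [expPoly, Polynomial.eval_add, Polynomial.eval_sub, Polynomial.eval_neg]
    ring
  · rw [uFun_of_mem _ _ _ _ _ _ _ hβ hβ']
    obtain ⟨n, rfl⟩ : ∃ n : ℕ, β = n := ⟨β.toNat, by omega⟩
    have := h1 ⟨n, by omega⟩
    simp only at this
    rw [← this, psiSum, expPoly, zero_mul, zero_add, ← add_assoc]
    rfl

/-- The linear system implies `D_m * u = c`. -/
theorem conv_uFun_of_solvesSystem {k N : ℕ} (hN : 1 ≤ N) (hk : k ≤ N) {p : ℝ → ℝ}
    {c : Fin (N + 1) → ℝ} {P : ℝ[X]} {d : ℝ} (hs : SolvesSystem (k + 1) N p c P d) :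
    conv (discD (k + 1) (1 / (N : ℝ))) (fun β => ((uFun (k + 1) N p (P + polyQlow (k + 1) N c)
      (P - polyQlow (k + 1) N c) (d + constD N c) (d - constD N c) β : ℝ) : ℂ)) =
      act (genPoly N c) unitSeq := by
  have hh := mesh_pos hN
  have hD := decays_discD hh (mesh_bound hN hk)
  have hg1 := (expBounded_psiSum k N c).grows hh.le
  have hg2 := (expBounded_expPoly 0 P d).grows hh.le
  have e : (fun β => ((uFun (k + 1) N p (P + polyQlow (k + 1) N c)
      (P - polyQlow (k + 1) N c) (d + constD N c) (d - constD N c) β : ℝ) : ℂ)) =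
      sample (1 / (N : ℝ)) (psiSum k N c) - (-1 : ℂ) • sample (1 / (N : ℝ)) (expPoly 0 P d) := by
    ext β
    rw [uFun_eq_of_solvesSystem hN hs β]
    simp [sample]
  have hz : act (opPolyC k (1 / (N : ℝ))) ((-1 : ℂ) • sample (1 / (N : ℝ)) (expPoly 0 P d)) = 0 := by
    rw [map_smul, act_opPoly_expPoly k _ _ (mem_degreeLT_degree_lt hs.1 (by omega)), smul_zero]
  rw [e, conv_sub_right hh.le hD hg1 (hg2.smul _),
    conv_discD_eq_zero hh (mesh_bound hN hk) (hg2.smul _) hz, sub_zero, ← act_genPoly_psi,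
    conv_discD_act_psi hh (mesh_bound hN hk) ((expBounded_psi k).grows hh.le)]

theorem solvesOuter_of_solvesSystem {k N : ℕ} (hN : 1 ≤ N) (hk : k ≤ N) {p : ℝ → ℝ}
    (hp : IntegrableOn p (Set.Icc 0 1))
    {c : Fin (N + 1) → ℝ} {P : ℝ[X]} {d : ℝ} (hs : SolvesSystem (k + 1) N p c P d) :
    SolvesOuter (k + 1) N p (P + polyQlow (k + 1) N c) (P - polyQlow (k + 1) N c)
      (d + constD N c) (d - constD N c) := by
  refine ⟨Submodule.add_mem _ hs.1 (polyQlow_mem_degreeLT k N c),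
    Submodule.sub_mem _ hs.1 (polyQlow_mem_degreeLT k N c), fun β hβ => ?_⟩
  have h1 := ((decays_discD (mesh_pos hN) (mesh_bound hN hk)).summable_conv (mesh_pos hN).le
    (grows_uFun k N hp (P + polyQlow (k + 1) N c) (P - polyQlow (k + 1) N c)
      (d + constD N c) (d - constD N c)) β).hasSum
  have h2 := congrFun (conv_uFun_of_solvesSystem hN hk hs) β
  rw [act_genPoly_unitSeq_of_outside c hβ] at h2
  rwa [← h2]

lemma coefA_ofReal (k : ℕ) (h x : ℝ) : ∃ y : ℝ, coefA (k + 1) h (x : ℂ) = y := by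
  refine ⟨2 * (1 - x) ^ (2 * (k + 1) - 2) * (x * (Real.exp (2 * h) + 1) - Real.exp h * (x ^ 2 + 1)) *
    leadP (k + 1) h / (x * (Polynomial.derivative (charP (k + 1) h)).eval x), ?_⟩
  have : (Polynomial.aeval (x : ℂ)) (Polynomial.derivative (charP (k + 1) h)) =
      (((Polynomial.derivative (charP (k + 1) h)).eval x : ℝ) : ℂ) :=
    Polynomial.aeval_algebraMap_apply_eq_algebraMap_eval x _
  rw [coefA, this]
  push_cast
  ring

/-- The inner roots are real, hence so are the A_k and D_m; invariance under conjugation lets D_m *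
u provide real coefficients. -/
lemma discD_real {k : ℕ} {h : ℝ} (hh : 0 < h) (β : ℤ) : ∃ y : ℝ, discD (k + 1) h β = y := by
  have hA : ∀ z ∈ innerRoots (k + 1) h, (starRingEnd ℂ) z = z ∧
      (starRingEnd ℂ) (coefA (k + 1) h z) = coefA (k + 1) h z := fun z hz => by
    obtain ⟨x, rfl, -⟩ := exists_real_of_mem_innerRoots hh k hz
    obtain ⟨y, hy⟩ := coefA_ofReal k h x
    rw [hy]
    exact ⟨Complex.conj_ofReal x, Complex.conj_ofReal y⟩
  suffices hc : (starRingEnd ℂ) (discD (k + 1) h β) = discD (k + 1) h β by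
    obtain ⟨y, hy⟩ := Complex.conj_eq_iff_real.1 hc
    exact ⟨y, hy⟩
  have e1 : ∀ n : ℕ, (starRingEnd ℂ) (∑ z ∈ innerRoots (k + 1) h, coefA (k + 1) h z * z ^ n) =
      ∑ z ∈ innerRoots (k + 1) h, coefA (k + 1) h z * z ^ n := fun n => by
    rw [map_sum]
    refine Finset.sum_congr rfl fun z hz => ?_
    rw [map_mul, map_pow, (hA z hz).1, (hA z hz).2]
  have e2 : (starRingEnd ℂ) (∑ z ∈ innerRoots (k + 1) h, coefA (k + 1) h z / z) =
      ∑ z ∈ innerRoots (k + 1) h, coefA (k + 1) h z / z := by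
    rw [map_sum]
    refine Finset.sum_congr rfl fun z hz => ?_
    rw [map_div₀, (hA z hz).1, (hA z hz).2]
  have e3 := e1 0
  simp only [pow_zero, mul_one] at e3
  rw [discD, map_mul, map_div₀, map_one, Complex.conj_ofReal]
  congr 1
  split_ifs
  · rw [map_add, e2, map_mul, Complex.conj_ofReal, map_ofNat]
  · rw [map_add, e3, map_mul, Complex.conj_ofReal, map_neg, map_ofNat]
  · exact e1 _

lemma conv_discD_real {k : ℕ} {h : ℝ} (hh : 0 < h) (u : ℤ → ℝ) (β : ℤ) :
    ∃ y : ℝ, conv (discD (k + 1) h) (fun γ => ((u γ : ℝ) : ℂ)) β = y := by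
  choose D hD using fun β => discD_real (k := k) hh β
  refine ⟨∑' γ : ℤ, D (β - γ) * u γ, ?_⟩
  rw [Complex.ofReal_tsum, conv]
  refine tsum_congr fun γ => ?_
  rw [hD, Complex.ofReal_mul]

/-- The outer equations imply the linear system for the coefficients `D_m * u`. -/
theorem solvesSystem_of_solvesOuter {k N : ℕ} (hN : 1 ≤ N) (hk : k ≤ N) {p : ℝ → ℝ}
    (hp : IntegrableOn p (Set.Icc 0 1)) {Qm Qp : ℝ[X]} {am ap : ℝ}
    (ho : SolvesOuter (k + 1) N p Qm Qp am ap) :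
    ∃ (c : Fin (N + 1) → ℝ) (P : ℝ[X]) (d : ℝ), SolvesSystem (k + 1) N p c P d ∧
      ∀ β : Fin (N + 1), ((c β : ℝ) : ℂ) = conv (discD (k + 1) (1 / (N : ℝ)))
        (fun β => ((uFun (k + 1) N p Qm Qp am ap β : ℝ) : ℂ)) (β : ℕ) := by
  have hh := mesh_pos hN
  have hb := mesh_bound hN hk
  have hD := decays_discD hh hb
  obtain ⟨hQm, hQp, ho⟩ := ho
  have hug := grows_uFun k N hp Qm Qp am ap
  choose e he using conv_discD_real (k := k) hh (uFun (k + 1) N p Qm Qp am ap)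
  have he0 : ∀ β : ℤ, (β < 0 ∨ (N : ℤ) < β) → e β = 0 := by
    intro β hβ
    have h1 := he β
    rw [conv, (ho β hβ).tsum_eq] at h1
    exact_mod_cast h1.symm
  set c : Fin (N + 1) → ℝ := fun β => e (β : ℕ) with hc
  set u : ℤ → ℂ := fun β => ((uFun (k + 1) N p Qm Qp am ap β : ℝ) : ℂ) with hu
  have hcu : conv (discD (k + 1) (1 / (N : ℝ))) u = act (genPoly N c) unitSeq := by
    rw [← exists_genPoly_unitSeq he0]
    exact funext he
  have hwg := (expBounded_psiSum k N c).grows hh.le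
  -- M annihilates u - ψ_m * c because D_m sends both u and ψ_m * c to c.
  have hv : act (opPolyC k (1 / (N : ℝ))) (u - sample (1 / (N : ℝ)) (psiSum k N c)) = 0 := by
    rw [← act_conv_discD hh hb (hug.sub hwg), conv_sub_right hh.le hD hug hwg, hcu,
      ← act_genPoly_psi, conv_discD_act_psi hh hb ((expBounded_psi k).grows hh.le), sub_self,
      map_zero]
  set S : ℝ := ∑ γ : Fin (N + 1), c γ * Real.exp (-grid N (γ : ℕ)) with hS
  set Z := momentPoly k (powerSum N c) with hZ
  have hdeg : (polyQ (k + 1) p + Qm - Z).degree < (2 * k : ℕ) :=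
    Polynomial.mem_degreeLT.1 (Submodule.sub_mem _ (Submodule.add_mem _
      (Polynomial.mem_degreeLT.2 (degree_polyQ_lt k p))
      (Polynomial.mem_degreeLT.2 (mem_degreeLT_degree_lt hQm (by omega))))
      (Polynomial.mem_degreeLT.2 (degree_momentPoly_lt k _)))
  -- On β < 0 the difference is an exponential polynomial killed by M. As M has nonzero constant
  -- coefficient, its recurrence continues this equality from the left to the whole grid.
  have hall : u - sample (1 / (N : ℝ)) (psiSum k N c) = sample (1 / (N : ℝ))
      (expPoly (-expMoment p / 4 - -S / 4) (polyQ (k + 1) p + Qm - Z) (am - constD N c)) := by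
    rw [← sub_eq_zero]
    refine eq_zero_of_act_eq_zero_of_left (p := opPolyC k (1 / (N : ℝ))) (β₀ := 0) ?_ ?_ ?_
    · rw [opPolyC, Polynomial.coeff_map, coeff_zero_opPoly]
      simp
    · rw [map_sub, hv, act_opPoly_expPoly k _ _ hdeg, sub_zero]
    · intro β hβ
      simp only [Pi.sub_apply, hu, sample]
      rw [uFun_of_neg _ _ _ _ _ _ _ hβ, psiSum_of_nonpos _ _ _ (mesh_mul_nonpos N hβ.le),
        ← expPoly_sub, ← hS, ← hZ]
      push_cast
      ring
  have hall' : ∀ β : ℤ, uFun (k + 1) N p Qm Qp am ap β - psiSum k N c ((1 / (N : ℝ)) * β) =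
      expPoly (-expMoment p / 4 - -S / 4) (polyQ (k + 1) p + Qm - Z) (am - constD N c)
        ((1 / (N : ℝ)) * β) := fun β => by
    have := congrFun hall β
    simp only [Pi.sub_apply, hu, sample] at this
    exact_mod_cast this
  -- To the right of the interval the same function has a second expression. The coefficients of e^x
  -- enter the two expressions with opposite signs, so their equality forces the exponential moment
  -- condition.
  have hright := expPoly_eq_zero hh (A := (expMoment p / 4 - S / 4) - (-expMoment p / 4 - -S / 4))
    (q := (Qp - polyQ (k + 1) p - -Z) - (polyQ (k + 1) p + Qm - Z))
    (B := (ap - -constD N c) - (am - constD N c)) (N := N) (fun n hn => by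
      have h1 := hall' n
      rw [uFun_of_gt _ _ _ _ _ _ _ (by exact_mod_cast hn),
        psiSum_of_one_le hN _ (one_le_mesh_mul hN (by exact_mod_cast hn.le)), expPoly_sub] at h1
      rw [← expPoly_sub]
      simp only [Int.cast_natCast] at h1
      rw [h1, sub_self])
  obtain ⟨hA, hq, -⟩ := hright
  have hSq : S = expMoment p := by linarith
  -- Comparing polynomial parts shows that twice the moment polynomial of the discrepancies is Qm -
  -- Qp, of degree below k; such a bound forces the first k discrepancies to vanish.
  have hmom : ∀ α < k, powerSum N c α = moment p α := by
    have h1 : momentPoly k (fun α => powerSum N c α - if α < k then moment p α else 0) =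
        Polynomial.C (1 / 2) * (Qm - Qp) := by
      rw [momentPoly_sub, ← polyQ_eq, ← hZ]
      have h2 : Polynomial.C (1 / 2 : ℝ) * 2 = 1 := by
        rw [show (2 : ℝ[X]) = Polynomial.C 2 from rfl, ← map_mul]; norm_num
      linear_combination Polynomial.C (1 / 2 : ℝ) * hq - (Z - polyQ (k + 1) p) * h2
    have h2 := eq_zero_of_momentPoly_mem_degreeLT (k := k)
      (M := fun α => powerSum N c α - if α < k then moment p α else 0) (by
        rw [h1, ← Polynomial.smul_eq_C_mul]
        exact Submodule.smul_mem _ _ (Submodule.sub_mem _ hQm hQp))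
    intro α hα
    have := h2 α hα
    rw [if_pos hα] at this
    linarith
  have hM := momentPoly_powerSum hmom
  refine ⟨c, Qm - polyQlow (k + 1) N c, am - constD N c, ⟨Submodule.sub_mem _ hQm
    (polyQlow_mem_degreeLT k N c), fun β => ?_, fun α hα => hmom α (by simpa using hα), hSq⟩,
    fun β => (he _).symm⟩
  have h1 := hall' (β : ℕ)
  rw [uFun_of_mem _ _ _ _ _ _ _ (by omega) (by have := β.2; omega), hSq, hZ, hM] at h1
  refine Eq.trans ?_ (sub_eq_iff_eq_add'.1 h1).symm
  rw [psiSum, expPoly, add_assoc]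
  congr 1
  simp only [Polynomial.eval_add, Polynomial.eval_sub, grid]
  ring

end OptimalQuadrature

namespace OptimalQuadrature

/-! ### The structure of the space `W_2^{(m,m-1)}(0,1)` -/

/-- The function `φ^{(k+1)} + φ^{(k)}` on `[0,1]`. -/
noncomputable def wDeriv (k : ℕ) (φ : ℝ → ℝ) (x : ℝ) : ℝ :=
  iteratedDerivWithin (k + 1) φ (Set.Icc 0 1) x + iteratedDerivWithin k φ (Set.Icc 0 1) x

lemma wNorm_eq (k : ℕ) (φ : ℝ → ℝ) :
    wNorm (k + 1) φ = Real.sqrt (∫ x in (0 : ℝ)..1, wDeriv k φ x ^ 2) := rfl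

lemma mem_degreeLT_sum_monomial (k : ℕ) (a : ℕ → ℝ) :
    ∑ j ∈ Finset.range k, Polynomial.C (a j) * Polynomial.X ^ j ∈ Polynomial.degreeLT ℝ k := by
  refine Submodule.sum_mem _ fun j hj => Polynomial.mem_degreeLT.2 ?_
  exact (Polynomial.degree_C_mul_X_pow_le j (a j)).trans_lt
    (by exact_mod_cast Finset.mem_range.1 hj)

/-- The translates of the Green function are annihilated by `D^{k+1} + D^k`. -/
lemma green_sub_eq (k : ℕ) (t : ℝ) :
    ∃ q ∈ Polynomial.degreeLT ℝ k, ∃ b : ℝ, ∀ x, green k (x - t) = expPoly 0 q b x := by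
  refine ⟨-∑ j ∈ Finset.range k, Polynomial.C ((-1) ^ k * (1 / (j.factorial : ℝ))) *
    (Polynomial.C t - Polynomial.X) ^ j, ?_, (-1) ^ k * Real.exp t, fun x => ?_⟩
  · refine Submodule.neg_mem _ (Submodule.sum_mem _ fun j hj => Polynomial.mem_degreeLT.2 ?_)
    refine (Polynomial.degree_le_of_natDegree_le (n := j) ?_).trans_lt
      (by exact_mod_cast Finset.mem_range.1 hj)
    refine (Polynomial.natDegree_C_mul_le _ _).trans (Polynomial.natDegree_pow_le.trans ?_)
    have : (Polynomial.C t - Polynomial.X).natDegree ≤ 1 := by compute_degree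
    nlinarith
  · rw [green, expRem, expPoly, neg_sub, sub_eq_add_neg t, Real.exp_add]
    simp only [Polynomial.eval_neg, Polynomial.eval_finsetSum, Polynomial.eval_mul,
      Polynomial.eval_C, Polynomial.eval_pow, Polynomial.eval_sub, Polynomial.eval_X]
    rw [mul_sub, Finset.mul_sum, ← sub_eq_add_neg t]
    have e : ∀ j ∈ Finset.range k, (-1 : ℝ) ^ k * ((t - x) ^ j / (j.factorial : ℝ)) =
        (-1) ^ k * (1 / (j.factorial : ℝ)) * (t - x) ^ j := fun j _ => by ring
    rw [Finset.sum_congr rfl e]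
    ring

lemma expPoly_add (A A' : ℝ) (q q' : ℝ[X]) (B B' x : ℝ) :
    expPoly A q B x + expPoly A' q' B' x = expPoly (A + A') (q + q') (B + B') x := by
  simp only [expPoly, Polynomial.eval_add]; ring

lemma expPoly_smul (s A : ℝ) (q : ℝ[X]) (B x : ℝ) :
    s * expPoly A q B x = expPoly (s * A) (s • q) (s * B) x := by
  simp only [expPoly, Polynomial.eval_smul, smul_eq_mul]; ring

lemma contDiff_green (k : ℕ) {n : WithTop ℕ∞} : ContDiff ℝ n (green k) := by
  unfold green expRem
  fun_prop

/-- Taylor's formula at x uses derivatives within [0, x], while the space is defined by derivatives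
within [0, 1]; at the right end point the two need this comparison. -/
lemma iteratedDerivWithin_Icc_eq {φ : ℝ → ℝ} {k : ℕ} (hφ : ContDiffOn ℝ k φ (Set.Icc 0 1)) {x : ℝ}
    (hx0 : 0 < x) (hx1 : x ≤ 1) {j : ℕ} (hj : j ≤ k) {t : ℝ} (ht : t ∈ Set.Icc 0 x) :
    iteratedDerivWithin j φ (Set.Icc 0 x) t = iteratedDerivWithin j φ (Set.Icc 0 1) t := by
  rw [iteratedDerivWithin, iteratedDerivWithin, iteratedFDerivWithin_subset
    (Set.Icc_subset_Icc_right hx1) (uniqueDiffOn_Icc hx0) (uniqueDiffOn_Icc zero_lt_one)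
    (hφ.of_le (by exact_mod_cast hj)) ht]

/-- Taylor's formula with integral remainder, for functions of class `C^k` on `[0,1]`. -/
lemma exists_taylor {φ : ℝ → ℝ} {k : ℕ} (hφ : ContDiffOn ℝ (k + 1 : ℕ) φ (Set.Icc 0 1)) :
    ∃ q ∈ Polynomial.degreeLT ℝ (k + 1), ∀ x ∈ Set.Icc (0 : ℝ) 1, φ x = q.eval x +
      ∫ t in (0 : ℝ)..x, (x - t) ^ k / (k.factorial : ℝ) *
        iteratedDerivWithin (k + 1) φ (Set.Icc 0 1) t := by
  refine ⟨_, mem_degreeLT_sum_monomial (k + 1)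
    fun j => (j.factorial : ℝ)⁻¹ * iteratedDerivWithin j φ (Set.Icc 0 1) 0, fun x hx => ?_⟩
  simp only [Polynomial.eval_finsetSum, Polynomial.eval_mul,
      Polynomial.eval_C, Polynomial.eval_pow, Polynomial.eval_X]
  rcases hx.1.eq_or_lt with rfl | hx0
  · rw [Finset.sum_range_succ']
    simp
  have h1 := taylor_integral_remainder (f := φ) (x₀ := 0) (x := x) (n := k) (by
    rw [Set.uIcc_of_le hx.1]
    exact hφ.mono (Set.Icc_subset_Icc_right hx.2))
  rw [Set.uIcc_of_le hx.1, taylor_within_apply, sub_eq_iff_eq_add'] at h1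
  rw [h1]
  congr 1
  · refine Finset.sum_congr rfl fun j hj => ?_
    rw [iteratedDerivWithin_Icc_eq hφ hx0 hx.2 (by simp at hj; omega) (Set.left_mem_Icc.2 hx.1),
      sub_zero, smul_eq_mul]
    ring
  · refine intervalIntegral.integral_congr fun t ht => ?_
    rw [Set.uIcc_of_le hx.1] at ht
    simp only [smul_eq_mul]
    rw [iteratedDerivWithin_Icc_eq hφ hx0 hx.2 le_rfl ht]

lemma memLp_two_of_continuousOn {f : ℝ → ℝ} (hf : ContinuousOn f (Set.Icc 0 1)) :
    MemLp f 2 (volume.restrict (Set.Icc 0 1)) := by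
  obtain ⟨C, hC⟩ := isCompact_Icc.exists_bound_of_continuousOn hf
  refine MemLp.of_bound (hf.aestronglyMeasurable measurableSet_Icc) C ?_
  rw [ae_restrict_iff' measurableSet_Icc]
  exact Filter.Eventually.of_forall hC

lemma absolutelyContinuousOnInterval_congr {f g : ℝ → ℝ} {a b : ℝ}
    (hf : AbsolutelyContinuousOnInterval f a b) (h : Set.EqOn g f (Set.uIcc a b)) :
    AbsolutelyContinuousOnInterval g a b := by
  rw [absolutelyContinuousOnInterval_iff] at hf ⊢
  intro ε hε
  obtain ⟨δ, hδ, hf⟩ := hf ε hε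
  refine ⟨δ, hδ, fun E hE hlt => ?_⟩
  have he : ∑ i ∈ Finset.range E.1, dist (g (E.2 i).1) (g (E.2 i).2) =
      ∑ i ∈ Finset.range E.1, dist (f (E.2 i).1) (f (E.2 i).2) := by
    refine Finset.sum_congr rfl fun i hi => ?_
    obtain ⟨h1, h2⟩ := hE.1 i hi
    rw [h h1, h h2]
  rw [he]
  exact hf E hE hlt

lemma MemW.memLp_wDeriv {k : ℕ} {φ : ℝ → ℝ} (hφ : MemW (k + 1) φ) :
    MemLp (wDeriv k φ) 2 (volume.restrict (Set.Ioc 0 1)) := by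
  obtain ⟨-, h2, h3⟩ := hφ
  rw [Measure.restrict_congr_set Ioc_ae_eq_Icc]
  refine h3.add ?_
  have hc : ContinuousOn (iteratedDerivWithin k φ (Set.Icc 0 1)) (Set.Icc 0 1) := by
    have := h2.continuousOn
    rwa [Set.uIcc_of_le zero_le_one] at this
  exact memLp_two_of_continuousOn hc

/-- Integration by parts, valid for the absolutely continuous φ^{(k)}, combined with (D + 1) `green
k` = Taylor kernel: the terms with `green k` times φ^{(k)} cancel and only the Taylor kernel is
left. -/
lemma integral_green_mul_wDeriv {k : ℕ} {φ : ℝ → ℝ} (hφ : MemW (k + 1) φ) {x : ℝ}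
    (hx : x ∈ Set.Icc (0 : ℝ) 1) : ∫ t in (0 : ℝ)..x, green k (x - t) * wDeriv k φ t =
      green k 0 * iteratedDerivWithin k φ (Set.Icc 0 1) x -
        green k x * iteratedDerivWithin k φ (Set.Icc 0 1) 0 +
      ∫ t in (0 : ℝ)..x, (if k = 0 then 0 else (x - t) ^ (k - 1) / ((k - 1).factorial : ℝ)) *
        iteratedDerivWithin k φ (Set.Icc 0 1) t := by
  obtain ⟨-, h2, -⟩ := hφ
  set F := iteratedDerivWithin k φ (Set.Icc 0 1) with hF
  have hFx : AbsolutelyContinuousOnInterval F 0 x := h2.mono (by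
    rw [Set.uIcc_of_le hx.1, Set.uIcc_of_le zero_le_one]
    exact Set.Icc_subset_Icc_right hx.2)
  have hg : AbsolutelyContinuousOnInterval (fun t => green k (x - t)) 0 x := by
    apply ContDiffOn.absolutelyContinuousOnInterval
    exact ((contDiff_green k).comp (contDiff_const.sub contDiff_id)).contDiffOn
  have hd : ∀ t, deriv (fun t => green k (x - t)) t =
      green k (x - t) - if k = 0 then 0 else (x - t) ^ (k - 1) / ((k - 1).factorial : ℝ) := by
    intro t
    have := (hasDerivAt_green_self k (x - t)).comp t ((hasDerivAt_id t).const_sub x)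
    have h' := this.deriv
    simp only [Function.comp_def] at h'
    rw [h']
    ring
  have hparts := hg.integral_mul_deriv_eq_deriv_mul hFx
  simp only [sub_self, sub_zero] at hparts
  have e1 : ∫ t in (0 : ℝ)..x, green k (x - t) * wDeriv k φ t =
      ∫ t in (0 : ℝ)..x, (green k (x - t) * deriv F t + green k (x - t) * F t) := by
    -- The derivative within [0, 1] is the ordinary one except possibly at the end point 1, a null
    -- set.
    refine intervalIntegral.integral_congr_ae ?_
    filter_upwards [compl_mem_ae_iff.2 (measure_singleton (1 : ℝ))] with t ht1 ht
    rw [Set.uIoc_of_le hx.1] at ht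
    have ht' : t < 1 := lt_of_le_of_ne (ht.2.trans hx.2) ht1
    rw [wDeriv, ← hF, iteratedDerivWithin_succ, ← hF,
      derivWithin_of_mem_nhds (Icc_mem_nhds ht.1 ht')]
    ring
  have hc1 : ContinuousOn (fun t => green k (x - t)) (Set.uIcc 0 x) :=
    ((contDiff_green (n := 0) k).continuous.comp (by fun_prop)).continuousOn
  have i1 : IntervalIntegrable (fun t => green k (x - t) * deriv F t) volume 0 x :=
    hFx.intervalIntegrable_deriv.continuousOn_mul hc1
  have i2 : IntervalIntegrable (fun t => green k (x - t) * F t) volume 0 x :=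
    (hc1.mul hFx.continuousOn).intervalIntegrable
  have i3 : IntervalIntegrable (fun t =>
      (if k = 0 then 0 else (x - t) ^ (k - 1) / ((k - 1).factorial : ℝ)) * F t) volume 0 x := by
    refine (ContinuousOn.mul ?_ hFx.continuousOn).intervalIntegrable
    split_ifs <;> fun_prop
  rw [e1, intervalIntegral.integral_add i1 i2, hparts]
  simp only [hd, sub_mul]
  rw [intervalIntegral.integral_sub i2 i3]
  ring

/-- Functions in `W_2^{(m,m-1)}(0,1)` are determined by `φ^{(m)} + φ^{(m-1)}` up to the kernel. -/
theorem MemW.exists_repr {k : ℕ} {φ : ℝ → ℝ} (hφ : MemW (k + 1) φ) :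
    ∃ q ∈ Polynomial.degreeLT ℝ k, ∃ b : ℝ, ∀ x ∈ Set.Icc (0 : ℝ) 1, φ x = expPoly 0 q b x +
      ∫ t in (0 : ℝ)..x, green k (x - t) * wDeriv k φ t := by
  obtain ⟨q₁, hq₁, b₁, hb₁⟩ := green_sub_eq k 0
  simp only [sub_zero] at hb₁
  set F := iteratedDerivWithin k φ (Set.Icc 0 1) with hF
  -- For k = 0 the boundary term at x is φ(x) itself, since `green 0 0` is 1. For k > 0 that term
  -- vanishes and the remaining integral is the Taylor remainder of φ.
  rcases Nat.eq_zero_or_pos k with rfl | hk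
  · refine ⟨F 0 • q₁, Submodule.smul_mem _ _ hq₁, F 0 * b₁, fun x hx => ?_⟩
    rw [integral_green_mul_wDeriv hφ hx, ← hF, hb₁ x]
    have e : F x = φ x := by rw [hF, iteratedDerivWithin_zero]
    have := expPoly_smul (F 0) 0 q₁ b₁ x
    rw [mul_zero] at this
    rw [← this]
    simp [e]
    ring
  · obtain ⟨j, rfl⟩ : ∃ j, k = j + 1 := ⟨k - 1, by omega⟩
    obtain ⟨q₂, hq₂, hq⟩ := exists_taylor hφ.1
    refine ⟨F 0 • q₁ + q₂, Submodule.add_mem _ (Submodule.smul_mem _ _ hq₁) hq₂, F 0 * b₁,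
      fun x hx => ?_⟩
    rw [integral_green_mul_wDeriv hφ hx, ← hF, hb₁ x, hq x hx]
    simp only [green_succ_zero, Nat.succ_ne_zero, if_false, Nat.add_sub_cancel, ← hF]
    simp only [expPoly, Polynomial.eval_add, Polynomial.eval_smul, smul_eq_mul]
    ring

lemma exists_contDiff_iteratedDeriv_eq {f : ℝ → ℝ} (hf : Continuous f) (k : ℕ) :
    ∃ F : ℝ → ℝ, ContDiff ℝ k F ∧ iteratedDeriv k F = f := by
  induction k with
  | zero => exact ⟨f, by simpa using hf, iteratedDeriv_zero⟩
  | succ k ih =>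
    obtain ⟨G, hG, hGf⟩ := ih
    have hd : ∀ x, HasDerivAt (fun x => ∫ t in (0 : ℝ)..x, G t) (G x) x := fun x =>
      intervalIntegral.integral_hasDerivAt_right (hG.continuous.intervalIntegrable _ _)
        hG.continuous.stronglyMeasurable.stronglyMeasurableAtFilter hG.continuous.continuousAt
    have hd' : deriv (fun x => ∫ t in (0 : ℝ)..x, G t) = G := funext fun x => (hd x).deriv
    refine ⟨fun x => ∫ t in (0 : ℝ)..x, G t, ?_, ?_⟩
    · rw [Nat.cast_add, Nat.cast_one, contDiff_succ_iff_deriv]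
      refine ⟨fun x => (hd x).differentiableAt, fun h => by simp at h, by rwa [hd']⟩
    · rw [iteratedDeriv_succ', hd', hGf]

/-- Every square integrable function is `φ^{(m)} + φ^{(m-1)}` for some `φ`. -/
theorem exists_memW {k : ℕ} {v : ℝ → ℝ} (hv : MemLp v 2 (volume.restrict (Set.Ioc 0 1))) :
    ∃ φ, MemW (k + 1) φ ∧ wDeriv k φ =ᵐ[volume.restrict (Set.Ioc 0 1)] v := by
  have hvi : IntegrableOn v (Set.Ioc 0 1) := hv.integrable (by norm_num)
  set V : ℝ → ℝ := Set.indicator (Set.Ioc 0 1) v with hV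
  have hVi : Integrable V := (integrable_indicator_iff measurableSet_Ioc).2 hvi
  have hEi : ∀ a b, IntervalIntegrable (fun t => Real.exp t * V t) volume a b := fun a b =>
    hVi.intervalIntegrable.continuousOn_mul Real.continuous_exp.continuousOn
  -- Variation of constants: f = e^{-x} W solves f' + f = v almost everywhere, and φ is a k-fold
  -- primitive of f.
  set W : ℝ → ℝ := fun x => ∫ t in (0 : ℝ)..x, Real.exp t * V t with hW
  have hWc : Continuous W := intervalIntegral.continuous_primitive hEi 0
  set f : ℝ → ℝ := fun x => Real.exp (-x) * W x with hf
  have hfc : Continuous f := (Real.continuous_exp.comp continuous_neg).mul hWc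
  obtain ⟨φ, hφ, hφf⟩ := exists_contDiff_iteratedDeriv_eq hfc k
  have hI : ∀ x ∈ Set.Icc (0 : ℝ) 1, iteratedDerivWithin k φ (Set.Icc 0 1) x = f x := fun x hx => by
    rw [iteratedDerivWithin_eq_iteratedDeriv (uniqueDiffOn_Icc zero_lt_one) hφ.contDiffAt hx, hφf]
  have hac : AbsolutelyContinuousOnInterval f 0 1 := by
    refine AbsolutelyContinuousOnInterval.mul ?_
      ((hEi 0 1).absolutelyContinuousOnInterval_intervalIntegral (by simp))
    apply ContDiffOn.absolutelyContinuousOnInterval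
    exact (Real.contDiff_exp.comp contDiff_neg).contDiffOn
  have hderiv : ∀ᵐ x ∂(volume.restrict (Set.Ioc (0 : ℝ) 1)),
      iteratedDerivWithin (k + 1) φ (Set.Icc 0 1) x = v x - f x := by
    rw [ae_restrict_iff' measurableSet_Ioc]
    filter_upwards [(hEi 0 1).ae_hasDerivAt_integral, compl_mem_ae_iff.2 (measure_singleton (1 : ℝ))]
      with x hx hx1 hx01
    have hx' : x < 1 := lt_of_le_of_ne hx01.2 hx1
    have hxI : x ∈ Set.Icc (0 : ℝ) 1 := ⟨hx01.1.le, hx01.2⟩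
    have h1 : HasDerivAt W (Real.exp x * V x) x := hx (by simpa using hxI) 0 (by simp)
    have h2 := ((hasDerivAt_neg x).exp).mul h1
    have h3 : HasDerivAt f (v x - f x) x := by
      refine h2.congr_deriv ?_
      rw [hV, Set.indicator_of_mem hx01, ← mul_assoc, ← Real.exp_add, hf]
      simp
      ring
    rw [iteratedDerivWithin_succ, derivWithin_congr hI (hI x hxI)]
    exact h3.hasDerivWithinAt.derivWithin (uniqueDiffOn_Icc zero_lt_one x hxI)
  have hfL : MemLp f 2 (volume.restrict (Set.Ioc 0 1)) := by
    rw [Measure.restrict_congr_set Ioc_ae_eq_Icc]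
    exact memLp_two_of_continuousOn hfc.continuousOn
  refine ⟨φ, ⟨hφ.contDiffOn, ?_, ?_⟩, ?_⟩
  · rw [Nat.add_sub_cancel]
    refine absolutelyContinuousOnInterval_congr hac fun x hx => hI x ?_
    rwa [Set.uIcc_of_le zero_le_one] at hx
  · rw [← Measure.restrict_congr_set Ioc_ae_eq_Icc]
    exact (hv.sub hfL).ae_eq (hderiv.mono fun x hx => hx.symm)
  · rw [Filter.EventuallyEq, ae_restrict_iff' measurableSet_Ioc] at *
    filter_upwards [hderiv] with x hx hx01
    rw [wDeriv, hx hx01, hI x ⟨hx01.1.le, hx01.2⟩]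
    ring

end OptimalQuadrature

namespace OptimalQuadrature

/-! ### The error functional -/

/-- Lebesgue measure on `(0,1]`. -/
noncomputable abbrev unitMeasure : Measure ℝ := volume.restrict (Set.Ioc 0 1)

lemma quadError_eq (N : ℕ) (p : ℝ → ℝ) (c : Fin (N + 1) → ℝ) (φ : ℝ → ℝ) :
    quadError N p c φ = (∫ x, p x * φ x ∂unitMeasure) -
      ∑ β : Fin (N + 1), c β * φ (grid N (β : ℕ)) := by
  rw [quadError, intervalIntegral.integral_of_le zero_le_one]

lemma grid_mem_Icc {N : ℕ} (hN : 1 ≤ N) (β : Fin (N + 1)) :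
    grid N ((β : ℕ) : ℤ) ∈ Set.Icc (0 : ℝ) 1 :=
  ⟨grid_nonneg N β, grid_le_one hN (Nat.lt_succ_iff.1 β.2)⟩

lemma quadError_congr {N : ℕ} (hN : 1 ≤ N) (p : ℝ → ℝ) (c : Fin (N + 1) → ℝ) {φ χ : ℝ → ℝ}
    (h : Set.EqOn φ χ (Set.Icc 0 1)) : quadError N p c φ = quadError N p c χ := by
  rw [quadError_eq, quadError_eq]
  congr 1
  · refine setIntegral_congr_fun measurableSet_Ioc fun x hx => ?_
    simp only [h ⟨hx.1.le, hx.2⟩]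
  · exact Finset.sum_congr rfl fun β _ => by rw [h (grid_mem_Icc hN β)]

lemma integrable_mul_of_continuousOn {p f : ℝ → ℝ} (hp : IntegrableOn p (Set.Icc 0 1))
    (hf : ContinuousOn f (Set.Icc 0 1)) : Integrable (fun x => p x * f x) unitMeasure := by
  have : IntegrableOn (fun x => p x * f x) (Set.Icc 0 1) := hp.mul_continuousOn hf isCompact_Icc
  exact this.mono_set Set.Ioc_subset_Icc_self

lemma quadError_add {N : ℕ} {p : ℝ → ℝ} (hp : IntegrableOn p (Set.Icc 0 1))
    (c : Fin (N + 1) → ℝ) {φ χ : ℝ → ℝ} (hφ : ContinuousOn φ (Set.Icc 0 1))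
    (hχ : ContinuousOn χ (Set.Icc 0 1)) :
    quadError N p c (fun x => φ x + χ x) = quadError N p c φ + quadError N p c χ := by
  simp only [quadError_eq, mul_add]
  rw [integral_add (integrable_mul_of_continuousOn hp hφ) (integrable_mul_of_continuousOn hp hχ),
    Finset.sum_add_distrib]
  ring

lemma quadError_const_mul (N : ℕ) (p : ℝ → ℝ) (c : Fin (N + 1) → ℝ) (a : ℝ) (φ : ℝ → ℝ) :
    quadError N p c (fun x => a * φ x) = a * quadError N p c φ := by
  simp only [quadError_eq, mul_sub, ← integral_const_mul, Finset.mul_sum]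
  congr 1
  · exact integral_congr_ae (Filter.Eventually.of_forall fun x => by ring)
  · exact Finset.sum_congr rfl fun β _ => by ring

lemma quadError_finset_sum {N : ℕ} {p : ℝ → ℝ} (hp : IntegrableOn p (Set.Icc 0 1))
    (c : Fin (N + 1) → ℝ) {ι : Type*} (s : Finset ι) (a : ι → ℝ) {φ : ι → ℝ → ℝ}
    (hφ : ∀ i, ContinuousOn (φ i) (Set.Icc 0 1)) :
    quadError N p c (fun x => ∑ i ∈ s, a i * φ i x) = ∑ i ∈ s, a i * quadError N p c (φ i) := by
  classical
  induction s using Finset.induction_on with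
  | empty => simp [quadError_eq]
  | insert i s hi ih =>
    simp only [Finset.sum_insert hi]
    rw [quadError_add hp c (φ := fun x => a i * φ i x) (χ := fun x => ∑ i ∈ s, a i * φ i x)
      (continuousOn_const.mul (hφ i)) (continuousOn_finsetSum _ fun j _ => continuousOn_const.mul (hφ j)), quadError_const_mul, ih]

lemma continuous_expPoly (A : ℝ) (q : ℝ[X]) (B : ℝ) : Continuous (expPoly A q B) := by
  unfold expPoly
  fun_prop

/-- The formula is exact on the kernel of the seminorm. -/
def IsExact (k N : ℕ) (p : ℝ → ℝ) (c : Fin (N + 1) → ℝ) : Prop :=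
  (∀ α < k, ∑ γ : Fin (N + 1), c γ * grid N (γ : ℕ) ^ α = moment p α) ∧
    ∑ γ : Fin (N + 1), c γ * Real.exp (-grid N (γ : ℕ)) = expMoment p

lemma isExact_iff {k N : ℕ} {p : ℝ → ℝ} (hp : IntegrableOn p (Set.Icc 0 1))
    {c : Fin (N + 1) → ℝ} : IsExact k N p c ↔
      ∀ q ∈ Polynomial.degreeLT ℝ k, ∀ b : ℝ, quadError N p c (expPoly 0 q b) = 0 := by
  constructor
  · rintro ⟨h1, h2⟩ q hq b
    have e : expPoly 0 q b = fun x => (∑ j ∈ Finset.range k, q.coeff j * x ^ j) +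
        b * Real.exp (-x) := by
      ext x
      rw [expPoly, zero_mul, zero_add]
      congr 1
      rcases Nat.eq_zero_or_pos k with rfl | hk
      · have : q = 0 := Polynomial.ext (by simpa [Polynomial.degreeLT] using hq)
        simp [this]
      · refine Polynomial.eval_eq_sum_range' ?_ x
        rw [Polynomial.mem_degreeLT] at hq
        rcases eq_or_ne q 0 with rfl | h0
        · simpa using hk
        · exact (Polynomial.natDegree_lt_iff_degree_lt h0).2 hq
    rw [e, quadError_add hp c (by fun_prop) (by fun_prop), quadError_const_mul,
      quadError_finset_sum hp c (φ := fun j x => x ^ j) _ _ (fun j => by fun_prop)]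
    have e1 : quadError N p c (fun x => Real.exp (-x)) = 0 := by
      rw [quadError, h2, expMoment, sub_self]
    rw [e1, Finset.sum_eq_zero, mul_zero, add_zero]
    intro j hj
    rw [quadError, h1 j (Finset.mem_range.1 hj), moment, sub_self, mul_zero]
  · intro h
    refine ⟨fun α hα => ?_, ?_⟩
    · have h1 := h (Polynomial.X ^ α) (Polynomial.mem_degreeLT.2 (by
        rw [Polynomial.degree_X_pow]; exact_mod_cast hα)) 0
      have e : expPoly 0 (Polynomial.X ^ α) 0 = fun x => x ^ α := by ext x; simp [expPoly]
      rw [e, quadError] at h1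
      exact (sub_eq_zero.1 h1).symm
    · have h1 := h 0 (Submodule.zero_mem _) 1
      have e : expPoly 0 0 1 = fun x => Real.exp (-x) := by ext x; simp [expPoly]
      rw [e, quadError] at h1
      exact (sub_eq_zero.1 h1).symm

/-! ### Boundedness of the error functional forces exactness on the kernel -/

lemma iteratedDeriv_expPoly (q : ℝ[X]) (b : ℝ) (n : ℕ) :
    iteratedDeriv n (expPoly 0 q b) = expPoly 0 (Polynomial.derivative^[n] q) ((-1) ^ n * b) := by
  induction n with
  | zero => simp [iteratedDeriv_zero]
  | succ n ih =>
    rw [iteratedDeriv_succ, ih]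
    ext x
    have e : ∀ q b, expPoly 0 q b = fun x => q.eval x + b * Real.exp (-x) := fun q b => by
      ext x; simp [expPoly]
    have h1 := ((Polynomial.derivative^[n] q).hasDerivAt x).fun_add
      ((hasDerivAt_neg x).exp.const_mul ((-1) ^ n * b))
    rw [e, h1.deriv, e, Function.iterate_succ_apply']
    ring

lemma contDiff_expPoly (q : ℝ[X]) (b : ℝ) {n : WithTop ℕ∞} : ContDiff ℝ n (expPoly 0 q b) := by
  unfold expPoly
  have : ContDiff ℝ n fun x => q.eval x := by
    have h := Polynomial.contDiff_aeval (𝕜 := ℝ) q n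
    simp only [Polynomial.coe_aeval_eq_eval] at h
    exact h
  fun_prop

lemma memW_expPoly (k : ℕ) (q : ℝ[X]) (b : ℝ) : MemW (k + 1) (expPoly 0 q b) := by
  have hI : ∀ n : ℕ, Set.EqOn (iteratedDerivWithin n (expPoly 0 q b) (Set.Icc 0 1))
      (iteratedDeriv n (expPoly 0 q b)) (Set.Icc 0 1) := fun n x hx =>
    iteratedDerivWithin_eq_iteratedDeriv (uniqueDiffOn_Icc zero_lt_one)
      (contDiff_expPoly q b).contDiffAt hx
  refine ⟨(contDiff_expPoly q b).contDiffOn, ?_, ?_⟩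
  · refine absolutelyContinuousOnInterval_congr (f := iteratedDeriv k (expPoly 0 q b)) ?_ ?_
    · rw [iteratedDeriv_expPoly]
      exact (contDiff_expPoly _ _).contDiffOn.absolutelyContinuousOnInterval
    · rw [Set.uIcc_of_le zero_le_one]; exact hI k
  · refine memLp_two_of_continuousOn (ContinuousOn.congr ?_ (hI _))
    rw [iteratedDeriv_expPoly]
    exact (continuous_expPoly _ _ _).continuousOn

lemma wDeriv_expPoly (k : ℕ) (q : ℝ[X]) (b : ℝ) {x : ℝ} (hx : x ∈ Set.Icc (0 : ℝ) 1) :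
    wDeriv k (expPoly 0 q b) x =
      (Polynomial.derivative^[k + 1] q).eval x + (Polynomial.derivative^[k] q).eval x := by
  have hI : ∀ n : ℕ, iteratedDerivWithin n (expPoly 0 q b) (Set.Icc 0 1) x =
      iteratedDeriv n (expPoly 0 q b) x := fun n =>
    iteratedDerivWithin_eq_iteratedDeriv (uniqueDiffOn_Icc zero_lt_one)
      (contDiff_expPoly q b).contDiffAt hx
  rw [wDeriv, hI, hI, iteratedDeriv_expPoly, iteratedDeriv_expPoly, expPoly, expPoly, pow_succ]
  ring

lemma wNorm_expPoly_eq_one {k : ℕ} {q : ℝ[X]} (hq : Polynomial.derivative^[k] q = 1) (b : ℝ) :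
    wNorm (k + 1) (expPoly 0 q b) = 1 := by
  have h1 : ∫ x in (0 : ℝ)..1, wDeriv k (expPoly 0 q b) x ^ 2 = ∫ x in (0 : ℝ)..1, (1 : ℝ) := by
    refine intervalIntegral.integral_congr fun x hx => ?_
    rw [Set.uIcc_of_le zero_le_one] at hx
    simp only [wDeriv_expPoly k q b hx, Function.iterate_succ_apply', hq]
    simp
  rw [wNorm_eq, h1]
  simp

lemma le_errNorm (m N : ℕ) (p : ℝ → ℝ) (c : Fin (N + 1) → ℝ) {φ : ℝ → ℝ} (h1 : MemW m φ)
    (h2 : wNorm m φ = 1) : ENNReal.ofReal |quadError N p c φ| ≤ errNorm m N p c :=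
  le_iSup_of_le φ (le_iSup_of_le h1 (le_iSup_of_le h2 le_rfl))

theorem isExact_of_errNorm_ne_top {k N : ℕ} {p : ℝ → ℝ} (hp : IntegrableOn p (Set.Icc 0 1))
    {c : Fin (N + 1) → ℝ} (h : errNorm (k + 1) N p c ≠ ⊤) : IsExact k N p c := by
  rw [isExact_iff hp]
  intro q hq b
  -- x^k/k! has seminorm 1, and adding any multiple of a kernel element keeps the seminorm while
  -- changing the error affinely.
  set q₀ : ℝ[X] := Polynomial.C (1 / (k.factorial : ℝ)) * Polynomial.X ^ k with hq₀
  have hd₀ : Polynomial.derivative^[k] q₀ = 1 := by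
    have : (k.factorial : ℝ) ≠ 0 := by positivity
    rw [hq₀, Polynomial.iterate_derivative_C_mul, Polynomial.iterate_derivative_X_pow_eq_smul,
      Nat.descFactorial_self, Nat.sub_self, pow_zero, Polynomial.smul_eq_C_mul, mul_one,
      ← map_mul, one_div, inv_mul_cancel₀ this, map_one]
  have hd : Polynomial.derivative^[k] q = 0 := by
    rcases eq_or_ne q 0 with rfl | h0
    · simp
    · exact Polynomial.iterate_derivative_eq_zero
        ((Polynomial.natDegree_lt_iff_degree_lt h0).2 (Polynomial.mem_degreeLT.1 hq))
  have hb : ∀ s : ℝ, |quadError N p c (expPoly 0 q₀ 0) + s * quadError N p c (expPoly 0 q b)| ≤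
      (errNorm (k + 1) N p c).toReal := by
    intro s
    have hds : Polynomial.derivative^[k] (q₀ + s • q) = 1 := by
      rw [iterate_map_add, Polynomial.iterate_derivative_smul, hd₀, hd]
      simp
    have h1 := le_errNorm (k + 1) N p c (memW_expPoly k (q₀ + s • q) (0 + s * b))
      (wNorm_expPoly_eq_one hds _)
    have e : expPoly 0 (q₀ + s • q) (0 + s * b) =
        fun x => expPoly 0 q₀ 0 x + s * expPoly 0 q b x := by
      ext x
      rw [expPoly_smul, expPoly_add]
      simp
    rw [e, quadError_add hp c (χ := fun x => s * expPoly 0 q b x)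
      (continuous_expPoly _ _ _).continuousOn
      ((continuous_expPoly _ _ _).const_smul s).continuousOn, quadError_const_mul] at h1
    exact (ENNReal.ofReal_le_iff_le_toReal h).1 h1
  by_contra he
  set e₀ := quadError N p c (expPoly 0 q₀ 0)
  set e := quadError N p c (expPoly 0 q b)
  set R := (errNorm (k + 1) N p c).toReal
  -- If the error on the kernel element were nonzero, this multiple would make the total error R +
  -- 1, exceeding the norm R.
  have h1 := hb ((R + 1 - e₀) / e)
  rw [div_mul_cancel₀ _ he, add_sub_cancel] at h1
  have := le_abs_self (R + 1)
  linarith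

/-! ### The kernel of the error functional -/

/-- The Green function of the initial value problem. -/
noncomputable def truncGreen (k : ℕ) (x t : ℝ) : ℝ := if t ≤ x then green k (x - t) else 0

lemma measurable_truncGreen (k : ℕ) : Measurable (Function.uncurry (truncGreen k)) := by
  refine Measurable.ite (measurableSet_le measurable_snd measurable_fst) ?_ measurable_const
  exact (continuous_green k).measurable.comp (measurable_fst.sub measurable_snd)

lemma abs_green_le (k : ℕ) (x : ℝ) : |green k x| ≤ 2 * Real.exp |x| := by
  rw [green, abs_mul, abs_pow, abs_neg, abs_one, one_pow, one_mul]
  simpa using abs_expRem_le k (-x)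

lemma abs_green_sub_le (k : ℕ) {x t : ℝ} (hx : x ∈ Set.Icc (0 : ℝ) 1) (ht : t ∈ Set.Ioc (0 : ℝ) 1) :
    |green k (x - t)| ≤ 2 * Real.exp 1 := by
  refine (abs_green_le k _).trans ?_
  have : |x - t| ≤ 1 := by rw [abs_le]; constructor <;> linarith [hx.1, hx.2, ht.1, ht.2]
  gcongr

lemma abs_truncGreen_le (k : ℕ) {x t : ℝ} (hx : x ∈ Set.Icc (0 : ℝ) 1)
    (ht : t ∈ Set.Ioc (0 : ℝ) 1) : |truncGreen k x t| ≤ 2 * Real.exp 1 := by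
  rw [truncGreen]
  split_ifs
  · exact abs_green_sub_le k hx ht
  · rw [abs_zero]; positivity

lemma integral_truncGreen_mul (k : ℕ) {x : ℝ} (hx : x ∈ Set.Icc (0 : ℝ) 1) (g : ℝ → ℝ) :
    ∫ t, truncGreen k x t * g t ∂unitMeasure = ∫ t in (0 : ℝ)..x, green k (x - t) * g t := by
  have e : ∀ t, truncGreen k x t * g t =
      Set.indicator (Set.Iic x) (fun t => green k (x - t) * g t) t := by
    intro t
    by_cases h : t ≤ x
    · rw [truncGreen, if_pos h, Set.indicator_of_mem (Set.mem_Iic.2 h)]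
    · rw [truncGreen, if_neg h, Set.indicator_of_notMem (by simpa using h), zero_mul]
  simp only [e]
  rw [integral_indicator measurableSet_Iic, Measure.restrict_restrict measurableSet_Iic,
    intervalIntegral.integral_of_le hx.1]
  congr 2
  ext t
  simp only [Set.mem_inter_iff, Set.mem_Iic, Set.mem_Ioc]
  constructor
  · rintro ⟨h1, h2, h3⟩; exact ⟨h2, h1⟩
  · rintro ⟨h1, h2⟩; exact ⟨h2, h1, h2.trans hx.2⟩

lemma integrable_kernel {p : ℝ → ℝ} (hp : IntegrableOn p (Set.Icc 0 1)) {H : ℝ → ℝ → ℝ}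
    (hH : Measurable (Function.uncurry H)) {C : ℝ}
    (hC : ∀ x ∈ Set.Icc (0 : ℝ) 1, ∀ t ∈ Set.Ioc (0 : ℝ) 1, |H x t| ≤ C) {g : ℝ → ℝ}
    (hg : Integrable g unitMeasure) :
    Integrable (Function.uncurry fun x t => p x * (H x t * g t))
      (unitMeasure.prod unitMeasure) := by
  have hp' : Integrable p unitMeasure := hp.mono_set Set.Ioc_subset_Icc_self
  have h1 : Integrable (fun z : ℝ × ℝ => Function.uncurry H z * (p z.1 * g z.2))
      (unitMeasure.prod unitMeasure) := by
    refine (hp'.mul_prod hg).bdd_mul (c := C) hH.aestronglyMeasurable ?_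
    rw [Measure.prod_restrict, ae_restrict_iff' (measurableSet_Ioc.prod measurableSet_Ioc)]
    exact Filter.Eventually.of_forall fun z hz => hC z.1 ⟨hz.1.1.le, hz.1.2⟩ z.2 hz.2
  refine h1.congr (Filter.Eventually.of_forall fun z => ?_)
  simp only [Function.uncurry]
  ring

lemma integrable_kernel_right {H : ℝ → ℝ → ℝ} (hH : Measurable (Function.uncurry H)) {C : ℝ}
    (hC : ∀ x ∈ Set.Icc (0 : ℝ) 1, ∀ t ∈ Set.Ioc (0 : ℝ) 1, |H x t| ≤ C) {g : ℝ → ℝ}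
    (hg : Integrable g unitMeasure) {x : ℝ} (hx : x ∈ Set.Icc (0 : ℝ) 1) :
    Integrable (fun t => H x t * g t) unitMeasure := by
  refine hg.bdd_mul (c := C) (hH.comp measurable_prodMk_left).aestronglyMeasurable ?_
  rw [ae_restrict_iff' measurableSet_Ioc]
  exact Filter.Eventually.of_forall fun t ht => hC x hx t ht

/-- The error functional commutes with integration against a bounded kernel. -/
lemma quadError_integral {N : ℕ} (hN : 1 ≤ N) {p : ℝ → ℝ} (hp : IntegrableOn p (Set.Icc 0 1))
    (c : Fin (N + 1) → ℝ) {H : ℝ → ℝ → ℝ} (hH : Measurable (Function.uncurry H)) {C : ℝ}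
    (hC : ∀ x ∈ Set.Icc (0 : ℝ) 1, ∀ t ∈ Set.Ioc (0 : ℝ) 1, |H x t| ≤ C) {g : ℝ → ℝ}
    (hg : Integrable g unitMeasure) :
    quadError N p c (fun x => ∫ t, H x t * g t ∂unitMeasure) =
      ∫ t, quadError N p c (fun x => H x t) * g t ∂unitMeasure := by
  have hi := integrable_kernel hp hH hC hg
  have h1 : ∫ x, p x * ∫ t, H x t * g t ∂unitMeasure ∂unitMeasure =
      ∫ t, (∫ x, p x * H x t ∂unitMeasure) * g t ∂unitMeasure := by
    simp only [← integral_const_mul]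
    rw [integral_integral_swap hi]
    refine integral_congr_ae (Filter.Eventually.of_forall fun t => ?_)
    simp only [← integral_mul_const, mul_assoc]
  have h2 : Integrable (fun t => (∫ x, p x * H x t ∂unitMeasure) * g t) unitMeasure := by
    refine hi.integral_prod_right.congr (Filter.Eventually.of_forall fun t => ?_)
    simp only [Function.uncurry, ← integral_mul_const, mul_assoc]
  have h3 : ∀ β : Fin (N + 1), Integrable (fun t => c β * (H (grid N (β : ℕ)) t * g t))
      unitMeasure := fun β =>
    (integrable_kernel_right hH hC hg (grid_mem_Icc hN β)).const_mul _
  simp only [quadError_eq, h1, sub_mul, Finset.sum_mul, mul_assoc]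
  rw [integral_sub h2 (integrable_finsetSum _ fun β _ => h3 β),
    integral_finsetSum _ fun β _ => h3 β]
  simp only [integral_const_mul]

/-- The kernel of the error functional. -/
noncomputable def errKernel (k N : ℕ) (p : ℝ → ℝ) (c : Fin (N + 1) → ℝ) (t : ℝ) : ℝ :=
  quadError N p c (fun x => truncGreen k x t)

lemma memLp_errKernel {N : ℕ} (hN : 1 ≤ N) (k : ℕ) {p : ℝ → ℝ} (hp : IntegrableOn p (Set.Icc 0 1))
    (c : Fin (N + 1) → ℝ) : MemLp (errKernel k N p c) 2 unitMeasure := by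
  have hH := measurable_truncGreen k
  have hC : ∀ x ∈ Set.Icc (0 : ℝ) 1, ∀ t ∈ Set.Ioc (0 : ℝ) 1, |truncGreen k x t| ≤ 2 * Real.exp 1 :=
    fun x hx t ht => abs_truncGreen_le k hx ht
  have hp' : Integrable p unitMeasure := hp.mono_set Set.Ioc_subset_Icc_self
  have hi := integrable_kernel hp hH hC (integrable_const (1 : ℝ))
  have hm : AEStronglyMeasurable (errKernel k N p c) unitMeasure := by
    have h1 : AEStronglyMeasurable (fun t => ∫ x, p x * truncGreen k x t ∂unitMeasure)
        unitMeasure := by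
      refine hi.integral_prod_right.aestronglyMeasurable.congr
        (Filter.Eventually.of_forall fun t => ?_)
      simp only [Function.uncurry, mul_one]
    have h2 : ∀ t, errKernel k N p c t = (∫ x, p x * truncGreen k x t ∂unitMeasure) -
        ∑ β : Fin (N + 1), c β * truncGreen k (grid N (β : ℕ)) t := fun t => quadError_eq _ _ _ _
    rw [funext h2]
    refine h1.sub (Measurable.aestronglyMeasurable ?_)
    exact Finset.measurable_sum _ fun β _ =>
      (hH.comp measurable_prodMk_left).const_mul _
  refine MemLp.of_bound hm ((∫ x, |p x| * (2 * Real.exp 1) ∂unitMeasure) +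
    ∑ β : Fin (N + 1), |c β| * (2 * Real.exp 1)) ?_
  rw [ae_restrict_iff' measurableSet_Ioc]
  refine Filter.Eventually.of_forall fun t ht => ?_
  rw [errKernel, quadError_eq]
  refine (norm_sub_le _ _).trans (add_le_add ?_ ?_)
  · refine norm_integral_le_of_norm_le (hp'.abs.mul_const _) ?_
    rw [ae_restrict_iff' measurableSet_Ioc]
    refine Filter.Eventually.of_forall fun x hx => ?_
    rw [norm_mul, Real.norm_eq_abs, Real.norm_eq_abs]
    exact mul_le_mul_of_nonneg_left (hC x ⟨hx.1.le, hx.2⟩ t ht) (abs_nonneg _)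
  · refine (norm_sum_le _ _).trans (Finset.sum_le_sum fun β _ => ?_)
    rw [norm_mul, Real.norm_eq_abs, Real.norm_eq_abs]
    exact mul_le_mul_of_nonneg_left (hC _ (grid_mem_Icc hN β) t ht) (abs_nonneg _)

/-- The error as an integral against the kernel. -/
lemma quadError_eq_integral {k N : ℕ} (hN : 1 ≤ N) {p : ℝ → ℝ}
    (hp : IntegrableOn p (Set.Icc 0 1)) {c : Fin (N + 1) → ℝ} (hc : IsExact k N p c) {φ : ℝ → ℝ}
    (hφ : MemW (k + 1) φ) :
    quadError N p c φ = ∫ t, errKernel k N p c t * wDeriv k φ t ∂unitMeasure := by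
  obtain ⟨q, hq, b, hrep⟩ := hφ.exists_repr
  have hφc : ContinuousOn φ (Set.Icc 0 1) := hφ.1.continuousOn
  have hwi : Integrable (wDeriv k φ) unitMeasure := hφ.memLp_wDeriv.integrable (by norm_num)
  have h1 : Set.EqOn (fun x => ∫ t, truncGreen k x t * wDeriv k φ t ∂unitMeasure)
      (fun x => φ x + -1 * expPoly 0 q b x) (Set.Icc 0 1) := fun x hx => by
    simp only []
    rw [integral_truncGreen_mul k hx, hrep x hx]
    ring
  have h2 := quadError_integral hN hp c (measurable_truncGreen k)
    (fun x hx t ht => abs_truncGreen_le k hx ht) hwi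
  rw [quadError_congr hN p c h1, quadError_add hp c
    (χ := fun x => -1 * expPoly 0 q b x) hφc
    ((continuous_expPoly _ _ _).const_smul (-1 : ℝ)).continuousOn, quadError_const_mul,
    (isExact_iff hp).1 hc q hq b, mul_zero, add_zero] at h2
  exact h2

lemma integrable_mul_of_memLp {f g : ℝ → ℝ} (hf : MemLp f 2 unitMeasure)
    (hg : MemLp g 2 unitMeasure) : Integrable (fun t => f t * g t) unitMeasure :=
  hf.integrable_mul hg

/-- The norm of the error functional is the `L²` norm of its kernel. -/
theorem errNorm_eq {k N : ℕ} (hN : 1 ≤ N) {p : ℝ → ℝ} (hp : IntegrableOn p (Set.Icc 0 1))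
    {c : Fin (N + 1) → ℝ} (hc : IsExact k N p c) : errNorm (k + 1) N p c =
      ENNReal.ofReal (Real.sqrt (∫ t, errKernel k N p c t ^ 2 ∂unitMeasure)) := by
  set K := errKernel k N p c with hK
  have hKL : MemLp K 2 unitMeasure := memLp_errKernel hN k hp c
  set J := ∫ t, K t ^ 2 ∂unitMeasure with hJ
  have hJ0 : 0 ≤ J := integral_nonneg fun t => sq_nonneg _
  refine le_antisymm (iSup_le fun φ => iSup_le fun hφ => iSup_le fun hn => ?_) ?_
  · rw [quadError_eq_integral hN hp hc hφ]
    have hwL := hφ.memLp_wDeriv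
    have hw1 : ∫ t, wDeriv k φ t ^ 2 ∂unitMeasure = 1 := by
      rw [wNorm_eq, intervalIntegral.integral_of_le zero_le_one, Real.sqrt_eq_one] at hn
      exact hn
    set s := ∫ t, K t * wDeriv k φ t ∂unitMeasure with hs
    -- Cauchy–Schwarz for a unit vector: subtracting the projection of K leaves the nonnegative
    -- square norm J - s².
    have h1 : 0 ≤ ∫ t, (K t - s * wDeriv k φ t) ^ 2 ∂unitMeasure :=
      integral_nonneg fun t => sq_nonneg _
    have h2 : ∫ t, (K t - s * wDeriv k φ t) ^ 2 ∂unitMeasure = J - s ^ 2 := by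
      have e : ∀ t, (K t - s * wDeriv k φ t) ^ 2 =
          K t ^ 2 - 2 * s * (K t * wDeriv k φ t) + s ^ 2 * wDeriv k φ t ^ 2 := fun t => by ring
      have i1 : Integrable (fun t => K t ^ 2 - 2 * s * (K t * wDeriv k φ t)) unitMeasure :=
        hKL.integrable_sq.sub ((integrable_mul_of_memLp hKL hwL).const_mul _)
      simp only [e]
      rw [integral_add i1 (hwL.integrable_sq.const_mul _), integral_sub hKL.integrable_sq
        ((integrable_mul_of_memLp hKL hwL).const_mul _), integral_const_mul, integral_const_mul,
        hw1, ← hJ, ← hs]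
      ring
    rw [h2] at h1
    refine ENNReal.ofReal_le_ofReal (Real.le_sqrt_of_sq_le ?_)
    rw [sq_abs]
    linarith
  · rcases hJ0.eq_or_lt with h0 | h0
    · rw [← h0]; simp
    · have hr := Real.sqrt_pos.2 h0
      have hrr := Real.sq_sqrt hJ0
      -- The extremal function is one whose φ^{(m)} + φ^{(m-1)} is the normalized kernel; it attains
      -- the norm.
      obtain ⟨φ, hφ, hφv⟩ := exists_memW (k := k) (hKL.const_mul (1 / Real.sqrt J))
      have hn : wNorm (k + 1) φ = 1 := by
        rw [wNorm_eq, intervalIntegral.integral_of_le zero_le_one, Real.sqrt_eq_one]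
        have : ∫ t, wDeriv k φ t ^ 2 ∂unitMeasure = ∫ t, (1 / J) * K t ^ 2 ∂unitMeasure := by
          refine integral_congr_ae (hφv.mono fun t ht => ?_)
          simp only [] at ht ⊢
          rw [ht, mul_pow, div_pow, one_pow, hrr]
        rw [this, integral_const_mul, ← hJ, one_div, inv_mul_cancel₀ h0.ne']
      refine le_trans (le_of_eq ?_) (le_errNorm (k + 1) N p c hφ hn)
      have : quadError N p c φ = Real.sqrt J := by
        rw [quadError_eq_integral hN hp hc hφ]
        have : ∫ t, K t * wDeriv k φ t ∂unitMeasure =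
            ∫ t, (1 / Real.sqrt J) * K t ^ 2 ∂unitMeasure := by
          refine integral_congr_ae (hφv.mono fun t ht => ?_)
          simp only [] at ht ⊢
          rw [ht]; ring
        rw [this, integral_const_mul, ← hJ]
        field_simp
        exact hrr.symm
      rw [this, abs_of_pos hr]

theorem isOptimal_iff {k N : ℕ} (hN : 1 ≤ N) {p : ℝ → ℝ} (hp : IntegrableOn p (Set.Icc 0 1))
    {c : Fin (N + 1) → ℝ} : IsOptimal (k + 1) N p c ↔ IsExact k N p c ∧
      ∀ c', IsExact k N p c' → ∫ t, errKernel k N p c t ^ 2 ∂unitMeasure ≤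
        ∫ t, errKernel k N p c' t ^ 2 ∂unitMeasure := by
  have hJ0 : ∀ c, 0 ≤ ∫ t, errKernel k N p c t ^ 2 ∂unitMeasure := fun c =>
    integral_nonneg fun t => sq_nonneg _
  constructor
  · rintro ⟨h1, h2⟩
    have hc := isExact_of_errNorm_ne_top hp h1
    refine ⟨hc, fun c' hc' => ?_⟩
    have := h2 c'
    rw [errNorm_eq hN hp hc, errNorm_eq hN hp hc',
      ENNReal.ofReal_le_ofReal_iff (Real.sqrt_nonneg _)] at this
    exact (Real.sqrt_le_sqrt_iff (hJ0 c')).1 this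
  · rintro ⟨hc, h⟩
    refine ⟨by rw [errNorm_eq hN hp hc]; exact ENNReal.ofReal_ne_top, fun c' => ?_⟩
    by_cases ht : errNorm (k + 1) N p c' = ⊤
    · rw [ht]; exact le_top
    · have hc' := isExact_of_errNorm_ne_top hp ht
      rw [errNorm_eq hN hp hc, errNorm_eq hN hp hc']
      exact ENNReal.ofReal_le_ofReal (Real.sqrt_le_sqrt (h c' hc'))

end OptimalQuadrature

namespace OptimalQuadrature

/-! ### Optimality and the linear system -/

/-- With s = x - t the second factor becomes (-1)^k `expRem k ((x - y) - s)`, so the integral is the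
convolution already computed, of total order 2k. -/
lemma integral_green_mul_green (k : ℕ) (x y : ℝ) :
    ∫ t in y..x, green k (x - t) * green k (y - t) = (-1) ^ k * primSinh (2 * k) (x - y) := by
  have h1 := intervalIntegral.integral_comp_sub_left (a := y) (b := x)
    (fun s => green k s * green k (s - (x - y))) x
  rw [sub_self] at h1
  rw [two_mul, ← integral_green_mul_expRem, ← intervalIntegral.integral_const_mul]
  have h2 : ∀ t, green k (x - t) * green k (y - t) =
      green k (x - t) * green k (x - t - (x - y)) := fun t => by
    rw [show x - t - (x - y) = y - t by ring]
  simp only [h2]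
  rw [h1]
  refine intervalIntegral.integral_congr fun s _ => ?_
  simp only [green, neg_sub]
  ring

/-- The product lives on [0, y]; twice its integral is the integral over [0, y] plus that over [0,
x] minus that over [y, x], and the last gives ψ_m. Each of the other two is, in one of its
variables, in the kernel of the seminorm and will be killed by exactness or annihilation. -/
lemma two_mul_integral_truncGreen_aux {k : ℕ} {x y : ℝ}
    (hy : y ∈ Set.Icc (0 : ℝ) 1) (hyx : y ≤ x) :
    2 * ∫ t, truncGreen k x t * truncGreen k y t ∂unitMeasure =
      2 * (-1) ^ (k + 1) * psi (k + 1) (x - y) +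
        ((∫ t in (0 : ℝ)..y, green k (x - t) * green k (y - t)) +
          ∫ t in (0 : ℝ)..x, green k (x - t) * green k (y - t)) := by
  have h1 : ∫ t, truncGreen k x t * truncGreen k y t ∂unitMeasure =
      ∫ t in (0 : ℝ)..y, green k (x - t) * green k (y - t) := by
    simp only [mul_comm (truncGreen k x _)]
    rw [integral_truncGreen_mul k hy]
    refine intervalIntegral.integral_congr fun t ht => ?_
    rw [Set.uIcc_of_le hy.1] at ht
    rw [truncGreen, if_pos (ht.2.trans hyx), mul_comm]
  have hc : Continuous fun t => green k (x - t) * green k (y - t) := by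
    have := continuous_green k
    fun_prop
  have h2 := intervalIntegral.integral_add_adjacent_intervals (μ := volume)
    (hc.intervalIntegrable 0 y) (hc.intervalIntegrable y x)
  rw [h1, ← h2, integral_green_mul_green, psi_of_nonneg k (sub_nonneg.2 hyx), pow_succ]
  ring

/-- The reproducing kernel in terms of `ψ_m`. -/
lemma two_mul_integral_truncGreen {k : ℕ} {x y : ℝ} (hx : x ∈ Set.Icc (0 : ℝ) 1)
    (hy : y ∈ Set.Icc (0 : ℝ) 1) :
    2 * ∫ t, truncGreen k x t * truncGreen k y t ∂unitMeasure =
      2 * (-1) ^ (k + 1) * psi (k + 1) (x - y) +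
        ((∫ t in (0 : ℝ)..y, green k (x - t) * green k (y - t)) +
          ∫ t in (0 : ℝ)..x, green k (x - t) * green k (y - t)) := by
  rcases le_total y x with h | h
  · exact two_mul_integral_truncGreen_aux hy h
  · have := two_mul_integral_truncGreen_aux (k := k) hx h
    rw [← psi_neg, neg_sub] at this
    simp only [mul_comm (green k (y - _)), mul_comm (truncGreen k y _)] at this
    rw [this]
    ring

/-- The kernel belonging to the nodes alone. -/
noncomputable def nodeKernel (k N : ℕ) (v : Fin (N + 1) → ℝ) (t : ℝ) : ℝ :=
  ∑ β : Fin (N + 1), v β * truncGreen k (grid N (β : ℕ)) t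

lemma memLp_nodeKernel {N : ℕ} (hN : 1 ≤ N) (k : ℕ) (v : Fin (N + 1) → ℝ) :
    MemLp (nodeKernel k N v) 2 unitMeasure := by
  refine MemLp.of_bound (C := ∑ β : Fin (N + 1), |v β| * (2 * Real.exp 1))
    (Measurable.aestronglyMeasurable ?_) ?_
  · exact Finset.measurable_sum _ fun β _ =>
      ((measurable_truncGreen k).comp measurable_prodMk_left).const_mul _
  · rw [ae_restrict_iff' measurableSet_Ioc]
    refine Filter.Eventually.of_forall fun t ht => ?_
    refine (norm_sum_le _ _).trans (Finset.sum_le_sum fun β _ => ?_)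
    rw [norm_mul, Real.norm_eq_abs, Real.norm_eq_abs]
    exact mul_le_mul_of_nonneg_left (abs_truncGreen_le k (grid_mem_Icc hN β) ht) (abs_nonneg _)

lemma errKernel_add (k N : ℕ) (p : ℝ → ℝ) (c v : Fin (N + 1) → ℝ) (s t : ℝ) :
    errKernel k N p (fun β => c β + s * v β) t = errKernel k N p c t - s * nodeKernel k N v t := by
  simp only [errKernel, quadError_eq, nodeKernel, add_mul, Finset.sum_add_distrib, Finset.mul_sum,
    mul_assoc]
  ring

/-- The coefficient vectors that annihilate the kernel of the seminorm on the nodes. -/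
def Annihilates (k N : ℕ) (v : Fin (N + 1) → ℝ) : Prop :=
  ∀ q ∈ Polynomial.degreeLT ℝ k, ∀ b : ℝ,
    ∑ β : Fin (N + 1), v β * expPoly 0 q b (grid N (β : ℕ)) = 0

lemma quadError_add_coef (N : ℕ) (p : ℝ → ℝ) (c v : Fin (N + 1) → ℝ) (s : ℝ) (φ : ℝ → ℝ) :
    quadError N p (fun β => c β + s * v β) φ =
      quadError N p c φ - s * ∑ β : Fin (N + 1), v β * φ (grid N (β : ℕ)) := by
  simp only [quadError_eq, add_mul, Finset.sum_add_distrib, Finset.mul_sum, mul_assoc]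
  ring

lemma IsExact.add {k N : ℕ} {p : ℝ → ℝ} (hp : IntegrableOn p (Set.Icc 0 1))
    {c v : Fin (N + 1) → ℝ} (hc : IsExact k N p c) (hv : Annihilates k N v) (s : ℝ) :
    IsExact k N p fun β => c β + s * v β := by
  rw [isExact_iff hp] at hc ⊢
  intro q hq b
  rw [quadError_add_coef, hc q hq b, hv q hq b]
  simp

lemma IsExact.annihilates_sub {k N : ℕ} {p : ℝ → ℝ} (hp : IntegrableOn p (Set.Icc 0 1))
    {c c' : Fin (N + 1) → ℝ} (hc : IsExact k N p c) (hc' : IsExact k N p c') :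
    Annihilates k N fun β => c' β - c β := by
  rw [isExact_iff hp] at hc hc'
  intro q hq b
  have h1 := hc q hq b
  have h2 := hc' q hq b
  rw [quadError_eq] at h1 h2
  simp only [sub_mul, Finset.sum_sub_distrib]
  linarith

/-- The residuals of the linear system. -/
noncomputable def residual (k N : ℕ) (p : ℝ → ℝ) (c : Fin (N + 1) → ℝ) (β : Fin (N + 1)) : ℝ :=
  fm (k + 1) p (grid N (β : ℕ)) -
    ∑ γ : Fin (N + 1), c γ * psi (k + 1) (grid N (β : ℕ) - grid N (γ : ℕ))

lemma integral_errKernel_mul_nodeKernel {k N : ℕ} (hN : 1 ≤ N) {p : ℝ → ℝ}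
    (hp : IntegrableOn p (Set.Icc 0 1)) {c v : Fin (N + 1) → ℝ} (hc : IsExact k N p c)
    (hv : Annihilates k N v) :
    ∫ t, errKernel k N p c t * nodeKernel k N v t ∂unitMeasure =
      (-1) ^ (k + 1) * ∑ β : Fin (N + 1), v β * residual k N p c β := by
  have hvi : Integrable (nodeKernel k N v) unitMeasure :=
    (memLp_nodeKernel hN k v).integrable (by norm_num)
  have h1 := quadError_integral hN hp c (measurable_truncGreen k)
    (fun x hx t ht => abs_truncGreen_le k hx ht) hvi
  have hgm : Measurable (Function.uncurry fun x t => green k (x - t)) :=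
    (continuous_green k).measurable.comp (measurable_fst.sub measurable_snd)
  have h2 := quadError_integral hN hp c hgm (fun x hx t ht => abs_green_sub_le k hx ht) hvi
  -- Translates of the untruncated Green function are kernel elements: the exact error functional
  -- kills them in the first variable, and v kills them at the nodes.
  have h3 : ∀ t, quadError N p c (fun x => green k (x - t)) = 0 := by
    intro t
    obtain ⟨q, hq, b, hqb⟩ := green_sub_eq k t
    rw [funext hqb]
    exact (isExact_iff hp).1 hc q hq b
  simp only [h3, zero_mul, integral_zero] at h2
  have h4 : ∀ t, ∑ β : Fin (N + 1), v β * green k (grid N (β : ℕ) - t) = 0 := by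
    intro t
    obtain ⟨q, hq, b, hqb⟩ := green_sub_eq k t
    simp only [hqb]
    exact hv q hq b
  have hcont := continuous_green k
  have h5 : ∀ x ∈ Set.Icc (0 : ℝ) 1, ∫ t, truncGreen k x t * nodeKernel k N v t ∂unitMeasure =
      (-1) ^ (k + 1) * psiSum k N v x +
        (1 / 2) * ∫ t, green k (x - t) * nodeKernel k N v t ∂unitMeasure := by
    intro x hx
    have e1 : ∫ t, truncGreen k x t * nodeKernel k N v t ∂unitMeasure =
        ∑ β : Fin (N + 1), v β *
          ∫ t, truncGreen k x t * truncGreen k (grid N (β : ℕ)) t ∂unitMeasure := by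
      simp only [nodeKernel, Finset.mul_sum, mul_left_comm (truncGreen k x _)]
      rw [integral_finsetSum]
      · simp only [integral_const_mul]
      · intro β _
        refine Integrable.const_mul (integrable_kernel_right (measurable_truncGreen k)
          (fun x hx t ht => abs_truncGreen_le k hx ht) ?_ hx) _
        have := integrable_kernel_right (measurable_truncGreen k)
          (fun x hx t ht => abs_truncGreen_le k hx ht) (integrable_const (1 : ℝ))
          (grid_mem_Icc hN β)
        simpa using this
    have e2 : ∫ t, green k (x - t) * nodeKernel k N v t ∂unitMeasure =
        ∑ β : Fin (N + 1), v β *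
          ∫ t in (0 : ℝ)..grid N (β : ℕ), green k (x - t) * green k (grid N (β : ℕ) - t) := by
      have e : ∀ β : Fin (N + 1), ∫ t in (0 : ℝ)..grid N (β : ℕ),
          green k (x - t) * green k (grid N (β : ℕ) - t) =
          ∫ t, truncGreen k (grid N (β : ℕ)) t * green k (x - t) ∂unitMeasure := by
        intro β
        rw [integral_truncGreen_mul k (grid_mem_Icc hN β)]
        simp only [mul_comm]
      simp only [e, nodeKernel, Finset.mul_sum, mul_left_comm (green k (x - _))]
      rw [integral_finsetSum]
      · simp only [integral_const_mul, mul_comm (green k (x - _))]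
      · intro β _
        simp only [mul_comm (green k (x - _))]
        refine Integrable.const_mul (integrable_kernel_right (measurable_truncGreen k)
          (fun x hx t ht => abs_truncGreen_le k hx ht) ?_ (grid_mem_Icc hN β)) _
        exact (show Continuous fun t => green k (x - t) by fun_prop).continuousOn.integrableOn_Icc
          (a := 0) (b := 1) |>.mono_set Set.Ioc_subset_Icc_self
    have e3 : ∑ β : Fin (N + 1), v β *
        ∫ t in (0 : ℝ)..x, green k (x - t) * green k (grid N (β : ℕ) - t) = 0 := by
      simp only [← intervalIntegral.integral_const_mul]
      rw [← intervalIntegral.integral_finsetSum]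
      · have : ∀ t, ∑ β : Fin (N + 1), v β * (green k (x - t) * green k (grid N (β : ℕ) - t)) = 0 :=
          fun t => by
            simp only [mul_left_comm (v _), ← Finset.mul_sum, h4 t, mul_zero]
        simp only [this, intervalIntegral.integral_zero]
      · intro β _
        apply Continuous.intervalIntegrable
        fun_prop
    rw [e1, e2, psiSum, Finset.mul_sum, Finset.mul_sum, ← Finset.sum_add_distrib,
      ← sub_eq_zero, ← Finset.sum_sub_distrib]
    have e4 : ∀ β : Fin (N + 1), v β *
        (∫ t, truncGreen k x t * truncGreen k (grid N (β : ℕ)) t ∂unitMeasure) -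
        ((-1) ^ (k + 1) * (v β * psi (k + 1) (x - grid N (β : ℕ))) + 1 / 2 * (v β *
          ∫ t in (0 : ℝ)..grid N (β : ℕ), green k (x - t) * green k (grid N (β : ℕ) - t))) =
        1 / 2 * (v β * ∫ t in (0 : ℝ)..x, green k (x - t) * green k (grid N (β : ℕ) - t)) := by
      intro β
      have := two_mul_integral_truncGreen (k := k) hx (grid_mem_Icc hN β)
      linear_combination (v β / 2) * this
    rw [Finset.sum_congr rfl fun β _ => e4 β, ← Finset.mul_sum, e3, mul_zero]
  have hpsi := continuous_psi k
  have hpc : ContinuousOn (fun x => (-1) ^ (k + 1) * psiSum k N v x) (Set.Icc 0 1) := by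
    unfold psiSum
    fun_prop
  -- Applying the error functional in x to `h5` removes the integral with the untruncated Green
  -- function; only the convolution of v with ψ_m is left, whose error is expressed by the
  -- residuals.
  have h6 : ∫ t, errKernel k N p c t * nodeKernel k N v t ∂unitMeasure =
      quadError N p c (fun x => (-1) ^ (k + 1) * psiSum k N v x) := by
    have hgc : ContinuousOn (fun x => ∫ t, green k (x - t) * nodeKernel k N v t ∂unitMeasure)
        (Set.Icc 0 1) := by
      refine continuousOn_of_dominated (bound := fun t => 2 * Real.exp 1 * |nodeKernel k N v t|)
        (fun x hx => ?_) (fun x hx => ?_) (hvi.abs.const_mul _) ?_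
      · exact (integrable_kernel_right hgm (fun x hx t ht => abs_green_sub_le k hx ht) hvi
          hx).aestronglyMeasurable
      · rw [ae_restrict_iff' measurableSet_Ioc]
        refine Filter.Eventually.of_forall fun t ht => ?_
        rw [norm_mul, Real.norm_eq_abs, Real.norm_eq_abs]
        exact mul_le_mul_of_nonneg_right (abs_green_sub_le k hx ht) (abs_nonneg _)
      · exact Filter.Eventually.of_forall fun t => by fun_prop
    refine h1.symm.trans ?_
    rw [quadError_congr hN p c h5, quadError_add hp c (χ := fun x =>
      (1 / 2) * ∫ t, green k (x - t) * nodeKernel k N v t ∂unitMeasure) hpc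
      (continuousOn_const.mul hgc), quadError_const_mul N p c (1 / 2), h2, mul_zero, add_zero]
  rw [h6, quadError_const_mul]
  congr 1
  have h7 := quadError_finset_sum hp c Finset.univ v
    (φ := fun β : Fin (N + 1) => fun x => psi (k + 1) (x - grid N (β : ℕ)))
    (fun β => (hpsi.comp (continuous_id.sub continuous_const)).continuousOn)
  refine h7.trans (Finset.sum_congr rfl fun β _ => ?_)
  rw [residual, quadError, fm]
  congr 2
  refine Finset.sum_congr rfl fun γ _ => ?_
  rw [← psi_neg, neg_sub]

lemma integral_errKernel_add_sq {k N : ℕ} (hN : 1 ≤ N) {p : ℝ → ℝ}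
    (hp : IntegrableOn p (Set.Icc 0 1)) (c v : Fin (N + 1) → ℝ) (s : ℝ) :
    ∫ t, errKernel k N p (fun β => c β + s * v β) t ^ 2 ∂unitMeasure =
      ∫ t, errKernel k N p c t ^ 2 ∂unitMeasure -
        2 * s * ∫ t, errKernel k N p c t * nodeKernel k N v t ∂unitMeasure +
        s ^ 2 * ∫ t, nodeKernel k N v t ^ 2 ∂unitMeasure := by
  have hK := memLp_errKernel hN k hp c
  have hV := memLp_nodeKernel hN k v
  have i1 : Integrable (fun t => errKernel k N p c t ^ 2 -
      2 * s * (errKernel k N p c t * nodeKernel k N v t)) unitMeasure :=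
    hK.integrable_sq.sub ((integrable_mul_of_memLp hK hV).const_mul _)
  have e : ∀ t, errKernel k N p (fun β => c β + s * v β) t ^ 2 =
      errKernel k N p c t ^ 2 - 2 * s * (errKernel k N p c t * nodeKernel k N v t) +
        s ^ 2 * nodeKernel k N v t ^ 2 := fun t => by rw [errKernel_add]; ring
  simp only [e]
  rw [integral_add i1 (hV.integrable_sq.const_mul _), integral_sub hK.integrable_sq
    ((integrable_mul_of_memLp hK hV).const_mul _), integral_const_mul, integral_const_mul]

/-- Double annihilators: a vector orthogonal to everything that annihilates the kernel of the
seminorm comes from the kernel of the seminorm. -/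
lemma exists_expPoly_of_orthogonal {k N : ℕ} {r : Fin (N + 1) → ℝ}
    (hr : ∀ v, Annihilates k N v → ∑ β : Fin (N + 1), v β * r β = 0) :
    ∃ P ∈ Polynomial.degreeLT ℝ k, ∃ d : ℝ, ∀ β : Fin (N + 1),
      r β = expPoly 0 P d (grid N (β : ℕ)) := by
  let lin : (Fin (N + 1) → ℝ) → ((Fin (N + 1) → ℝ) →ₗ[ℝ] ℝ) := fun f =>
    ∑ β, f β • LinearMap.proj β
  have hlin : ∀ f v, lin f v = ∑ β, v β * f β := fun f v => by
    simp [lin, LinearMap.sum_apply, mul_comm]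
  let L : Option (Fin k) → ((Fin (N + 1) → ℝ) →ₗ[ℝ] ℝ) := fun o =>
    o.elim (lin fun β => Real.exp (-grid N (β : ℕ))) fun j => lin fun β => grid N (β : ℕ) ^ (j : ℕ)
  have hmem : lin r ∈ Submodule.span ℝ (Set.range L) := by
    refine mem_span_of_iInf_ker_le_ker fun v hv => ?_
    rw [Submodule.mem_iInf] at hv
    rw [LinearMap.mem_ker, hlin]
    refine hr v fun q hq b => ?_
    have h0 : ∑ β : Fin (N + 1), v β * Real.exp (-grid N (β : ℕ)) = 0 := by
      exact (hlin _ v).symm.trans (LinearMap.mem_ker.1 (hv none))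
    have h1 : ∀ j < k, ∑ β : Fin (N + 1), v β * grid N (β : ℕ) ^ j = 0 := by
      intro j hj
      exact (hlin _ v).symm.trans (LinearMap.mem_ker.1 (hv (some ⟨j, hj⟩)))
    -- Annihilating the basis of the kernel is exactness for the zero weight, so linear extension
    -- from the basis to the whole kernel is already available.
    have hz : IsExact k N 0 v := by
      constructor
      · intro α hα; rw [h1 α hα]; simp [moment]
      · rw [h0]; simp [expMoment]
    have h2 := (isExact_iff (p := 0) integrableOn_zero).1 hz q hq b
    rw [quadError_eq] at h2
    simpa using h2
  obtain ⟨a, ha⟩ := (Submodule.mem_span_range_iff_exists_fun ℝ).1 hmem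
  refine ⟨∑ j : Fin k, Polynomial.C (a (some j)) * Polynomial.X ^ (j : ℕ),
    Submodule.sum_mem _ fun j _ => Polynomial.mem_degreeLT.2
      ((Polynomial.degree_C_mul_X_pow_le _ _).trans_lt (by exact_mod_cast j.2)), a none,
    fun β => ?_⟩
  have h1 := congrArg (fun l : (Fin (N + 1) → ℝ) →ₗ[ℝ] ℝ => l (Pi.single β 1)) ha
  simp only [LinearMap.add_apply, LinearMap.sum_apply, LinearMap.smul_apply, Fintype.sum_option, L, Option.elim_none,
    Option.elim_some, hlin, Pi.single_apply, ite_mul, one_mul, zero_mul, Finset.sum_ite_eq',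
    Finset.mem_univ, if_true, smul_eq_mul] at h1
  rw [← h1, expPoly, Polynomial.eval_finsetSum]
  simp only [Polynomial.eval_mul, Polynomial.eval_C, Polynomial.eval_pow, Polynomial.eval_X]
  ring

theorem exists_solvesSystem_of_isOptimal {k N : ℕ} (hN : 1 ≤ N) {p : ℝ → ℝ}
    (hp : IntegrableOn p (Set.Icc 0 1)) {c : Fin (N + 1) → ℝ} (hc : IsOptimal (k + 1) N p c) :
    ∃ P d, SolvesSystem (k + 1) N p c P d := by
  obtain ⟨hex, hmin⟩ := (isOptimal_iff hN hp).1 hc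
  have horth : ∀ v, Annihilates k N v → ∑ β : Fin (N + 1), v β * residual k N p c β = 0 := by
    intro v hv
    have hI := integral_errKernel_mul_nodeKernel hN hp hex hv
    set I := ∫ t, errKernel k N p c t * nodeKernel k N v t ∂unitMeasure with hIdef
    set n := ∫ t, nodeKernel k N v t ^ 2 ∂unitMeasure with hn
    have hn0 : 0 ≤ n := integral_nonneg fun t => sq_nonneg _
    -- The optimal step would be I/n; the denominator n + 1 avoids dividing by zero and is still
    -- small enough to force I = 0.
    have h1 := hmin _ (hex.add hp hv (I / (n + 1)))
    rw [integral_errKernel_add_sq hN hp, ← hIdef, ← hn] at h1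
    have hpos : 0 < n + 1 := by linarith
    have h2 : 2 * (I / (n + 1)) * I ≤ (I / (n + 1)) ^ 2 * n := by linarith
    have h3 : 2 * I * I * (n + 1) ≤ I ^ 2 * n := by
      have := mul_le_mul_of_nonneg_right h2 (sq_nonneg (n + 1))
      field_simp at this
      linarith
    have h4 : I = 0 := by
      have : I ^ 2 ≤ 0 := by nlinarith [sq_nonneg I]
      exact pow_eq_zero_iff two_ne_zero |>.1 (le_antisymm this (sq_nonneg I))
    rw [h4] at hI
    exact (mul_eq_zero.1 hI.symm).resolve_left (by simp)
  obtain ⟨P, hP, d, hr⟩ := exists_expPoly_of_orthogonal horth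
  refine ⟨P, d, hP, fun β => ?_, fun α hα => hex.1 α (by simpa using hα), hex.2⟩
  have := hr β
  rw [residual, expPoly, zero_mul, zero_add, sub_eq_iff_eq_add'] at this
  rw [this]
  ring

theorem isOptimal_of_solvesSystem {k N : ℕ} (hN : 1 ≤ N) {p : ℝ → ℝ}
    (hp : IntegrableOn p (Set.Icc 0 1)) {c : Fin (N + 1) → ℝ} {P : ℝ[X]} {d : ℝ}
    (hs : SolvesSystem (k + 1) N p c P d) : IsOptimal (k + 1) N p c := by
  obtain ⟨hP, h1, h2, h3⟩ := hs
  have hex : IsExact k N p c := ⟨fun α hα => h2 α (by simpa using hα), h3⟩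
  rw [isOptimal_iff hN hp]
  refine ⟨hex, fun c' hc' => ?_⟩
  have hv := hex.annihilates_sub hp hc'
  have hI := integral_errKernel_mul_nodeKernel hN hp hex hv
  have hres : ∀ β, residual k N p c β = expPoly 0 P d (grid N (β : ℕ)) := fun β => by
    rw [residual, ← h1 β, expPoly]; ring
  simp only [hres] at hI
  rw [hv P hP d, mul_zero] at hI
  -- The residuals come from the seminorm kernel, so the cross term vanishes, and the square norm
  -- for c' exceeds that for c by the square norm of the difference.
  have hsq := integral_errKernel_add_sq (k := k) hN hp c (fun β => c' β - c β) 1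
  rw [hI] at hsq
  have hc'' : (fun β => c β + 1 * (c' β - c β)) = c' := by ext β; ring
  rw [hc''] at hsq
  have hn0 : 0 ≤ ∫ t, nodeKernel k N (fun β => c' β - c β) t ^ 2 ∂unitMeasure :=
    integral_nonneg fun t => sq_nonneg _
  linarith

end OptimalQuadrature

theorem theorem3 (m N : ℕ) (hm : 1 ≤ m) (hN : 1 ≤ N) (hmN : m ≤ N + 1)
    (p : ℝ → ℝ) (hp : IntegrableOn p (Set.Icc 0 1)) :
    -- `P_{2m-2}` has exactly `m - 1` distinct roots `λ_1, …, λ_{m-1}` in the open unit disc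
    (OptimalQuadrature.innerRoots m (1 / (N : ℝ))).card = m - 1 ∧
    -- the series in the definitions of `D_m * f_m`, `a_k` and `b_k` converge
    (∀ β : ℤ, Summable fun γ : ℤ =>
      OptimalQuadrature.discD m (1 / (N : ℝ)) (β - γ) *
        ((OptimalQuadrature.fm m p (OptimalQuadrature.grid N γ) : ℝ) : ℂ)) ∧
    (∀ (Q : Polynomial ℝ) (a : ℝ), ∀ z ∈ OptimalQuadrature.innerRoots m (1 / (N : ℝ)),
      Summable (fun γ : ℕ =>
        z ^ (γ + 1) * ((OptimalQuadrature.leftTerm m N p Q a (γ + 1) : ℝ) : ℂ)) ∧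
      Summable (fun γ : ℕ =>
        z ^ (γ + 1) * ((OptimalQuadrature.rightTerm m N p Q a (γ + 1) : ℝ) : ℂ))) ∧
    -- optimal coefficients have the stated form
    (∀ c : Fin (N + 1) → ℝ, OptimalQuadrature.IsOptimal m N p c →
      ∃ (P : Polynomial ℝ) (d : ℝ) (Qm Qp : Polynomial ℝ) (am ap : ℝ),
        OptimalQuadrature.SolvesSystem m N p c P d ∧
        Qm = P + OptimalQuadrature.polyQlow m N c ∧
        Qp = P - OptimalQuadrature.polyQlow m N c ∧
        am = d + OptimalQuadrature.constD N c ∧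
        ap = d - OptimalQuadrature.constD N c ∧
        OptimalQuadrature.SolvesOuter m N p Qm Qp am ap ∧
        ∀ β : Fin (N + 1),
          ((c β : ℝ) : ℂ) = OptimalQuadrature.explicitCoef m N p Qm Qp am ap (β : ℕ)) ∧
    -- and any solution `Q^{(±)}`, `a^±` of the outer equations gives the optimal coefficients
    (∀ (Qm Qp : Polynomial ℝ) (am ap : ℝ), OptimalQuadrature.SolvesOuter m N p Qm Qp am ap →
      ∃ c : Fin (N + 1) → ℝ, OptimalQuadrature.IsOptimal m N p c ∧
        ∀ β : Fin (N + 1),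
          ((c β : ℝ) : ℂ) = OptimalQuadrature.explicitCoef m N p Qm Qp am ap (β : ℕ)) := by
  obtain ⟨k, rfl⟩ : ∃ k, m = k + 1 := ⟨m - 1, by omega⟩
  have hk : k ≤ N := by omega
  refine ⟨OptimalQuadrature.card_innerRoots (OptimalQuadrature.mesh_pos hN) k,
    OptimalQuadrature.summable_conv_fm hN hk hp,
    fun Q a z hz => ⟨OptimalQuadrature.summable_left hN hk hp Q a hz,
      OptimalQuadrature.summable_right hN hk hp Q a hz⟩, fun c hc => ?_, fun Qm Qp am ap ho => ?_⟩
  · obtain ⟨P, d, hs⟩ := OptimalQuadrature.exists_solvesSystem_of_isOptimal hN hp hc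
    refine ⟨P, d, _, _, _, _, hs, rfl, rfl, rfl, rfl,
      OptimalQuadrature.solvesOuter_of_solvesSystem hN hk hp hs, fun β => ?_⟩
    rw [← OptimalQuadrature.conv_uFun_eq_explicitCoef hN hk hp _ _ _ _ (Nat.lt_succ_iff.1 β.2),
      OptimalQuadrature.conv_uFun_of_solvesSystem hN hk hs,
      OptimalQuadrature.act_genPoly_unitSeq_of_le]
  · obtain ⟨c, P, d, hs, hc⟩ := OptimalQuadrature.solvesSystem_of_solvesOuter hN hk hp ho
    refine ⟨c, OptimalQuadrature.isOptimal_of_solvesSystem hN hp hs, fun β => ?_⟩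
    rw [hc β, OptimalQuadrature.conv_uFun_eq_explicitCoef hN hk hp _ _ _ _
      (Nat.lt_succ_iff.1 β.2)]
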